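/- Fix $T\in(0,\infty)$, a finite measure $\rho$ on $\mathbb Z$ and a function $\gamma:\mathbb Z^4\to\mathbb R$ for which there are constants $\gamma_y\in[0,\infty)$, $y\in\mathbb Z$, with $0\le\gamma(y,x,\tilde x,\tilde\xi)\le\gamma_y$ for all $y,x,\tilde x,\tilde\xi\in\mathbb Z$ and $\int_{\mathbb Z}|y|\gamma_y\,\rho(dy)<\infty$. For $\nu\in\mathcal P(\mathbb Z^2)$ put $\Gamma(y,x,\nu)=\int_{\mathbb Z^2}\gamma(y,x,\tilde x,\tilde\xi)\,\nu(d\tilde x\,d\tilde\xi)$. Write $\mathbb D([0,T]:S)$ for the space of right continuous paths with left limits with the Skorokhod topology, $\mathcal P(\cdot)$ for the space of probability measures with the weak topology, $\mathcal L(\cdot)$ for the law of a random element, $[n]=\{1,\dots,n\}$, $\|x\|_{*,T}=\sup_{0\le s\le T}|x(s)|$ and $\mathbb X_t=[0,t]\times\mathbb Z\times\mathbb R_+$. On a filtered probability space $(\Omega,\mathcal F,\mathbb P,\{\mathcal F_t\}_{0\le t\le T})$ let the following be given for $i,j\in\mathbb N$: i.i.d. $\mathcal F_0$-measurable $\mathbb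 Z$-valued $X_i(0)$; i.i.d. Poisson random measures $N_i$ on $\mathbb X_T$ with intensity $ds\times\rho(dy)\times dz$, which are Poisson with respect to $\{\mathcal F_t\}$ (their restrictions to times in $[0,t]$ are $\mathcal F_t$-measurable, and the family of their restrictions to times in $(t,T]$ is independent of $\mathcal F_t$); and i.i.d. adapted, possibly non-Markovian processes $\xi_{ij}$ with paths in $\mathbb D([0,T]:\mathbb Z)$ and common law $\theta$. The families $\{X_i(0)\}$ and $\{N_i\}$ are independent of each other, and $\{\xi_{ij}\}$ is independent of $\{X_i(0),N_i\}$. Let $\theta(t)$ be the law of $\xi_{ij}(t)$. Solutions below are processes with paths in $\mathbb D([0,T]:\mathbb Z)$, adapted to the completed filtration, that satisfy the equations almost surely. The $n$-node system is $$X_i^n(t)=X_i(0)+\int_{\mathbb X_t}y\,\mathbf 1_{[0,\Gamma(y,X_i^n(s-),\nu_i^n(s-))]}(z)\,N_i(ds\,dy\,dz),\qquad \nu_i^n(t)=\frac1n\sum_{j=1}^n\delta_{(X_j^n(t),\xi_{ij}(t))},\qquad i\in[n],$$ and the limiting system is $$X_i(t)=X_i(0)+\int_{\mathbb X_t}y\,\mathbf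 1_{[0,\Gamma(y,X_i(s-),\nu(s-))]}(z)\,N_i(ds\,dy\,dz),\qquad \nu(t)=\mathcal L(X_i(t))\otimes\mathcal L(\xi_{ij}(t)),\qquad i,j\in\mathbb N.$$ Then the following hold. (a) The limiting system has a solution, and it is pathwise unique: for any two solutions $(X,\nu)$ and $(X',\nu')$ one has $\nu=\nu'$ and, almost surely, $X_i=X_i'$ for all $i$. (b) There is $\kappa<\infty$, depending only on $T$, $\rho$ and $\gamma$, such that for all $n\ge1$ $$\max_{i\in[n]}\mathbb E\|X_i^n-X_i\|_{*,T}\le\frac{\kappa}{\sqrt n}.$$ (c) (Propagation of chaos) All $X_i$ have the same law $\mu\in\mathcal P(\mathbb D([0,T]:\mathbb Z))$. With $\mu(t)=\mathcal L(X_i(t))$ one has, for every $k$, as $n\to\infty$, $$\mathcal L(X_1^n,\dots,X_k^n)\to\mu^{\otimes k},\qquad \mathcal L(X_1^n(t),\dots,X_k^n(t))\to\mu(t)^{\otimes k}\quad\text{for each }t\in[0,T].$$ (d) (Law of large numbers) As $n\to\infty$, for each node $i$, and more generally along every sequence of nodes $i=i_n$ with $i_n\in[n]$ for all large $n$, $$\frac1n\sum_{j=1}^n\delta_{(X_j^n(\cdot),\xi_{ij}(\cdot))}\to\mu\otimes\theta\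 \text{ in }\mathcal P(\mathbb D([0,T]:\mathbb Z^2)),\qquad \nu_i^n(t)\to\nu(t)=\mu(t)\otimes\theta(t)\ \text{ in }\mathcal P(\mathbb Z^2)\ \text{ for each }t\in[0,T],$$ in probability, where $\mu\otimes\theta$ is regarded as a law of $\mathbb Z^2$-valued paths. Moreover, $$\frac1n\sum_{i=1}^n\delta_{X_i^n(\cdot)}\to\mu\ \text{ in }\mathcal P(\mathbb D([0,T]:\mathbb Z)),\qquad \frac1n\sum_{i=1}^n\delta_{X_i^n(t)}\to\mu(t)\ \text{ in }\mathcal P(\mathbb Z)\ \text{ for each }t\in[0,T],$$ in probability. -/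

import Mathlib

open MeasureTheory ProbabilityTheory Filter Topology Set
open scoped NNReal ENNReal

namespace EdgeMeanField

/-- The space `𝔻([0,T] : S)` of right continuous paths with left limits. The time set is the
subtype `[0,T]`, so the condition on the left is empty at `0` and the one on the right at `T`. -/
@[ext]
structure PathSpace (T : ℝ) (S : Type*) [TopologicalSpace S] where
  toFun : Icc (0 : ℝ) T → S
  right_continuous : ∀ t, ContinuousWithinAt toFun (Ici t) t
  left_limit : ∀ t, ∃ l, Tendsto toFun (𝓝[<] t) (𝓝 l)

namespace PathSpace

variable {T : ℝ}

instance {S : Type*} [TopologicalSpace S] : CoeFun (PathSpace T S) (fun _ => Icc (0 : ℝ) T → S) :=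
  ⟨PathSpace.toFun⟩

/-- The `σ`-field generated by the coordinate maps, which for separable metric `S` is the Borel
`σ`-field of the Skorokhod topology; the inclusion of the Borel `σ`-field is proved below. -/
instance {S : Type*} [TopologicalSpace S] [MeasurableSpace S] : MeasurableSpace (PathSpace T S) :=
  MeasurableSpace.comap PathSpace.toFun MeasurableSpace.pi

theorem measurable_eval {S : Type*} [TopologicalSpace S] [MeasurableSpace S] (t : Icc (0 : ℝ) T) :
    Measurable (fun x : PathSpace T S => x t) :=
  (measurable_pi_apply t).comp (comap_measurable PathSpace.toFun)

theorem measurable_of_eval {S : Type*} [TopologicalSpace S] [MeasurableSpace S]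
    {Ω : Type*} [MeasurableSpace Ω] {X : Ω → PathSpace T S}
    (h : ∀ t, Measurable (fun ω => X ω t)) : Measurable X := by
  rw [measurable_comap_iff]
  exact measurable_pi_lambda _ h

/-- The Skorokhod distance, and with it the Skorokhod (J1) topology: the infimum over the
increasing bijections `l` of `[0,T]` of `max (sup |l t - t|) (sup d(x t, y (l t)))`. -/
noncomputable instance {S : Type*} [PseudoEMetricSpace S] : PseudoEMetricSpace (PathSpace T S) where
  edist x y := ⨅ l : Icc (0 : ℝ) T ≃o Icc (0 : ℝ) T,
    max (⨆ t, edist (l t) t) (⨆ t, edist (x t) (y (l t)))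
  edist_self x := by
    refine le_antisymm ((iInf_le _ (OrderIso.refl _)).trans ?_) zero_le
    simp
  edist_comm := by
    have key : ∀ x y : PathSpace T S,
        (⨅ l : Icc (0 : ℝ) T ≃o Icc (0 : ℝ) T,
          max (⨆ t, edist (l t) t) (⨆ t, edist (y t) (x (l t)))) ≤
        ⨅ l : Icc (0 : ℝ) T ≃o Icc (0 : ℝ) T,
          max (⨆ t, edist (l t) t) (⨆ t, edist (x t) (y (l t))) := by
      intro x y
      refine le_iInf fun l => (iInf_le _ l.symm).trans ?_
      refine max_le_max (iSup_le fun t => ?_) (iSup_le fun t => ?_)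
      · refine le_trans (le_of_eq ?_) (le_iSup _ (l.symm t))
        simp [edist_comm]
      · refine le_trans (le_of_eq ?_) (le_iSup _ (l.symm t))
        simp [edist_comm]
    exact fun x y => le_antisymm (key y x) (key x y)
  edist_triangle x y z := by
    refine ENNReal.le_iInf_add_iInf fun l m => (iInf_le _ (l.trans m)).trans ?_
    refine max_le (iSup_le fun t => ?_) (iSup_le fun t => ?_)
    · calc edist ((l.trans m) t) t ≤ edist (m (l t)) (l t) + edist (l t) t := edist_triangle _ _ _
        _ ≤ _ := by
          rw [add_comm]
          exact add_le_add (le_max_of_le_left (le_iSup (fun t => edist (l t) t) t))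
            (le_max_of_le_left (le_iSup (fun t => edist (m t) t) (l t)))
    · calc edist (x t) (z ((l.trans m) t)) ≤ edist (x t) (y (l t)) + edist (y (l t)) (z (m (l t))) :=
            edist_triangle _ _ _
        _ ≤ _ := add_le_add (le_max_of_le_right (le_iSup (fun t => edist (x t) (y (l t))) t))
            (le_max_of_le_right (le_iSup (fun t => edist (y t) (z (m t))) (l t)))

theorem edist_def {S : Type*} [PseudoEMetricSpace S] (x y : PathSpace T S) :
    edist x y = ⨅ l : Icc (0 : ℝ) T ≃o Icc (0 : ℝ) T,
      max (⨆ t, edist (l t) t) (⨆ t, edist (x t) (y (l t))) := rfl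

/-- Finitely many interior times can be moved to any sufficiently near ones by a time change
that is uniformly near to the identity. -/
theorem exists_timeChange (B : Finset ℝ) (hB : ∀ b ∈ B, 0 < b ∧ b < T) {δ : ℝ} (hδ : 0 < δ) :
    ∀ᶠ ε in 𝓝[>] (0 : ℝ), ∀ p : ℝ → ℝ, (∀ b ∈ B, |p b - b| ≤ ε) →
      ∃ l : Icc (0 : ℝ) T ≃o Icc (0 : ℝ) T, (∀ t, |(l t : ℝ) - t| ≤ δ) ∧
        ∀ b ∈ B, ∀ t : Icc (0 : ℝ) T, (p b ≤ t ↔ b ≤ l t) := by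
  classical
  obtain ⟨η, hη, hη0, hηT, hηB⟩ : ∃ η : ℝ, 0 < η ∧ (∀ b ∈ B, 2 * η ≤ b) ∧
      (∀ b ∈ B, 2 * η ≤ T - b) ∧ ∀ b ∈ B, ∀ c ∈ B, b ≠ c → 3 * η ≤ |b - c| := by
    have h1 : ∀ᶠ η : ℝ in 𝓝[>] 0, ∀ b ∈ B, 2 * η ≤ b := by
      rw [Filter.eventually_all_finset]
      intro b hb
      have : Tendsto (fun η : ℝ => 2 * η) (𝓝[>] 0) (𝓝 (2 * 0)) :=
        (tendsto_id.const_mul 2).mono_left nhdsWithin_le_nhds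
      exact this.eventually_le_const (by simpa using (hB b hb).1)
    have h2 : ∀ᶠ η : ℝ in 𝓝[>] 0, ∀ b ∈ B, 2 * η ≤ T - b := by
      rw [Filter.eventually_all_finset]
      intro b hb
      have : Tendsto (fun η : ℝ => 2 * η) (𝓝[>] 0) (𝓝 (2 * 0)) :=
        (tendsto_id.const_mul 2).mono_left nhdsWithin_le_nhds
      exact this.eventually_le_const (by simpa using (hB b hb).2)
    have h3 : ∀ᶠ η : ℝ in 𝓝[>] 0, ∀ b ∈ B, ∀ c ∈ B, b ≠ c → 3 * η ≤ |b - c| := by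
      rw [Filter.eventually_all_finset]
      intro b hb
      rw [Filter.eventually_all_finset]
      intro c hc
      by_cases hbc : b = c
      · simp [hbc]
      have : Tendsto (fun η : ℝ => 3 * η) (𝓝[>] 0) (𝓝 (3 * 0)) :=
        (tendsto_id.const_mul 3).mono_left nhdsWithin_le_nhds
      filter_upwards [this.eventually_le_const (u := |b - c|)
        (by simpa [sub_eq_zero] using hbc)] with η h _ using h
    obtain ⟨η, h⟩ := (h1.and (h2.and (h3.and self_mem_nhdsWithin))).exists
    exact ⟨η, h.2.2.2, h.1, h.2.1, h.2.2.1⟩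
  have e1 : ∀ᶠ ε : ℝ in 𝓝[>] 0, ε ≤ η := by
    exact (tendsto_id.mono_left nhdsWithin_le_nhds : Tendsto id (𝓝[>] (0:ℝ)) (𝓝 0)).eventually_le_const hη
  have e2 : ∀ᶠ ε : ℝ in 𝓝[>] 0, B.card * ε ≤ δ := by
    have : Tendsto (fun ε : ℝ => B.card * ε) (𝓝[>] 0) (𝓝 (B.card * 0)) :=
      (tendsto_id.const_mul _).mono_left nhdsWithin_le_nhds
    exact this.eventually_le_const (by simpa using hδ)
  have e3 : ∀ᶠ ε : ℝ in 𝓝[>] 0, B.card * ε < η := by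
    have : Tendsto (fun ε : ℝ => B.card * ε) (𝓝[>] 0) (𝓝 (B.card * 0)) :=
      (tendsto_id.const_mul _).mono_left nhdsWithin_le_nhds
    exact this.eventually_lt_const (by simpa using hη)
  filter_upwards [e1, e2, e3, self_mem_nhdsWithin] with ε h1 h2 h3 h0 p hp
  have h0 : 0 < ε := h0
  by_cases hT : T < 0
  · refine ⟨OrderIso.refl _, fun t => ?_, fun b hb t => ?_⟩ <;>
    exact absurd (t.2.1.trans t.2.2) (not_le.2 hT)
  have hT : 0 ≤ T := not_lt.1 hT
  -- tents
  let τ : ℝ → ℝ → ℝ := fun b t => max 0 (1 - |t - p b| / η)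
  have τ0 : ∀ b t, 0 ≤ τ b t := fun b t => le_max_left _ _
  have τ1 : ∀ b t, τ b t ≤ 1 := fun b t => max_le zero_le_one (by
    have := div_nonneg (abs_nonneg (t - p b)) hη.le
    linarith)
  have τp : ∀ b, τ b (p b) = 1 := fun b => by simp [τ]
  have τz : ∀ b t, η ≤ |t - p b| → τ b t = 0 := fun b t h => by
    apply max_eq_left
    have := (one_le_div hη).2 h
    linarith
  have τl : ∀ b s t, |τ b t - τ b s| ≤ |t - s| / η := fun b s t => by
    have e : ∀ t, τ b t = max (1 - |t - p b| / η) 0 := fun t => max_comm _ _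
    rw [e, e]
    refine (abs_max_sub_max_le_abs _ _ _).trans ?_
    rw [sub_sub_sub_cancel_left, ← sub_div, abs_div, abs_of_pos hη]
    refine div_le_div_of_nonneg_right ((abs_abs_sub_abs_le _ _).trans ?_) hη.le
    rw [sub_sub_sub_cancel_right, abs_sub_comm]
  let f : ℝ → ℝ := fun t => t + ∑ b ∈ B, (b - p b) * τ b t
  have fc : Continuous f := by
    simp only [f, τ]
    fun_prop
  have fm : StrictMono f := by
    intro s t hst
    have : |∑ b ∈ B, (b - p b) * (τ b t - τ b s)| ≤ (B.card * ε) * ((t - s) / η) := by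
      refine (Finset.abs_sum_le_sum_abs _ _).trans ?_
      rw [mul_assoc, ← nsmul_eq_mul]
      refine Finset.sum_le_card_nsmul _ _ _ fun b hb => ?_
      rw [abs_mul, abs_sub_comm b]
      refine mul_le_mul (hp b hb) ((τl b s t).trans (by rw [abs_of_pos (sub_pos.2 hst)]))
        (abs_nonneg _) h0.le
    have h4 : (B.card * ε) * ((t - s) / η) < t - s := by
      rw [mul_div_assoc', div_lt_iff₀ hη, mul_comm]
      exact mul_lt_mul_of_pos_left h3 (sub_pos.2 hst)
    have h5 : f t - f s = (t - s) + ∑ b ∈ B, (b - p b) * (τ b t - τ b s) := by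
      simp only [f, mul_sub, Finset.sum_sub_distrib]
      ring
    have := neg_le_of_abs_le this
    linarith
  have fd : ∀ t, |f t - t| ≤ δ := by
    intro t
    refine le_trans ?_ h2
    simp only [f, add_sub_cancel_left]
    refine (Finset.abs_sum_le_sum_abs _ _).trans ?_
    rw [← nsmul_eq_mul]
    refine Finset.sum_le_card_nsmul _ _ _ fun b hb => ?_
    rw [abs_mul, abs_sub_comm b, abs_of_nonneg (τ0 b t)]
    exact (mul_le_of_le_one_right (abs_nonneg _) (τ1 b t)).trans (hp b hb)
  have fb : ∀ b ∈ B, f (p b) = b := by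
    intro b hb
    have : ∑ c ∈ B, (c - p c) * τ c (p b) = (b - p b) * τ b (p b) := by
      refine Finset.sum_eq_single_of_mem b hb fun c hc hcb => ?_
      rw [τz, mul_zero]
      have := hηB b hb c hc hcb.symm
      have hb' := abs_le.1 (hp b hb)
      have hc' := abs_le.1 (hp c hc)
      rw [le_abs] at this ⊢
      rcases this with h | h
      · left; linarith
      · right; linarith
    simp only [f, this, τp]
    ring
  have f0 : f 0 = 0 := by
    simp only [f, zero_add]
    refine Finset.sum_eq_zero fun b hb => ?_
    rw [τz, mul_zero]
    have hb' := abs_le.1 (hp b hb)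
    have := hη0 b hb
    rw [le_abs]
    right; linarith
  have fT : f T = T := by
    simp only [f, add_eq_left]
    refine Finset.sum_eq_zero fun b hb => ?_
    rw [τz, mul_zero]
    have hb' := abs_le.1 (hp b hb)
    have := hηT b hb
    rw [le_abs]
    left; linarith
  have fI : ∀ t : Icc (0 : ℝ) T, f t ∈ Icc (0 : ℝ) T := fun t =>
    ⟨f0.symm.le.trans (fm.monotone t.2.1), (fm.monotone t.2.2).trans fT.le⟩
  let g : Icc (0 : ℝ) T → Icc (0 : ℝ) T := fun t => ⟨f t, fI t⟩
  have gm : StrictMono g := fun s t h => fm h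
  have gs : Function.Surjective g := by
    intro u
    have := intermediate_value_Icc hT fc.continuousOn
    rw [f0, fT] at this
    obtain ⟨t, ht, htu⟩ := this u.2
    exact ⟨⟨t, ht⟩, Subtype.ext htu⟩
  refine ⟨gm.orderIsoOfSurjective g gs, fun t => fd t, fun b hb t => ?_⟩
  show p b ≤ t ↔ b ≤ f t
  rw [← fm.le_iff_le, fb b hb]


/-- Rounding a time down to the grid of mesh `1 / (m + 1)`, the terminal time being kept. -/
noncomputable def roundDown (T : ℝ) (m : ℕ) (t : Icc (0 : ℝ) T) : Icc (0 : ℝ) T :=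
  open Classical in
  if (t : ℝ) = T then t else
    ⟨⌊(t : ℝ) * (m + 1)⌋₊ / (m + 1), by positivity, by
      refine le_trans ?_ t.2.2
      rw [div_le_iff₀ (by positivity)]
      exact Nat.floor_le (mul_nonneg t.2.1 (by positivity))⟩

theorem roundDown_finite (T : ℝ) (m : ℕ) : (range (roundDown T m)).Finite := by
  have : ((fun u : Icc (0 : ℝ) T => (u : ℝ)) '' range (roundDown T m)) ⊆
      insert T ((fun k : ℕ => (k : ℝ) / (m + 1)) '' (Finset.range (⌊T * (m + 1)⌋₊ + 1) : Set ℕ)) := by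
    rintro _ ⟨_, ⟨t, rfl⟩, rfl⟩
    by_cases h : (t : ℝ) = T
    · left
      simp [roundDown, h]
    · right
      refine ⟨⌊(t : ℝ) * (m + 1)⌋₊, ?_, by simp [roundDown, h]⟩
      simp only [Finset.coe_range, mem_Iio, Nat.lt_succ_iff]
      exact Nat.floor_mono (mul_le_mul_of_nonneg_right t.2.2 (by positivity))
  exact Set.Finite.of_finite_image
    ((((Finset.finite_toSet _).image _).insert _).subset this) Subtype.val_injective.injOn

/-- The step path that samples a function on the grid. -/
noncomputable def stepPath {S : Type*} [TopologicalSpace S] (m : ℕ)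
    (v : range (roundDown T m) → S) : PathSpace T S where
  toFun t := v ⟨roundDown T m t, t, rfl⟩
  right_continuous t := by
    by_cases h : (t : ℝ) = T
    · have : Ici t = {t} := by
        ext s
        simp only [mem_Ici, mem_singleton_iff]
        exact ⟨fun hs => le_antisymm (show (s : ℝ) ≤ t from s.2.2.trans h.ge) hs, fun hs => hs.ge⟩
      rw [this]
      exact continuousWithinAt_singleton
    · have h1 : ∀ᶠ s : Icc (0 : ℝ) T in 𝓝 t, (s : ℝ) * (m + 1) < ⌊(t : ℝ) * (m + 1)⌋₊ + 1 :=
        ((continuous_subtype_val.mul continuous_const).tendsto t).eventually_lt_const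
          (Nat.lt_floor_add_one _)
      have h2 : ∀ᶠ s : Icc (0 : ℝ) T in 𝓝 t, (s : ℝ) < T :=
        (continuous_subtype_val.tendsto t).eventually_lt_const (lt_of_le_of_ne t.2.2 h)
      refine ContinuousWithinAt.congr_of_eventuallyEq (f := fun _ => v ⟨roundDown T m t, t, rfl⟩)
        continuousWithinAt_const ?_ rfl
      filter_upwards [mem_nhdsWithin_of_mem_nhds h1, mem_nhdsWithin_of_mem_nhds h2,
        self_mem_nhdsWithin] with s hs1 hs2 hs3
      congr 2
      have : ⌊(s : ℝ) * (m + 1)⌋₊ = ⌊(t : ℝ) * (m + 1)⌋₊ := by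
        refine (Nat.floor_eq_iff (mul_nonneg s.2.1 (by positivity))).2 ⟨?_, hs1⟩
        exact (Nat.floor_le (mul_nonneg t.2.1 (by positivity))).trans
          (mul_le_mul_of_nonneg_right (show (t : ℝ) ≤ s from hs3) (by positivity))
      simp only [roundDown, h, hs2.ne, if_false, this]
  left_limit t := by
    rcases eq_or_neBot (𝓝[<] t) with hb | hb
    · exact ⟨v ⟨roundDown T m t, t, rfl⟩, by rw [hb]; exact tendsto_bot⟩
    obtain ⟨k, hk⟩ : ∃ k : ℕ, ∀ᶠ s : Icc (0 : ℝ) T in 𝓝[<] t, ⌊(s : ℝ) * (m + 1)⌋₊ = k := by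
      by_cases ht : (t : ℝ) ≤ 0
      · refine ⟨0, ?_⟩
        filter_upwards [self_mem_nhdsWithin] with s hs
        exact absurd (s.2.1.trans_lt (show (s : ℝ) < t from hs)) (not_lt.2 ht)
      · have hp : 0 < (t : ℝ) * (m + 1) := mul_pos (not_le.1 ht) (by positivity)
        obtain ⟨k, hk⟩ := Nat.exists_eq_add_one.2 (Nat.ceil_pos.2 hp)
        have h1 : (k : ℝ) < (t : ℝ) * (m + 1) := Nat.lt_ceil.1 (by omega)
        have h2 : (t : ℝ) * (m + 1) ≤ k + 1 := by
          have := Nat.le_ceil ((t : ℝ) * (m + 1))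
          rw [hk] at this
          exact_mod_cast this
        refine ⟨k, ?_⟩
        have h3 : ∀ᶠ s : Icc (0 : ℝ) T in 𝓝 t, (k : ℝ) < (s : ℝ) * (m + 1) :=
          ((continuous_subtype_val.mul continuous_const).tendsto t).eventually_const_lt h1
        filter_upwards [self_mem_nhdsWithin, mem_nhdsWithin_of_mem_nhds h3] with s hs hs3
        refine (Nat.floor_eq_iff (mul_nonneg s.2.1 (by positivity))).2 ⟨hs3.le, ?_⟩
        exact (mul_lt_mul_of_pos_right (show (s : ℝ) < t from hs) (by positivity)).trans_le h2
    have hk' := hk.and (self_mem_nhdsWithin : Iio t ∈ 𝓝[<] t)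
    obtain ⟨s₀, h₀, h₀'⟩ := hk'.exists
    refine ⟨v ⟨roundDown T m s₀, s₀, rfl⟩, tendsto_const_nhds.congr' ?_⟩
    filter_upwards [hk'] with s hs
    congr 2
    have n0 : (s₀ : ℝ) ≠ T := ((show (s₀ : ℝ) < t from h₀').trans_le t.2.2).ne
    have n1 : (s : ℝ) ≠ T := ((show (s : ℝ) < t from hs.2).trans_le t.2.2).ne
    simp only [roundDown, n0, n1, if_false, h₀, hs.1]

theorem continuous_stepPath {S : Type*} [PseudoEMetricSpace S] (m : ℕ) :
    Continuous (stepPath (T := T) (S := S) m) := by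
  have := (roundDown_finite T m).fintype
  refine (LipschitzWith.of_edist_le (f := stepPath (T := T) (S := S) m) fun v w => ?_).continuous
  refine (iInf_le _ (OrderIso.refl _)).trans ?_
  refine max_le (iSup_le fun t => by simp) (iSup_le fun t => ?_)
  exact edist_le_pi_edist v w ⟨roundDown T m t, t, rfl⟩

/-- The restriction of a path to the grid. -/
noncomputable def sample {S : Type*} [TopologicalSpace S] (m : ℕ) (x : PathSpace T S) :
    range (roundDown T m) → S := fun u => x u

theorem tendsto_stepPath_sample {S : Type*} [PseudoEMetricSpace S] (x : PathSpace T S) :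
    Tendsto (fun m => stepPath m (sample m x)) atTop (𝓝 x) := by
  rw [tendsto_iff_edist_tendsto_0, ENNReal.tendsto_nhds_zero]
  intro ε hε
  -- neighbourhoods on whose two halves the path oscillates little
  have hU : ∀ s : Icc (0 : ℝ) T, ∃ U : Set (Icc (0 : ℝ) T), IsOpen U ∧ s ∈ U ∧
      ∀ u ∈ U, ∀ v ∈ U, (s ≤ u ↔ s ≤ v) → edist (x u) (x v) ≤ ε := by
    intro s
    have hε2 : 0 < ε / 2 := ENNReal.half_pos hε.ne'
    obtain ⟨l, hl⟩ := x.left_limit s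
    have h1 := EMetric.tendsto_nhds.1 hl _ hε2
    have h2 := EMetric.tendsto_nhds.1 (x.right_continuous s) _ hε2
    rw [eventually_nhdsWithin_iff] at h1 h2
    obtain ⟨U, hU, hUo, hUs⟩ := eventually_nhds_iff.1 (h1.and h2)
    refine ⟨U, hUo, hUs, fun u hu v hv h => ?_⟩
    have key : ∀ c, edist (x u) c < ε / 2 → edist (x v) c < ε / 2 → edist (x u) (x v) ≤ ε := by
      intro c h3 h4
      refine (edist_triangle_right _ _ c).trans ?_
      exact (add_le_add h3.le h4.le).trans (ENNReal.add_halves ε).le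
    by_cases hsu : s ≤ u
    · exact key _ ((hU u hu).2 hsu) ((hU v hv).2 (h.1 hsu))
    · exact key _ ((hU u hu).1 (not_le.1 hsu)) ((hU v hv).1 (not_le.1 (mt h.2 hsu)))
  choose U hUo hUs hUe using hU
  obtain ⟨F, hF⟩ := isCompact_univ.elim_finite_subcover U hUo
    (fun s _ => mem_iUnion.2 ⟨s, hUs s⟩)
  obtain ⟨δ, hδ, hL⟩ := lebesgue_number_lemma_of_metric (c := fun s : F => U s)
    (isCompact_univ (X := Icc (0 : ℝ) T)) (fun s => hUo s) (by
      intro a ha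
      obtain ⟨s, hs, has⟩ := mem_iUnion₂.1 (hF ha)
      exact mem_iUnion.2 ⟨⟨s, hs⟩, has⟩)
  obtain ⟨ε', hε', hεε'⟩ : ∃ ε' : ℝ, 0 < ε' ∧ ENNReal.ofReal ε' ≤ ε := by
    obtain ⟨q, hq, hq'⟩ := ENNReal.lt_iff_exists_nnreal_btwn.1 hε
    exact ⟨q, by exact_mod_cast hq, by simpa using hq'.le⟩
  classical
  let B : Finset ℝ := (F.image (fun s : Icc (0 : ℝ) T => (s : ℝ))).filter fun b => 0 < b ∧ b < T
  have hB : ∀ b ∈ B, 0 < b ∧ b < T := fun b hb => (Finset.mem_filter.1 hb).2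
  have hm : Tendsto (fun m : ℕ => 1 / ((m : ℝ) + 1)) atTop (𝓝[>] 0) :=
    tendsto_nhdsWithin_iff.2 ⟨tendsto_one_div_add_atTop_nhds_zero_nat,
      Eventually.of_forall fun m => by simp only [mem_Ioi]; positivity⟩
  filter_upwards [hm.eventually (exists_timeChange B hB (lt_min (half_pos hδ) hε')),
    tendsto_one_div_add_atTop_nhds_zero_nat.eventually_lt_const (half_pos hδ)] with m h1 h2
  have hc : (0 : ℝ) < m + 1 := by positivity
  obtain ⟨l, hl, hlB⟩ := h1 (fun b => ⌈b * (m + 1)⌉₊ / (m + 1)) (by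
    intro b hb
    have hb0 : 0 ≤ b * (m + 1) := mul_nonneg (hB b hb).1.le hc.le
    have e : (⌈b * (m + 1)⌉₊ : ℝ) / (m + 1) - b = (⌈b * (m + 1)⌉₊ - b * (m + 1)) / (m + 1) := by
      field_simp
    rw [e, abs_of_nonneg (div_nonneg (sub_nonneg.2 (Nat.le_ceil _)) hc.le)]
    exact div_le_div_of_nonneg_right (by linarith [Nat.ceil_lt_add_one hb0]) hc.le)
  refine (iInf_le _ l).trans (max_le (iSup_le fun t => ?_) (iSup_le fun t => ?_))
  · refine le_trans ?_ hεε'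
    rw [edist_dist]
    exact ENNReal.ofReal_le_ofReal ((hl t).trans (min_le_right _ _))
  show edist (x (roundDown T m t)) (x (l t)) ≤ ε
  have hlT : (l t : ℝ) = T ↔ (t : ℝ) = T := by
    have top : ∀ l : Icc (0 : ℝ) T ≃o Icc (0 : ℝ) T, ∀ t : Icc (0 : ℝ) T, (t : ℝ) = T → (l t : ℝ) = T := by
      intro l t ht
      have : l.symm (⟨T, t.2.1.trans t.2.2, le_rfl⟩ : Icc (0 : ℝ) T) ≤ t :=
        show ((l.symm _ : Icc (0 : ℝ) T) : ℝ) ≤ t from (l.symm _).2.2.trans ht.ge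
      exact le_antisymm (l t).2.2 (l.symm_apply_le.1 this)
    refine ⟨fun h => ?_, top l t⟩
    have := top l.symm (l t) h
    rwa [l.symm_apply_apply] at this
  have hrT : ((roundDown T m t : Icc (0 : ℝ) T) : ℝ) = T ↔ (t : ℝ) = T := by
    by_cases h : (t : ℝ) = T
    · simp [roundDown, h]
    · simp only [roundDown, h, if_false, iff_false]
      refine (lt_of_le_of_lt ?_ (lt_of_le_of_ne t.2.2 h)).ne
      rw [div_le_iff₀ hc]
      exact Nat.floor_le (mul_nonneg t.2.1 hc.le)
  have hrd : |((roundDown T m t : Icc (0 : ℝ) T) : ℝ) - t| ≤ 1 / ((m : ℝ) + 1) := by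
    by_cases h : (t : ℝ) = T
    · simp only [roundDown, h, if_true, sub_self, abs_zero]
      positivity
    · simp only [roundDown, h, if_false]
      have e : (⌊(t : ℝ) * (m + 1)⌋₊ : ℝ) / (m + 1) - t =
          - ((t * (m + 1) - ⌊(t : ℝ) * (m + 1)⌋₊) / (m + 1)) := by
        field_simp
        ring
      have h0 := Nat.floor_le (mul_nonneg t.2.1 hc.le : 0 ≤ (t : ℝ) * (m + 1))
      rw [e, abs_neg, abs_of_nonneg (div_nonneg (sub_nonneg.2 h0) hc.le)]
      exact div_le_div_of_nonneg_right (by linarith [Nat.lt_floor_add_one ((t : ℝ) * (m + 1))]) hc.le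
  obtain ⟨s, hs⟩ := hL (l t) (mem_univ _)
  refine hUe s _ (hs ?_) _ (hs (Metric.mem_ball_self hδ)) ?_
  · rw [Metric.mem_ball, Subtype.dist_eq, Real.dist_eq]
    have h3 := (hl t).trans (min_le_left _ _)
    rw [abs_sub_comm] at h3
    have := abs_sub_le ((roundDown T m t : Icc (0 : ℝ) T) : ℝ) t (l t)
    linarith
  · obtain ⟨s, hsF⟩ := s
    show (s : ℝ) ≤ roundDown T m t ↔ (s : ℝ) ≤ l t
    by_cases hs0 : (s : ℝ) ≤ 0
    · exact ⟨fun _ => hs0.trans (l t).2.1, fun _ => hs0.trans (roundDown T m t).2.1⟩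
    by_cases hsT : T ≤ s
    · have hsT : (s : ℝ) = T := le_antisymm s.2.2 hsT
      rw [hsT, (roundDown T m t).2.2.ge_iff_eq, (l t).2.2.ge_iff_eq, hlT, hrT]
    have hsB : (s : ℝ) ∈ B := Finset.mem_filter.2
      ⟨Finset.mem_image.2 ⟨s, hsF, rfl⟩, not_le.1 hs0, not_le.1 hsT⟩
    by_cases h : (t : ℝ) = T
    · rw [hlT.2 h, hrT.2 h]
    · rw [← hlB s hsB t]
      simp only [roundDown, h, if_false]
      rw [le_div_iff₀ hc, div_le_iff₀ hc, ← Nat.ceil_le,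
        Nat.le_floor_iff (mul_nonneg t.2.1 hc.le)]

instance {S : Type*} [PseudoEMetricSpace S] [SecondCountableTopology S] :
    SecondCountableTopology (PathSpace T S) := by
  have h : TopologicalSpace.IsSeparable (univ : Set (PathSpace T S)) := by
    have h1 : TopologicalSpace.IsSeparable (⋃ m, range (stepPath (T := T) (S := S) m)) :=
      TopologicalSpace.IsSeparable.iUnion fun m => by
        have := (roundDown_finite T m).to_subtype
        exact TopologicalSpace.isSeparable_range (continuous_stepPath m)
    refine h1.closure.mono fun x _ => mem_closure_of_tendsto (tendsto_stepPath_sample x) ?_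
    exact Eventually.of_forall fun m => mem_iUnion.2 ⟨m, mem_range_self _⟩
  have : TopologicalSpace.SeparableSpace (PathSpace T S) := TopologicalSpace.isSeparable_univ_iff.1 h
  exact UniformSpace.secondCountable_of_separable _

theorem borel_le_of_tendsto {A : Type*} [TopologicalSpace A]
    [TopologicalSpace.PseudoMetrizableSpace A] (mA : MeasurableSpace A) {f : ℕ → A → A}
    (hf : ∀ m, @Measurable A A mA (borel A) (f m)) (h : ∀ x, Tendsto (fun m => f m x) atTop (𝓝 x)) :
    borel A ≤ mA := by
  have hb : @BorelSpace A _ (borel A) := @BorelSpace.mk A _ (borel A) rfl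
  have h1 : @Measurable A A mA (borel A) id :=
    @measurable_of_tendsto_metrizable A A mA _ _ (borel A) hb f id hf (tendsto_pi_nhds.2 h)
  exact fun U hU => h1 hU

instance {S : Type*} [PseudoEMetricSpace S] [SecondCountableTopology S] [MeasurableSpace S]
    [OpensMeasurableSpace S] : OpensMeasurableSpace (PathSpace T S) := by
  refine ⟨borel_le_of_tendsto _ (fun m => ?_) tendsto_stepPath_sample⟩
  have := (roundDown_finite T m).to_subtype
  have h1 : Measurable (sample (T := T) (S := S) m) :=
    measurable_pi_lambda _ fun u => measurable_eval _
  have h2 : @Measurable _ _ _ (borel (PathSpace T S)) (stepPath (T := T) (S := S) m) :=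
    (continuous_stepPath m).borel_measurable.mono OpensMeasurableSpace.borel_le le_rfl
  exact h2.comp h1

/-- The path `t ↦ (x t, y t)`. -/
def prodMk {S S' : Type*} [TopologicalSpace S] [TopologicalSpace S'] (x : PathSpace T S)
    (y : PathSpace T S') : PathSpace T (S × S') where
  toFun t := (x t, y t)
  right_continuous t := (x.right_continuous t).prodMk (y.right_continuous t)
  left_limit t := by
    obtain ⟨a, ha⟩ := x.left_limit t
    obtain ⟨b, hb⟩ := y.left_limit t
    exact ⟨(a, b), ha.prodMk_nhds hb⟩

theorem measurable_prodMk {S S' : Type*} [TopologicalSpace S] [TopologicalSpace S']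
    [MeasurableSpace S] [MeasurableSpace S'] :
    Measurable (fun p : PathSpace T S × PathSpace T S' => prodMk p.1 p.2) :=
  measurable_of_eval fun t => ((measurable_eval t).comp measurable_fst).prodMk
    ((measurable_eval t).comp measurable_snd)

/-- The marginal law at time `t` of a law on the path space. -/
noncomputable def marginal {S : Type*} [TopologicalSpace S] [MeasurableSpace S]
    (μ : ProbabilityMeasure (PathSpace T S)) (t : Icc (0 : ℝ) T) : ProbabilityMeasure S :=
  μ.map (measurable_eval t).aemeasurable

/-- The product law `μ ⊗ θ` as a law on the space of paths in the product: the law of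
`t ↦ (x t, y t)` for independent `x`, `y` with laws `μ`, `θ`. -/
noncomputable def prodLaw {S S' : Type*} [TopologicalSpace S] [TopologicalSpace S']
    [MeasurableSpace S] [MeasurableSpace S'] (μ : ProbabilityMeasure (PathSpace T S))
    (θ : ProbabilityMeasure (PathSpace T S')) : ProbabilityMeasure (PathSpace T (S × S')) :=
  (μ.prod θ).map measurable_prodMk.aemeasurable

end PathSpace

/-- Convergence in probability of `E`-valued random elements to the constant `z`: every
neighbourhood of `z` is charged with probability tending to one. -/
def TendstoInProb {Ω ι E : Type*} [MeasurableSpace Ω] [TopologicalSpace E] (P : Measure Ω)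
    (l : Filter ι) (Z : ι → Ω → E) (z : E) : Prop :=
  ∀ U ∈ 𝓝 z, Tendsto (fun n => P {ω | Z n ω ∉ U}) l (𝓝 0)

/-- For every metric `d` inducing the topology, it is the convergence `d(Z n, z) → 0` in
probability. -/
theorem tendstoInProb_iff_dist {Ω ι E : Type*} [MeasurableSpace Ω] [τ : TopologicalSpace E]
    (d : PseudoMetricSpace E) (hd : d.toUniformSpace.toTopologicalSpace = τ) (P : Measure Ω)
    (l : Filter ι) (Z : ι → Ω → E) (z : E) :
    TendstoInProb P l Z z ↔
      ∀ ε > 0, Tendsto (fun n => P {ω | ε ≤ d.dist (Z n ω) z}) l (𝓝 0) := by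
  subst hd
  constructor
  · intro h ε hε
    have := h _ (Metric.ball_mem_nhds z hε)
    simpa only [Metric.mem_ball, not_lt] using this
  · intro h U hU
    obtain ⟨ε, hε, hεU⟩ := Metric.mem_nhds_iff.1 hU
    refine tendsto_of_tendsto_of_tendsto_of_le_of_le tendsto_const_nhds (h ε hε)
      (fun _ => zero_le) fun n => measure_mono fun ω hω => ?_
    show ε ≤ dist (Z n ω) z
    by_contra hlt
    exact hω (hεU (Metric.mem_ball.2 (not_le.1 hlt)))

/-- The empirical measure of the first `n` of the points `x 0, x 1, …`. -/
noncomputable def empiricalMeasure {S : Type*} [MeasurableSpace S] (n : ℕ+) (x : ℕ → S) :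
    ProbabilityMeasure S :=
  ⟨(n : ℝ≥0∞)⁻¹ • ∑ j ∈ Finset.range n, Measure.dirac (x j), ⟨by
    simp only [Measure.smul_apply, Measure.finsetSum_apply, measure_univ, Finset.sum_const,
      Finset.card_range, nsmul_eq_mul, mul_one, smul_eq_mul]
    exact ENNReal.inv_mul_cancel (by exact_mod_cast n.ne_zero) (ENNReal.natCast_ne_top _)⟩⟩

/-- The space `[0,T] × ℤ × [0,∞)` of the points `(s, y, z)` of the driving noise. -/
abbrev MarkSpace (T : ℝ) : Type := Icc (0 : ℝ) T × ℤ × Ici (0 : ℝ)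

/-- The intensity `ds × ρ(dy) × dz`, with Lebesgue measure on `[0,T]` and on `[0,∞)`. -/
noncomputable def intensity (T : ℝ) (ρ : Measure ℤ) : Measure (MarkSpace T) :=
  ((volume : Measure ℝ).comap ((↑) : Icc (0 : ℝ) T → ℝ)).prod
    (ρ.prod ((volume : Measure ℝ).comap ((↑) : Ici (0 : ℝ) → ℝ)))

/-- `N` is a Poisson random measure with intensity `m`. -/
structure IsPoissonRandomMeasure {Ω E : Type*} [MeasurableSpace Ω] [MeasurableSpace E]
    (P : Measure Ω) (N : Ω → Measure E) (m : Measure E) : Prop where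
  measurable : Measurable N
  poisson : ∀ A, MeasurableSet A → m A < ∞ →
    HasLaw (fun ω => N ω A) ((poissonMeasure (m A).toNNReal).map (fun k : ℕ => (k : ℝ≥0∞))) P
  indep : ∀ (k : ℕ) (A : Fin k → Set E), (∀ j, MeasurableSet (A j)) →
    Pairwise (Function.onFun Disjoint A) → iIndepFun (fun j ω => N ω (A j)) P

/-- The rates are bounded by some `g y` with `∫ |y| g y ρ(dy) < ∞`. -/
def BoundedRates (ρ : Measure ℤ) (γ : ℤ → ℤ → ℤ → ℤ → ℝ) : Prop :=
  ∃ g : ℤ → ℝ, (∀ y, 0 ≤ g y) ∧ (∀ y x x' ξ', 0 ≤ γ y x x' ξ' ∧ γ y x x' ξ' ≤ g y) ∧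
    Integrable (fun y : ℤ => |(y : ℝ)| * g y) ρ

/-- `Γ(y, x, ν) = ∫ γ(y, x, x', ξ') ν(dx' dξ')`. -/
noncomputable def totalRate (γ : ℤ → ℤ → ℤ → ℤ → ℝ) (y x : ℤ) (ν : ProbabilityMeasure (ℤ × ℤ)) :
    ℝ :=
  ∫ p, γ y x p.1 p.2 ∂(ν : Measure (ℤ × ℤ))

/-- The integrand `y 𝟏_{[0, Γ(y, x(s-), ν(s-))]}(z)` at the point `(s, y, z)`. -/
noncomputable def jump {T : ℝ} (γ : ℤ → ℤ → ℤ → ℤ → ℝ) (x : Icc (0 : ℝ) T → ℤ)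
    (ν : Icc (0 : ℝ) T → ProbabilityMeasure (ℤ × ℤ)) (e : MarkSpace T) : ℝ :=
  open Classical in
  if (e.2.2 : ℝ) ≤ totalRate γ e.2.1 (Function.leftLim x e.1) (Function.leftLim ν e.1)
  then (e.2.1 : ℝ) else 0

/-- The path `x` solves, for one realization `N` of the noise,
`x(t) = x₀ + ∫_{[0,t] × ℤ × [0,∞)} y 𝟏_{[0, Γ(y, x(s-), ν(s-))]}(z) N(ds dy dz)` on `[0,T]`. -/
def SolvesEquation {T : ℝ} (γ : ℤ → ℤ → ℤ → ℤ → ℝ) (x₀ : ℤ) (N : Measure (MarkSpace T))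
    (ν : Icc (0 : ℝ) T → ProbabilityMeasure (ℤ × ℤ)) (x : PathSpace T ℤ) : Prop :=
  ∀ t, IntegrableOn (jump γ x ν) {e | e.1 ≤ t} N ∧
    (x t : ℝ) = x₀ + ∫ e in {e | e.1 ≤ t}, jump γ x ν e ∂N

section Model

variable {T : ℝ} {Ω : Type*} [mΩ : MeasurableSpace Ω]

/-- The probabilistic data: initial states `X₀ i`, Poisson random measures `N i` and edge
processes `ξ i j`, on a probability space with a filtration `F` of `[0,T]`. -/
structure IsModel (P : Measure Ω) (F : Filtration (Icc (0 : ℝ) T) mΩ) (ρ : Measure ℤ)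
    (θ : ProbabilityMeasure (PathSpace T ℤ)) (X₀ : ℕ → Ω → ℤ) (N : ℕ → Ω → Measure (MarkSpace T))
    (ξ : ℕ → ℕ → Ω → PathSpace T ℤ) : Prop where
  /-- The initial states are `F 0`-measurable (`F 0` is the smallest of the `F t`). -/
  init_measurable : ∀ i t, Measurable[F t] (X₀ i)
  init_indep : iIndepFun X₀ P
  init_identDistrib : ∀ i, IdentDistrib (X₀ i) (X₀ 0) P P
  poisson : ∀ i, IsPoissonRandomMeasure P (N i) (intensity T ρ)
  poisson_indep : iIndepFun N P
  /-- The noise up to time `t` is `F t`-measurable. -/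
  poisson_adapted : ∀ i t, Measurable[F t] (fun ω => (N i ω).restrict {e | e.1 ≤ t})
  /-- The noise after time `t` is independent of `F t`. -/
  poisson_future : ∀ t, Indep (F t)
    (MeasurableSpace.comap (fun ω i => (N i ω).restrict {e : MarkSpace T | t < e.1})
      MeasurableSpace.pi) P
  init_indep_poisson : IndepFun (fun ω i => X₀ i ω) (fun ω i => N i ω) P
  edge_adapted : ∀ i j t, Measurable[F t] (fun ω => ξ i j ω t)
  edge_law : ∀ i j, HasLaw (ξ i j) (θ : Measure (PathSpace T ℤ)) P
  edge_indep : iIndepFun (fun (p : ℕ × ℕ) => ξ p.1 p.2) P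
  /-- The family of edge processes is independent of the initial states and the noise. -/
  edge_indep_node : IndepFun (fun ω (p : ℕ × ℕ) => ξ p.1 p.2 ω)
    (fun ω => ((fun i => X₀ i ω), (fun i => N i ω))) P

/-- `X` is a process with paths in `𝔻([0,T] : ℤ)`, adapted to `F` (up to null sets), that solves
almost surely the equation started at `x₀` and driven by `N`, with the measure process `ν`. -/
structure IsNodeSolution (P : Measure Ω) (F : Filtration (Icc (0 : ℝ) T) mΩ)
    (γ : ℤ → ℤ → ℤ → ℤ → ℝ) (x₀ : Ω → ℤ) (N : Ω → Measure (MarkSpace T))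
    (ν : Ω → Icc (0 : ℝ) T → ProbabilityMeasure (ℤ × ℤ)) (X : Ω → PathSpace T ℤ) : Prop where
  measurable : Measurable X
  adapted : ∀ t, ∃ Y : Ω → ℤ, Measurable[F t] Y ∧ (fun ω => X ω t) =ᵐ[P] Y
  equation : ∀ᵐ ω ∂P, SolvesEquation γ (x₀ ω) (N ω) (ν ω) (X ω)

/-- `X 0, …, X (n - 1)` is a system of `n` nodes, each driven by the empirical measure of the
nodes and of its own edges. For convenience `X` is a sequence; nothing but measurability is asked
of `X i` for `i ≥ n`. -/
structure IsParticleSystem (P : Measure Ω) (F : Filtration (Icc (0 : ℝ) T) mΩ)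
    (γ : ℤ → ℤ → ℤ → ℤ → ℝ) (X₀ : ℕ → Ω → ℤ) (N : ℕ → Ω → Measure (MarkSpace T))
    (ξ : ℕ → ℕ → Ω → PathSpace T ℤ) (n : ℕ+) (X : ℕ → Ω → PathSpace T ℤ) : Prop where
  measurable : ∀ i, Measurable (X i)
  solution : ∀ i < (n : ℕ), IsNodeSolution P F γ (X₀ i) (N i)
    (fun ω t => empiricalMeasure n fun j => (X j ω t, ξ i j ω t)) (X i)

/-- `(X, ν)` solves the limiting McKean–Vlasov system:
`ν t = Law (X i t) ⊗ Law (ξ i j t)` for all `i`, `j`. -/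
structure IsLimitSystem (P : Measure Ω) (F : Filtration (Icc (0 : ℝ) T) mΩ)
    (γ : ℤ → ℤ → ℤ → ℤ → ℝ) (X₀ : ℕ → Ω → ℤ) (N : ℕ → Ω → Measure (MarkSpace T))
    (ξ : ℕ → ℕ → Ω → PathSpace T ℤ) (X : ℕ → Ω → PathSpace T ℤ)
    (ν : Icc (0 : ℝ) T → ProbabilityMeasure (ℤ × ℤ)) : Prop where
  solution : ∀ i, IsNodeSolution P F γ (X₀ i) (N i) (fun _ => ν) (X i)
  law : ∀ i j t, (ν t : Measure (ℤ × ℤ)) =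
    (P.map fun ω => X i ω t).prod (P.map fun ω => ξ i j ω t)

end Model

end EdgeMeanField

open EdgeMeanField

/-! The proof compares two solutions that share initial state and noise. At a mark `(s, y, z)` their
jumps differ only if `z` lies between the two rates, so integrating out `z` leaves `|y|` times the
distance of the rates. The integrands use left limits of adapted processes and are therefore
predictable, and the compensation formula `lintegral_activeKernel` replaces the noise by its
intensity in the mean. Thus `RateBound.lintegral_jumpDist_le` bounds the mean total difference of
the jumps by a time integral of the mean distance of the rates, with the constant `∫ |y| g(y)
ρ(dy)`.

States are integers, so bounded rates are Lipschitz: if `0 ≤ φ ≤ c`, then `|φ(a) - φ(b)|` is at most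
`c` and vanishes for `a = b`, hence is at most `c |a - b|`. The rate of a jump `y` is thus Lipschitz
with constant `g y` in the state and, by coupling, in the law of a node. Gronwall's inequality gives
uniqueness, and the successive approximations converge geometrically. No moment of the initial state
is needed: it cancels in differences, and the total jump mass allowed by the noise has finite mean.
Integer paths at distance below one coincide, so almost surely the approximations are eventually
constant, and their limit is one measurable function, the same for all nodes, of initial state and
noise. By uniqueness every solution has this form; hence the nodes are i.i.d. and independent of the
edges.

For `n` nodes the difference of the rates splits into a difference of states, a difference of
empirical measures with the same edges, and the fluctuation of the average over `j` of `γ(y, X_i,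
X_j, ξ_ij)`. For fixed `i` the pairs `(X_j, ξ_ij)` are i.i.d. In the second moment of the centred
average, a product with two different indices contains one index other than `i`; integrating out
that pair gives zero. The fluctuation is therefore at most `g y / √n` in mean
(`lintegral_average_sub_le`), and Gronwall's inequality yields the rate
(`IsParticleSystem.exists_majorant`).

By Markov's inequality and integrality, `X_i^n` and `X_i` are different paths with probability at
most `κ / √n`. Under any bounded test function the former may thus be replaced by the latter, and
both limit theorems reduce to statements about i.i.d. variables, without estimates in the Skorokhod
distance. -/

namespace EdgeMeanField

/-! ### Approximation of left limits along a grid -/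

section Grid

variable {T : ℝ}

/-- The point `k / (m + 1)` of the grid of mesh `1 / (m + 1)`, cut off at `T`. -/
noncomputable def gridPoint (t₀ : Icc (0 : ℝ) T) (m k : ℕ) : Icc (0 : ℝ) T :=
  ⟨min T (k / (m + 1)), le_min (t₀.2.1.trans t₀.2.2) (by positivity), min_le_left _ _⟩

/-- The index of the last grid point strictly before `t`, or `0` if there is none. -/
noncomputable def gridIndex (m : ℕ) (t : Icc (0 : ℝ) T) : ℕ := ⌈(t : ℝ) * (m + 1)⌉₊ - 1

/-- The last grid point strictly before `t`, or `0` if there is none. -/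
noncomputable def gridDown (m : ℕ) (t : Icc (0 : ℝ) T) : Icc (0 : ℝ) T :=
  gridPoint t m (gridIndex m t)

theorem gridPoint_congr (t₀ t₁ : Icc (0 : ℝ) T) (m k : ℕ) : gridPoint t₀ m k = gridPoint t₁ m k :=
  rfl

theorem gridIndex_lt_iff (m k : ℕ) (t : Icc (0 : ℝ) T) :
    k + 1 ≤ gridIndex m t ↔ gridPoint t m (k + 1) < t := by
  have hc : (0 : ℝ) < m + 1 := by positivity
  rw [gridIndex, ← Subtype.coe_lt_coe]
  show _ ↔ min T (((k + 1 : ℕ) : ℝ) / (m + 1)) < t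
  rw [min_lt_iff, or_iff_right (not_lt.2 t.2.2), div_lt_iff₀ hc, ← Nat.lt_ceil]
  omega

theorem gridDown_le_sub (m : ℕ) (t : Icc (0 : ℝ) T) :
    (t : ℝ) - 1 / (m + 1) ≤ gridDown m t := by
  have hc : (0 : ℝ) < m + 1 := by positivity
  show _ ≤ min T (((⌈(t : ℝ) * (m + 1)⌉₊ - 1 : ℕ) : ℝ) / (m + 1))
  refine le_min (by have := t.2.2; have : (0:ℝ) ≤ 1 / (m + 1) := by positivity
                    linarith) ?_
  rw [le_div_iff₀ hc, sub_mul, one_div_mul_cancel hc.ne', sub_le_iff_le_add]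
  refine (Nat.le_ceil _).trans ?_
  have : ⌈(t : ℝ) * (m + 1)⌉₊ ≤ (⌈(t : ℝ) * (m + 1)⌉₊ - 1) + 1 := by omega
  exact_mod_cast this

theorem gridDown_lt (m : ℕ) {t : Icc (0 : ℝ) T} (ht : 0 < (t : ℝ)) : gridDown m t < t := by
  have hc : (0 : ℝ) < m + 1 := by positivity
  rw [← Subtype.coe_lt_coe]
  show min T (((⌈(t : ℝ) * (m + 1)⌉₊ - 1 : ℕ) : ℝ) / (m + 1)) < t
  refine (min_le_right _ _).trans_lt ?_
  rw [div_lt_iff₀ hc, ← Nat.lt_ceil]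
  have : 0 < ⌈(t : ℝ) * (m + 1)⌉₊ := Nat.ceil_pos.2 (by positivity)
  omega

theorem gridDown_le (m : ℕ) (t : Icc (0 : ℝ) T) : gridDown m t ≤ t := by
  rcases t.2.1.eq_or_lt with h | h
  · rw [← Subtype.coe_le_coe]
    show min T (((⌈(t : ℝ) * (m + 1)⌉₊ - 1 : ℕ) : ℝ) / (m + 1)) ≤ t
    simp [← h]
  · exact (gridDown_lt m h).le

/-- The grid points stay strictly below `t`. Values there converge to the left limit at `t`, and
they are known strictly before `t`; both are needed for predictability. -/
theorem tendsto_gridDown {t : Icc (0 : ℝ) T} (ht : 0 < (t : ℝ)) :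
    Tendsto (fun m => gridDown m t) atTop (𝓝[<] t) := by
  refine tendsto_nhdsWithin_iff.2 ⟨?_, Eventually.of_forall fun m => gridDown_lt m ht⟩
  rw [tendsto_subtype_rng]
  refine tendsto_of_tendsto_of_tendsto_of_le_of_le ?_ tendsto_const_nhds
    (fun m => gridDown_le_sub m t) (fun m => gridDown_le m t)
  simpa using tendsto_const_nhds.sub (tendsto_one_div_add_atTop_nhds_zero_nat (𝕜 := ℝ))

theorem gridDown_of_eq_zero (m : ℕ) {t : Icc (0 : ℝ) T} (ht : (t : ℝ) = 0) : gridDown m t = t :=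
  le_antisymm (gridDown_le m t) (show (t : ℝ) ≤ _ from ht.le.trans (gridDown m t).2.1)

theorem nhdsLT_eq_bot {t : Icc (0 : ℝ) T} (ht : (t : ℝ) = 0) : 𝓝[<] t = ⊥ := by
  have : Iio t = ∅ := by
    ext s
    simp only [mem_Iio, mem_empty_iff_false, iff_false, not_lt]
    exact (show (t : ℝ) ≤ s from ht.le.trans s.2.1)
  rw [this, nhdsWithin_empty]

/-- A function with left limits tends along the grid to the function of its left limits. -/
theorem tendsto_leftLim_gridDown {S : Type*} [TopologicalSpace S] [T2Space S]
    {f : Icc (0 : ℝ) T → S} (t : Icc (0 : ℝ) T) (hf : ∃ l, Tendsto f (𝓝[<] t) (𝓝 l)) :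
    Tendsto (fun m => f (gridDown m t)) atTop (𝓝 (Function.leftLim f t)) := by
  rcases t.2.1.eq_or_lt with h | h
  · rw [leftLim_eq_of_eq_bot _ (nhdsLT_eq_bot h.symm)]
    simp [gridDown_of_eq_zero _ h.symm]
  · exact (tendsto_leftLim_of_tendsto hf).comp (tendsto_gridDown h)

end Grid

/-! ### Predictable sets and processes -/

section Predictable

variable {T : ℝ} {Ω : Type*} [mΩ : MeasurableSpace Ω]

/-- The rectangles `G × [0,T] × B`, with `G` in every `F t`, and `G × (a,T] × B`, with `G ∈ F a`. -/
def predictableRectangles (F : Filtration (Icc (0 : ℝ) T) mΩ) : Set (Set (Ω × MarkSpace T)) :=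
  {C | ∃ (G : Set Ω) (J : Set (Icc (0 : ℝ) T)) (B : Set (ℤ × Ici (0 : ℝ))), MeasurableSet B ∧
    ((J = univ ∧ ∀ t, MeasurableSet[F t] G) ∨ ∃ a, J = Ioi a ∧ MeasurableSet[F a] G) ∧
    C = {p | p.1 ∈ G ∧ p.2.1 ∈ J ∧ p.2.2 ∈ B}}

/-- The predictable `σ`-field on `Ω × [0,T] × ℤ × [0,∞)`. -/
abbrev predictableSpace (F : Filtration (Icc (0 : ℝ) T) mΩ) : MeasurableSpace (Ω × MarkSpace T) :=
  MeasurableSpace.generateFrom (predictableRectangles F)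

theorem isPiSystem_predictableRectangles (F : Filtration (Icc (0 : ℝ) T) mΩ) :
    IsPiSystem (predictableRectangles F) := by
  rintro _ ⟨G, J, B, hB, hJ, rfl⟩ _ ⟨G', J', B', hB', hJ', rfl⟩ -
  refine ⟨G ∩ G', J ∩ J', B ∩ B', hB.inter hB', ?_, ?_⟩
  · rcases hJ with ⟨rfl, h⟩ | ⟨a, rfl, h⟩ <;> rcases hJ' with ⟨rfl, h'⟩ | ⟨a', rfl, h'⟩
    · exact Or.inl ⟨inter_self _, fun t => (h t).inter (h' t)⟩
    · exact Or.inr ⟨a', univ_inter _, (h a').inter h'⟩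
    · exact Or.inr ⟨a, inter_univ _, h.inter (h' a)⟩
    · exact Or.inr ⟨a ⊔ a', Ioi_inter_Ioi, (F.mono le_sup_left _ h).inter
        (F.mono le_sup_right _ h')⟩
  · ext p
    simp only [mem_inter_iff, mem_ofPred_eq]
    tauto

theorem measurableSet_of_mem_predictableRectangles [h0 : Nonempty (Icc (0 : ℝ) T)]
    {F : Filtration (Icc (0 : ℝ) T) mΩ}
    {C : Set (Ω × MarkSpace T)} (hC : C ∈ predictableRectangles F) : MeasurableSet C := by
  obtain ⟨G, J, B, hB, hJ, rfl⟩ := hC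
  have hG : MeasurableSet G := by
    rcases hJ with ⟨-, h⟩ | ⟨a, -, h⟩
    · exact F.le h0.some _ (h _)
    · exact F.le a _ h
  have hJ : MeasurableSet J := by
    rcases hJ with ⟨rfl, -⟩ | ⟨a, rfl, -⟩
    · exact MeasurableSet.univ
    · exact measurableSet_Ioi
  exact hG.prod (hJ.prod hB)

theorem predictableSpace_le [Nonempty (Icc (0 : ℝ) T)] (F : Filtration (Icc (0 : ℝ) T) mΩ) :
    predictableSpace F ≤ Prod.instMeasurableSpace :=
  MeasurableSpace.generateFrom_le fun _ hC => measurableSet_of_mem_predictableRectangles hC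

theorem measurableSet_predictable_mark (F : Filtration (Icc (0 : ℝ) T) mΩ)
    {B : Set (ℤ × Ici (0 : ℝ))} (hB : MeasurableSet B) :
    MeasurableSet[predictableSpace F] {p | p.2.2 ∈ B} :=
  MeasurableSpace.measurableSet_generateFrom
    ⟨univ, univ, B, hB, Or.inl ⟨rfl, fun _ => MeasurableSet.univ⟩, by ext; simp⟩

theorem measurable_predictable_mark (F : Filtration (Icc (0 : ℝ) T) mΩ) :
    Measurable[predictableSpace F] (fun p : Ω × MarkSpace T => p.2.2) :=
  fun _ hB => measurableSet_predictable_mark F hB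

theorem measurableSet_predictable_Ioi (F : Filtration (Icc (0 : ℝ) T) mΩ) {a : Icc (0 : ℝ) T}
    {G : Set Ω} (hG : MeasurableSet[F a] G) :
    MeasurableSet[predictableSpace F] {p | p.1 ∈ G ∧ a < p.2.1} :=
  MeasurableSpace.measurableSet_generateFrom
    ⟨G, Ioi a, univ, MeasurableSet.univ, Or.inr ⟨a, rfl, hG⟩, by ext; simp⟩

theorem measurableSet_predictable_of_forall (F : Filtration (Icc (0 : ℝ) T) mΩ)
    {G : Set Ω} (hG : ∀ t, MeasurableSet[F t] G) :
    MeasurableSet[predictableSpace F] {p | p.1 ∈ G} :=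
  MeasurableSpace.measurableSet_generateFrom
    ⟨G, univ, univ, MeasurableSet.univ, Or.inl ⟨rfl, hG⟩, by ext; simp⟩

/-- An adapted process, evaluated at the last grid point before the time, is predictable. -/
theorem measurable_predictable_gridDown (F : Filtration (Icc (0 : ℝ) T) mΩ) (t₀ : Icc (0 : ℝ) T)
    {E : Type*} [MeasurableSpace E] {r : Ω → Icc (0 : ℝ) T → ℤ → E}
    (hr : ∀ t y, Measurable[F t] (fun ω => r ω t y)) (m : ℕ) :
    Measurable[predictableSpace F]
      (fun p : Ω × MarkSpace T => r p.1 (gridDown m p.2.1) p.2.2.1) := by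
  intro S hS
  have key : ∀ k : ℕ, ∀ y : ℤ, MeasurableSet[predictableSpace F]
      {p : Ω × MarkSpace T | (r p.1 (gridPoint t₀ m k) y ∈ S) ∧ gridIndex m p.2.1 = k} := by
    intro k y
    have hup := measurableSet_predictable_Ioi F (a := gridPoint t₀ m (k + 1)) MeasurableSet.univ
    -- Index `0` stands for time `0`, where the event lies in every `F t` and the set of times has
    -- no lower end. A positive index `k` means that grid point `k`, but not grid point `k + 1`,
    -- lies strictly before the time.
    rcases k with _ | k
    · have h0 : ∀ t, MeasurableSet[F t] {ω | r ω (gridPoint t₀ m 0) y ∈ S} := fun t =>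
        F.mono (show (gridPoint t₀ m 0 : ℝ) ≤ t from
          (min_le_right _ _).trans (by simpa using t.2.1)) _ (hr _ y hS)
      convert (measurableSet_predictable_of_forall F h0).diff hup using 1
      ext p
      have := gridIndex_lt_iff m 0 p.2.1
      rw [gridPoint_congr p.2.1 t₀] at this
      simp only [mem_ofPred_eq, Set.mem_sdiff, mem_univ, true_and, ← this]
      refine and_congr_right fun _ => ?_
      omega
    · convert (measurableSet_predictable_Ioi F (a := gridPoint t₀ m (k + 1))
        (hr _ y hS)).diff hup using 1
      ext p
      have h1 := gridIndex_lt_iff m k p.2.1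
      have h2 := gridIndex_lt_iff m (k + 1) p.2.1
      rw [gridPoint_congr p.2.1 t₀] at h1 h2
      simp only [mem_ofPred_eq, Set.mem_sdiff, mem_univ, true_and, ← h1, ← h2, and_assoc, mem_preimage]
      refine and_congr_right fun _ => ?_
      omega
  have : (fun p : Ω × MarkSpace T => r p.1 (gridDown m p.2.1) p.2.2.1) ⁻¹' S =
      ⋃ k : ℕ, ⋃ y : ℤ, {p : Ω × MarkSpace T | (r p.1 (gridPoint t₀ m k) y ∈ S) ∧
        gridIndex m p.2.1 = k} ∩ {p | p.2.2 ∈ {q : ℤ × Ici (0 : ℝ) | q.1 = y}} := by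
    ext p
    simp only [mem_preimage, mem_iUnion, mem_inter_iff, mem_ofPred_eq]
    constructor
    · exact fun h => ⟨gridIndex m p.2.1, p.2.2.1, ⟨h, rfl⟩, rfl⟩
    · rintro ⟨k, y, ⟨h, rfl⟩, rfl⟩
      exact h
  rw [this]
  exact MeasurableSet.iUnion fun k => MeasurableSet.iUnion fun y => (key k y).inter
    (measurableSet_predictable_mark F (measurable_fst (measurableSet_singleton y)))

end Predictable

/-! ### Bounds, continuity and predictability of the rates -/

section Rate

variable {T : ℝ} {γ : ℤ → ℤ → ℤ → ℤ → ℝ} {g : ℤ → ℝ}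

/-- The pointwise bounds `0 ≤ γ ≤ g`. -/
def RateBound (γ : ℤ → ℤ → ℤ → ℤ → ℝ) (g : ℤ → ℝ) : Prop :=
  ∀ y x x' ξ', 0 ≤ γ y x x' ξ' ∧ γ y x x' ξ' ≤ g y

theorem RateBound.nonneg (h : RateBound γ g) (y : ℤ) : 0 ≤ g y :=
  (h y 0 0 0).1.trans (h y 0 0 0).2

theorem RateBound.norm_le (h : RateBound γ g) (y x : ℤ) (p : ℤ × ℤ) :
    ‖γ y x p.1 p.2‖ ≤ g y := by
  rw [Real.norm_of_nonneg (h _ _ _ _).1]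
  exact (h _ _ _ _).2

theorem RateBound.integrable (h : RateBound γ g) (y x : ℤ) (ν : Measure (ℤ × ℤ))
    [IsFiniteMeasure ν] : Integrable (fun p : ℤ × ℤ => γ y x p.1 p.2) ν :=
  Integrable.of_bound (measurable_of_countable _).aestronglyMeasurable (g y)
    (Eventually.of_forall (h.norm_le y x))

theorem RateBound.totalRate_nonneg (h : RateBound γ g) (y x : ℤ)
    (ν : ProbabilityMeasure (ℤ × ℤ)) : 0 ≤ totalRate γ y x ν :=
  integral_nonneg fun _ => (h _ _ _ _).1

theorem RateBound.totalRate_le (h : RateBound γ g) (y x : ℤ)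
    (ν : ProbabilityMeasure (ℤ × ℤ)) : totalRate γ y x ν ≤ g y := by
  refine (integral_mono (h.integrable y x _) (integrable_const (g y))
    fun p => (h y x p.1 p.2).2).trans ?_
  simp

theorem RateBound.continuous_totalRate (h : RateBound γ g) (y x : ℤ) :
    Continuous (totalRate γ y x) := by
  let f : BoundedContinuousFunction (ℤ × ℤ) ℝ :=
    BoundedContinuousFunction.ofNormedAddCommGroup (fun p => γ y x p.1 p.2)
      continuous_of_discreteTopology (g y) (h.norm_le y x)
  exact ProbabilityMeasure.continuous_integral_boundedContinuousFunction f

/-- The state is discrete, so its value on the grid eventually equals its left limit; only the weak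
continuity in the measure remains. -/
theorem RateBound.tendsto_totalRate (h : RateBound γ g) {x : PathSpace T ℤ}
    {ν : Icc (0 : ℝ) T → ProbabilityMeasure (ℤ × ℤ)}
    (hν : ∀ t, ∃ l, Tendsto ν (𝓝[<] t) (𝓝 l)) (y : ℤ) (t : Icc (0 : ℝ) T) :
    Tendsto (fun m => totalRate γ y (x (gridDown m t)) (ν (gridDown m t))) atTop
      (𝓝 (totalRate γ y (Function.leftLim x t) (Function.leftLim ν t))) := by
  have h1 := tendsto_leftLim_gridDown t (x.left_limit t)
  have h2 := tendsto_leftLim_gridDown t (hν t)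
  rw [nhds_discrete, tendsto_pure] at h1
  refine (((h.continuous_totalRate y _).tendsto _).comp h2).congr' ?_
  filter_upwards [h1] with m hm
  simp [hm]

variable {Ω : Type*} [mΩ : MeasurableSpace Ω]

theorem RateBound.measurable_predictable_rate (h : RateBound γ g)
    {F : Filtration (Icc (0 : ℝ) T) mΩ} {X : Ω → PathSpace T ℤ}
    {ν : Ω → Icc (0 : ℝ) T → ProbabilityMeasure (ℤ × ℤ)}
    (hν : ∀ ω t, ∃ l, Tendsto (ν ω) (𝓝[<] t) (𝓝 l)) (t₀ : Icc (0 : ℝ) T)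
    (hr : ∀ t y, Measurable[F t] (fun ω => totalRate γ y (X ω t) (ν ω t))) :
    Measurable[predictableSpace F] (fun p : Ω × MarkSpace T =>
      totalRate γ p.2.2.1 (Function.leftLim (X p.1) p.2.1) (Function.leftLim (ν p.1) p.2.1)) := by
  refine @measurable_of_tendsto_metrizable _ _ (predictableSpace F) _ _ _ _ _ _
    (fun m => measurable_predictable_gridDown F t₀
      (r := fun ω t y => totalRate γ y (X ω t) (ν ω t)) hr m) ?_
  exact tendsto_pi_nhds.2 fun p => h.tendsto_totalRate (hν p.1) p.2.2.1 p.2.1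

theorem measurable_ite_le {α : Type*} [MeasurableSpace α] {y z r : α → ℝ} (hy : Measurable y)
    (hz : Measurable z) (hr : Measurable r) :
    Measurable fun a => open Classical in if z a ≤ r a then y a else 0 :=
  Measurable.ite (measurableSet_le hz hr) hy measurable_const

theorem RateBound.measurable_predictable_jump (h : RateBound γ g)
    {F : Filtration (Icc (0 : ℝ) T) mΩ} {X : Ω → PathSpace T ℤ}
    {ν : Ω → Icc (0 : ℝ) T → ProbabilityMeasure (ℤ × ℤ)}
    (hν : ∀ ω t, ∃ l, Tendsto (ν ω) (𝓝[<] t) (𝓝 l)) (t₀ : Icc (0 : ℝ) T)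
    (hr : ∀ t y, Measurable[F t] (fun ω => totalRate γ y (X ω t) (ν ω t))) :
    Measurable[predictableSpace F] (fun p : Ω × MarkSpace T => jump γ (X p.1) (ν p.1) p.2) := by
  have h1 := h.measurable_predictable_rate hν t₀ hr
  have h2 := measurable_predictable_mark F
  have h3 : Measurable[predictableSpace F] (fun p : Ω × MarkSpace T => ((p.2.2.2 : ℝ))) :=
    (measurable_subtype_coe.comp measurable_snd).comp h2
  have h4 : Measurable[predictableSpace F] (fun p : Ω × MarkSpace T => ((p.2.2.1 : ℝ))) :=
    ((measurable_of_countable (fun y : ℤ => (y : ℝ))).comp measurable_fst).comp h2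
  exact @measurable_ite_le _ (predictableSpace F) _ _ _ h4 h3 h1

theorem RateBound.measurable_jump (h : RateBound γ g) (hT : 0 ≤ T) {X : Ω → PathSpace T ℤ}
    {ν : Ω → Icc (0 : ℝ) T → ProbabilityMeasure (ℤ × ℤ)}
    (hν : ∀ ω t, ∃ l, Tendsto (ν ω) (𝓝[<] t) (𝓝 l))
    (hr : ∀ t y, Measurable (fun ω => totalRate γ y (X ω t) (ν ω t))) :
    Measurable (fun p : Ω × MarkSpace T => jump γ (X p.1) (ν p.1) p.2) := by
  let t₀ : Icc (0 : ℝ) T := ⟨0, le_rfl, hT⟩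
  have : Nonempty (Icc (0 : ℝ) T) := ⟨t₀⟩
  -- With the constant filtration, predictability gives joint measurability in the outcome and the
  -- mark.
  let F : Filtration (Icc (0 : ℝ) T) mΩ := ⟨fun _ => mΩ, fun _ _ _ => le_rfl, fun _ => le_rfl⟩
  exact (h.measurable_predictable_jump (F := F) hν t₀ hr).mono (predictableSpace_le F) le_rfl

end Rate

end EdgeMeanField

namespace EdgeMeanField

/-! ### The active region, where the noise is finite -/

section Intensity

variable {T : ℝ}

instance : IsFiniteMeasure ((volume : Measure ℝ).comap ((↑) : Icc (0 : ℝ) T → ℝ)) := by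
  refine ⟨?_⟩
  rw [comap_subtype_coe_apply measurableSet_Icc, image_univ, Subtype.range_coe]
  simp

instance : SFinite ((volume : Measure ℝ).comap ((↑) : Ici (0 : ℝ) → ℝ)) := by
  have := IsFiniteMeasureOnCompacts.comap' (volume : Measure ℝ)
    (f := ((↑) : Ici (0 : ℝ) → ℝ)) continuous_subtype_val
    (MeasurableEmbedding.subtype_coe measurableSet_Ici)
  have : LocallyCompactSpace (Ici (0 : ℝ)) := isClosed_Ici.locallyCompactSpace
  infer_instance

instance {ρ : Measure ℤ} [IsFiniteMeasure ρ] : SFinite (intensity T ρ) := by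
  unfold intensity
  infer_instance

theorem lintegral_intensity (ρ : Measure ℤ) [IsFiniteMeasure ρ] {f : MarkSpace T → ℝ≥0∞}
    (hf : Measurable f) :
    ∫⁻ e, f e ∂(intensity T ρ) =
      ∫⁻ s, ∫⁻ y, ∫⁻ z, f (s, y, z) ∂((volume : Measure ℝ).comap ((↑) : Ici (0 : ℝ) → ℝ)) ∂ρ
        ∂((volume : Measure ℝ).comap ((↑) : Icc (0 : ℝ) T → ℝ)) := by
  rw [intensity, lintegral_prod _ hf.aemeasurable]
  refine lintegral_congr fun s => ?_
  rw [lintegral_prod _ (by fun_prop)]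

/-- The region of the marks that can make a process with rates bounded by `g` jump. -/
def activeSet (T : ℝ) (g : ℤ → ℝ) : Set (MarkSpace T) :=
  {e | 0 < (e.1 : ℝ) ∧ e.2.1 ≠ 0 ∧ (e.2.2 : ℝ) ≤ g e.2.1}

theorem measurableSet_activeSet (g : ℤ → ℝ) : MeasurableSet (activeSet T g) := by
  refine MeasurableSet.inter ?_ (MeasurableSet.inter ?_ ?_)
  · exact measurableSet_lt measurable_const (measurable_subtype_coe.comp measurable_fst)
  · exact (measurable_fst.comp measurable_snd) (measurableSet_singleton (0 : ℤ)).compl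
  · exact measurableSet_le (measurable_subtype_coe.comp (measurable_snd.comp measurable_snd))
      ((measurable_of_countable g).comp (measurable_fst.comp measurable_snd))

/-- The constant `∫ |y| g(y) ρ(dy)`. -/
noncomputable def jumpConst (ρ : Measure ℤ) (g : ℤ → ℝ) : ℝ≥0∞ :=
  ∫⁻ y, ‖(y : ℝ)‖ₑ * ENNReal.ofReal (g y) ∂ρ

theorem jumpConst_lt_top {ρ : Measure ℤ} {g : ℤ → ℝ} (hg : ∀ y, 0 ≤ g y)
    (h : Integrable (fun y : ℤ => |(y : ℝ)| * g y) ρ) : jumpConst ρ g < ∞ := by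
  have := h.2
  rw [hasFiniteIntegral_iff_enorm] at this
  refine lt_of_le_of_lt (lintegral_mono fun y => ?_) this
  rw [enorm_mul, Real.enorm_abs, Real.enorm_of_nonneg (hg y)]

theorem volume_Ici_le (c : ℝ) :
    ((volume : Measure ℝ).comap ((↑) : Ici (0 : ℝ) → ℝ)) {z | (z : ℝ) ≤ c} ≤ ENNReal.ofReal c := by
  rw [comap_subtype_coe_apply measurableSet_Ici]
  refine (measure_mono (t := Icc 0 c) ?_).trans (by simp)
  rintro _ ⟨z, hz, rfl⟩
  exact ⟨z.2, hz⟩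

theorem volume_Ici_Ioc_le (a b : ℝ) :
    ((volume : Measure ℝ).comap ((↑) : Ici (0 : ℝ) → ℝ)) {z | a < (z : ℝ) ∧ (z : ℝ) ≤ b} ≤
      ENNReal.ofReal (b - a) := by
  rw [comap_subtype_coe_apply measurableSet_Ici]
  refine (measure_mono (t := Ioc a b) ?_).trans (by simp)
  rintro _ ⟨z, hz, rfl⟩
  exact hz

/-- The total weight of the jumps in the active region is finite in mean. -/
theorem lintegral_activeSet_le (ρ : Measure ℤ) [IsFiniteMeasure ρ] (g : ℤ → ℝ) :
    ∫⁻ e in activeSet T g, ‖(e.2.1 : ℝ)‖ₑ ∂(intensity T ρ) ≤ ENNReal.ofReal T * jumpConst ρ g := by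
  have hm : Measurable fun e : MarkSpace T => ‖(e.2.1 : ℝ)‖ₑ :=
    (measurable_of_countable fun y : ℤ => ‖(y : ℝ)‖ₑ).comp (measurable_fst.comp measurable_snd)
  rw [← lintegral_indicator (measurableSet_activeSet g),
    lintegral_intensity _ (hm.indicator (measurableSet_activeSet g))]
  have : ∀ s : Icc (0 : ℝ) T, ∫⁻ y, ∫⁻ z, (activeSet T g).indicator
      (fun e : MarkSpace T => ‖(e.2.1 : ℝ)‖ₑ) (s, y, z)
      ∂((volume : Measure ℝ).comap ((↑) : Ici (0 : ℝ) → ℝ)) ∂ρ ≤ jumpConst ρ g := by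
    refine fun s => lintegral_mono fun y => ?_
    calc _ ≤ ∫⁻ z, ({z : Ici (0 : ℝ) | (z : ℝ) ≤ g y}.indicator fun _ => ‖(y : ℝ)‖ₑ) z
          ∂((volume : Measure ℝ).comap ((↑) : Ici (0 : ℝ) → ℝ)) := by
          refine lintegral_mono fun z => ?_
          by_cases h : ((s, y, z) : MarkSpace T) ∈ activeSet T g
          · rw [indicator_of_mem h, indicator_of_mem (show z ∈ {z : Ici (0 : ℝ) | (z : ℝ) ≤ g y} from h.2.2)]
          · rw [indicator_of_notMem h]
            exact zero_le
      _ ≤ _ := by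
          rw [lintegral_indicator_const (measurableSet_le measurable_subtype_coe measurable_const)]
          exact mul_le_mul_right (volume_Ici_le _) _
  refine (lintegral_mono this).trans ?_
  rw [lintegral_const, mul_comm, comap_subtype_coe_apply measurableSet_Icc, image_univ, Subtype.range_coe]
  simp

/-- In the active region `|y| ≥ 1`, so the mass is at most the mean total jump weight. -/
theorem intensity_activeSet_lt_top {ρ : Measure ℤ} [IsFiniteMeasure ρ] {g : ℤ → ℝ}
    (hC : jumpConst ρ g < ∞) : intensity T ρ (activeSet T g) < ∞ := by
  refine lt_of_le_of_lt ?_ ((lintegral_activeSet_le (T := T) ρ g).trans_lt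
    (ENNReal.mul_lt_top ENNReal.ofReal_lt_top hC))
  rw [← setLIntegral_one]
  refine setLIntegral_mono' (measurableSet_activeSet g) fun e he => ?_
  rw [← ofReal_norm, ENNReal.one_le_ofReal, Real.norm_eq_abs]
  exact_mod_cast Int.one_le_abs he.2.1

/-- The restriction to the active region, of the measures for which it has finite mass. -/
noncomputable def activeKernel (T : ℝ) (g : ℤ → ℝ) :
    Kernel (Measure (MarkSpace T)) (MarkSpace T) where
  -- The value zero for infinite mass makes this a kernel of finite measures; for Poisson noise of
  -- finite active intensity that case has probability zero.
  toFun N := open Classical in if N (activeSet T g) < ∞ then N.restrict (activeSet T g) else 0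
  measurable' := by
    refine Measurable.ite (measurableSet_lt (Measure.measurable_coe (measurableSet_activeSet g))
      measurable_const) ?_ measurable_const
    refine Measure.measurable_of_measurable_coe _ fun B hB => ?_
    simp only [Measure.restrict_apply hB]
    exact Measure.measurable_coe (hB.inter (measurableSet_activeSet g))

theorem activeKernel_apply {g : ℤ → ℝ} {N : Measure (MarkSpace T)}
    (h : N (activeSet T g) < ∞) : activeKernel T g N = N.restrict (activeSet T g) :=
  if_pos h

instance (g : ℤ → ℝ) (N : Measure (MarkSpace T)) : IsFiniteMeasure (activeKernel T g N) := by
  by_cases h : N (activeSet T g) < ∞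
  · rw [activeKernel_apply h]
    exact ⟨by simpa using h⟩
  · have : activeKernel T g N = 0 := if_neg h
    rw [this]
    infer_instance

/-- A kernel of finite measures is s-finite. -/
theorem isSFiniteKernel_of_isFiniteMeasure {α β : Type*} [MeasurableSpace α] [MeasurableSpace β]
    (κ : Kernel α β) [∀ a, IsFiniteMeasure (κ a)] : IsSFiniteKernel κ := by
  classical
  -- The kernel is cut into countably many pieces by the integer part of its total mass; each piece
  -- is uniformly bounded.
  have hm : ∀ n : ℕ, MeasurableSet {a | ⌊(κ a univ).toReal⌋₊ = n} := fun n =>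
    (Nat.measurable_floor.comp (κ.measurable_coe MeasurableSet.univ).ennreal_toReal)
      (measurableSet_singleton n)
  refine ⟨fun n => Kernel.piecewise (hm n) κ 0, fun n => ⟨⟨n + 1, by finiteness, fun a => ?_⟩⟩, ?_⟩
  · rw [Kernel.piecewise_apply]
    split_ifs with h
    · have h : ⌊(κ a univ).toReal⌋₊ = n := h
      have := (Nat.lt_floor_add_one (κ a univ).toReal).le
      rw [h] at this
      rw [← ENNReal.ofReal_toReal (measure_ne_top (κ a) univ)]
      refine (ENNReal.ofReal_le_ofReal this).trans ?_
      rw [ENNReal.ofReal_add (by positivity) zero_le_one]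
      simp
    · simp
  · ext a B hB
    rw [Kernel.sum_apply' _ _ hB, tsum_eq_single ⌊(κ a univ).toReal⌋₊]
    · simp [Kernel.piecewise_apply]
    · intro n hn
      simp [Kernel.piecewise_apply, hn.symm]

instance (g : ℤ → ℝ) : IsSFiniteKernel (activeKernel T g) :=
  isSFiniteKernel_of_isFiniteMeasure _

end Intensity

/-! ### Poisson random measures and the compensation formula -/

section Compensation

variable {T : ℝ} {Ω : Type*} [mΩ : MeasurableSpace Ω] {P : Measure Ω}

theorem lintegral_natCast_poissonMeasure (r : ℝ≥0) : ∫⁻ n : ℕ, (n : ℝ≥0∞) ∂(poissonMeasure r) = r := by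
  have h : HasSum (fun n : ℕ => Real.exp (-r) * r ^ n / n.factorial * n) r := by
    rw [← hasSum_nat_add_iff' 1]
    have := (hasSum_one_poissonMeasure r).mul_left (r : ℝ)
    rw [mul_one] at this
    simp only [Finset.range_one, Finset.sum_singleton, Nat.cast_zero, mul_zero, sub_zero]
    refine Eq.mp (congrArg (fun f => HasSum f (r : ℝ)) (funext fun n => ?_)) this
    rw [Nat.factorial_succ]
    push_cast
    have : (n.factorial : ℝ) ≠ 0 := by positivity
    field_simp
    ring
  rw [lintegral_countable']
  have h2 : ∀ n : ℕ, (n : ℝ≥0∞) * poissonMeasure r {n} =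
      ENNReal.ofReal (Real.exp (-r) * r ^ n / n.factorial * n) := by
    intro n
    rw [poissonMeasure_singleton, mul_comm, ENNReal.ofReal_mul (by positivity),
      ENNReal.ofReal_natCast]
  simp_rw [h2]
  rw [← ENNReal.ofReal_tsum_of_nonneg (fun n => by positivity) h.summable, h.tsum_eq]
  simp

theorem IsPoissonRandomMeasure.lintegral_apply {E : Type*} [MeasurableSpace E]
    {N : Ω → Measure E} {m : Measure E} (h : IsPoissonRandomMeasure P N m) {A : Set E}
    (hA : MeasurableSet A) (hm : m A < ∞) : ∫⁻ ω, N ω A ∂P = m A := by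
  have h1 := (h.poisson A hA hm).lintegral_comp (f := id) measurable_id.aemeasurable
  simp only [id] at h1
  rw [h1, lintegral_map (f := fun x => x) measurable_id (measurable_of_countable _)]
  exact (lintegral_natCast_poissonMeasure _).trans (ENNReal.coe_toNNReal hm.ne)

theorem IsPoissonRandomMeasure.ae_mem_range {E : Type*} [MeasurableSpace E]
    {N : Ω → Measure E} {m : Measure E} (h : IsPoissonRandomMeasure P N m) {A : Set E}
    (hA : MeasurableSet A) (hm : m A < ∞) : ∀ᵐ ω ∂P, N ω A ∈ range (Nat.cast : ℕ → ℝ≥0∞) := by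
  have hr : MeasurableSet (range (Nat.cast : ℕ → ℝ≥0∞)) := (countable_range _).measurableSet
  have h1 := h.poisson A hA hm
  refine ae_of_ae_map h1.aemeasurable ?_
  rw [h1.map_eq]
  exact (ae_map_iff (measurable_of_countable _).aemeasurable hr).2
    (Eventually.of_forall fun n => ⟨n, rfl⟩)

theorem IsPoissonRandomMeasure.ae_lt_top {E : Type*} [MeasurableSpace E]
    {N : Ω → Measure E} {m : Measure E} (h : IsPoissonRandomMeasure P N m) {A : Set E}
    (hA : MeasurableSet A) (hm : m A < ∞) : ∀ᵐ ω ∂P, N ω A < ∞ := by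
  filter_upwards [h.ae_mem_range hA hm] with ω hω
  obtain ⟨n, hn⟩ := hω
  rw [← hn]
  exact ENNReal.natCast_lt_top n

/-- The noise after each time `t` is independent of `F t`. -/
def IndepFuture (P : Measure Ω) (F : Filtration (Icc (0 : ℝ) T) mΩ)
    (N : Ω → Measure (MarkSpace T)) : Prop :=
  ∀ t, Indep (F t)
    (MeasurableSpace.comap (fun ω => (N ω).restrict {e : MarkSpace T | t < e.1}) inferInstance) P

/-- The compensation formula: predictable integrands have the same mean integral with respect to
the noise and with respect to its intensity. -/
theorem lintegral_activeKernel [IsProbabilityMeasure P] (hT : 0 ≤ T) {ρ : Measure ℤ}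
    [IsFiniteMeasure ρ] {g : ℤ → ℝ} (hC : jumpConst ρ g < ∞) {F : Filtration (Icc (0 : ℝ) T) mΩ}
    {N : Ω → Measure (MarkSpace T)} (hN : IsPoissonRandomMeasure P N (intensity T ρ))
    (hF : IndepFuture P F N) {f : Ω × MarkSpace T → ℝ≥0∞}
    (hf : Measurable[predictableSpace F] f) :
    ∫⁻ ω, ∫⁻ e, f (ω, e) ∂(activeKernel T g (N ω)) ∂P =
      ∫⁻ ω, ∫⁻ e in activeSet T g, f (ω, e) ∂(intensity T ρ) ∂P := by
  let t₀ : Icc (0 : ℝ) T := ⟨0, le_rfl, hT⟩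
  have : Nonempty (Icc (0 : ℝ) T) := ⟨t₀⟩
  have hA := measurableSet_activeSet (T := T) g
  have hmA := intensity_activeSet_lt_top (T := T) hC
  have hfin := hN.ae_lt_top hA hmA
  have hle := predictableSpace_le F
  let κ : Kernel Ω (MarkSpace T) := (activeKernel T g).comap N hN.measurable
  have hrect : ∀ (G : Set Ω) (J : Set (Icc (0 : ℝ) T)) (B : Set (ℤ × Ici (0 : ℝ))),
      {p : Ω × MarkSpace T | p.1 ∈ G ∧ p.2.1 ∈ J ∧ p.2.2 ∈ B} = G ×ˢ (J ×ˢ B) := fun G J B => rfl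
  -- On marks later than `a` the noise is independent of `G ∈ F a`, so the mean factorizes.
  have hfuture : ∀ (a : Icc (0 : ℝ) T) (G : Set Ω), MeasurableSet[F a] G →
      ∀ D : Set (MarkSpace T), MeasurableSet D → D ⊆ {e | a < e.1} → intensity T ρ D < ∞ →
      ∫⁻ ω in G, N ω D ∂P = P G * intensity T ρ D := by
    intro a G hG D hD hDa hmD
    have hGm : MeasurableSet G := F.le a _ hG
    have hND : (fun ω => N ω D) = fun ω => (N ω).restrict {e : MarkSpace T | a < e.1} D := by
      ext ω
      rw [Measure.restrict_apply hD, inter_eq_left.2 hDa]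
    have h1 : Measurable[MeasurableSpace.comap
        (fun ω => (N ω).restrict {e : MarkSpace T | a < e.1}) inferInstance] (fun ω => N ω D) := by
      rw [hND]
      exact (Measure.measurable_coe hD).comp (comap_measurable _)
    have hmr : Measurable fun ω => (N ω).restrict {e : MarkSpace T | a < e.1} := by
      refine Measure.measurable_of_measurable_coe _ fun B hB => ?_
      simp only [Measure.restrict_apply hB]
      exact (Measure.measurable_coe (hB.inter
        (measurableSet_lt measurable_const measurable_fst))).comp hN.measurable
    have h0 : Measurable[F a] (G.indicator fun _ => (1 : ℝ≥0∞)) :=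
      Measurable.indicator measurable_const hG
    have h2 := lintegral_mul_eq_lintegral_mul_lintegral_of_independent_measurableSpace (F.le a)
      hmr.comap_le (hF a) (f := G.indicator fun _ => 1) h0 h1
    rw [lintegral_indicator_const hGm, one_mul, hN.lintegral_apply hD hmD] at h2
    rw [← h2, ← lintegral_indicator hGm]
    refine lintegral_congr fun ω => ?_
    by_cases hω : ω ∈ G <;> simp [hω]
  have huniv : (P ⊗ₘ κ) univ = intensity T ρ (activeSet T g) := by
    rw [Measure.compProd_apply MeasurableSet.univ]
    rw [← hN.lintegral_apply hA hmA]
    refine lintegral_congr_ae (hfin.mono fun ω hω => ?_)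
    show activeKernel T g (N ω) _ = _
    simp [activeKernel_apply hω]
  -- Both sides of the formula are finite measures on the predictable `σ`-field; it suffices that
  -- they agree on the generating π-system of rectangles. The trimming restricts them to that
  -- `σ`-field.
  have key : (P ⊗ₘ κ).trim hle = (P.prod ((intensity T ρ).restrict (activeSet T g))).trim hle := by
    have hfm : IsFiniteMeasure (P ⊗ₘ κ) := ⟨by rw [huniv]; exact hmA⟩
    have := isFiniteMeasure_trim (μ := P ⊗ₘ κ) hle
    refine @ext_of_generate_finite _ (predictableSpace F) _ _ (predictableRectangles F) rfl
      (isPiSystem_predictableRectangles F) _ (fun C hC => ?_) ?_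
    · have hCm := measurableSet_of_mem_predictableRectangles hC
      rw [trim_measurableSet_eq hle (MeasurableSpace.measurableSet_generateFrom hC),
        trim_measurableSet_eq hle (MeasurableSpace.measurableSet_generateFrom hC)]
      obtain ⟨G, J, B, hB, hJ, rfl⟩ := hC
      rw [hrect] at hCm ⊢
      -- The active region contains no mark at time `0`, so there `[0,T]` may be replaced by
      -- `(0,T]`, and both kinds of rectangles reduce to the independence of the future.
      obtain ⟨a, haG, haJ⟩ : ∃ a, MeasurableSet[F a] G ∧
          J ×ˢ B ∩ activeSet T g = Ioi a ×ˢ B ∩ activeSet T g := by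
        rcases hJ with ⟨rfl, h⟩ | ⟨a, rfl, h⟩
        · refine ⟨t₀, h t₀, ?_⟩
          ext e
          simp only [mem_inter_iff, mem_prod, mem_univ, true_and, mem_Ioi]
          exact ⟨fun he => ⟨⟨he.2.1, he.1⟩, he.2⟩, fun he => ⟨he.1.2, he.2⟩⟩
        · exact ⟨a, h, rfl⟩
      have hGm : MeasurableSet G := F.le a _ haG
      have hJm : MeasurableSet J := by
        rcases hJ with ⟨rfl, -⟩ | ⟨b, rfl, -⟩
        · exact MeasurableSet.univ
        · exact measurableSet_Ioi
      have hD : MeasurableSet (Ioi a ×ˢ B ∩ activeSet T g) := (measurableSet_Ioi.prod hB).inter hA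
      rw [Measure.prod_prod, Measure.restrict_apply (hJm.prod hB), haJ,
        ← hfuture a G haG _ hD (fun e he => he.1.1)
          ((measure_mono inter_subset_right).trans_lt hmA),
        Measure.compProd_apply hCm, ← lintegral_indicator hGm]
      refine lintegral_congr_ae (hfin.mono fun ω hω => ?_)
      show activeKernel T g (N ω) _ = _
      rw [activeKernel_apply hω]
      by_cases hG : ω ∈ G
      · rw [mk_preimage_prod_right hG, Measure.restrict_apply (hJm.prod hB), haJ,
          indicator_of_mem hG]
      · rw [mk_preimage_prod_right_eq_empty hG, indicator_of_notMem hG, measure_empty]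
    · rw [trim_measurableSet_eq hle MeasurableSet.univ, trim_measurableSet_eq hle MeasurableSet.univ,
        huniv, ← univ_prod_univ, Measure.prod_prod]
      simp
  have hfm : Measurable f := hf.mono hle le_rfl
  have h1 := Measure.lintegral_compProd (μ := P) (κ := κ) hfm
  rw [← lintegral_prod _ hfm.aemeasurable, ← lintegral_trim hle hf, ← key, lintegral_trim hle hf,
    h1]
  rfl

end Compensation

end EdgeMeanField

namespace EdgeMeanField

/-! ### Gronwall's inequality by an exponential weight -/

section Gronwall

variable {T : ℝ}

/-- Lebesgue measure on `[0,T]`. -/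
noncomputable abbrev timeMeasure (T : ℝ) : Measure (Icc (0 : ℝ) T) :=
  (volume : Measure ℝ).comap ((↑) : Icc (0 : ℝ) T → ℝ)

/-- The weight `exp (c t)`. -/
noncomputable def expWeight (c : ℝ) (t : Icc (0 : ℝ) T) : ℝ≥0∞ := ENNReal.ofReal (Real.exp (c * t))

theorem measurable_expWeight (c : ℝ) : Measurable (expWeight (T := T) c) := by
  unfold expWeight
  fun_prop

theorem one_le_expWeight {c : ℝ} (hc : 0 ≤ c) (t : Icc (0 : ℝ) T) : 1 ≤ expWeight c t :=
  ENNReal.one_le_ofReal.2 (Real.one_le_exp (mul_nonneg hc t.2.1))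

theorem mul_lintegral_expWeight_le {c : ℝ} (hc : 0 ≤ c) (t : Icc (0 : ℝ) T) :
    ENNReal.ofReal c * ∫⁻ s in {s | s ≤ t}, expWeight c s ∂(timeMeasure T) ≤ expWeight c t := by
  have h1 : ∫⁻ s in {s | s ≤ t}, expWeight c s ∂(timeMeasure T) ≤
      ∫⁻ s in Icc (0 : ℝ) t, ENNReal.ofReal (Real.exp (c * s)) := by
    have hm : MeasurableSet {s : ℝ | s ≤ t} := measurableSet_le measurable_id measurable_const
    have := lintegral_subtype_comap (μ := (volume : Measure ℝ)) measurableSet_Icc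
      (s := Icc (0 : ℝ) T)
      ({s : ℝ | s ≤ t}.indicator fun s : ℝ => ENNReal.ofReal (Real.exp (c * s)))
    rw [setLIntegral_indicator hm] at this
    calc _ = ∫⁻ s, ({s : ℝ | s ≤ t}.indicator fun s : ℝ => ENNReal.ofReal (Real.exp (c * s))) s
          ∂(timeMeasure T) := by
          have e : MeasurableSet {s : Icc (0 : ℝ) T | s ≤ t} := measurableSet_Iic
          rw [← lintegral_indicator e]
          rfl
      _ = _ := this
      _ ≤ _ := lintegral_mono_set (by
          rintro s ⟨h1, h2⟩
          exact ⟨h2.1, h1⟩)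
  refine (mul_le_mul_right h1 _).trans ?_
  rw [← lintegral_const_mul' _ _ ENNReal.ofReal_ne_top]
  simp_rw [← ENNReal.ofReal_mul hc]
  have hi : IntegrableOn (fun s : ℝ => c * Real.exp (c * s)) (Icc 0 (t : ℝ)) :=
    (by fun_prop : Continuous fun s : ℝ => c * Real.exp (c * s)).continuousOn.integrableOn_compact
      isCompact_Icc
  rw [← ofReal_integral_eq_lintegral_ofReal hi (Eventually.of_forall fun s => by positivity)]
  refine ENNReal.ofReal_le_ofReal ?_
  rw [integral_Icc_eq_integral_Ioc, ← intervalIntegral.integral_of_le t.2.1,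
    intervalIntegral.integral_eq_sub_of_hasDerivAt (f := fun s => Real.exp (c * s))]
  · simp
  · intro s _
    have := ((hasDerivAt_id s).const_mul c).exp
    simp only [id, mul_one] at this
    rwa [mul_comm]
  · exact (by fun_prop : Continuous fun s : ℝ => c * Real.exp (c * s)).intervalIntegrable _ _

/-- With the weight `exp (2 K t)`, the operator `u ↦ K ∫ u` contracts by the factor `1 / 2`. -/
theorem lintegral_le_half_expWeight (K : ℝ≥0) {u : Icc (0 : ℝ) T → ℝ≥0∞} {B : ℝ≥0∞}
    (hu : ∀ t, u t ≤ B * expWeight (2 * K) t) (t : Icc (0 : ℝ) T) :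
    (K : ℝ≥0∞) * ∫⁻ s in {s | s ≤ t}, u s ∂(timeMeasure T) ≤ B / 2 * expWeight (2 * K) t := by
  have h1 := mul_lintegral_expWeight_le (c := 2 * K) (by positivity) t
  have h2 : ENNReal.ofReal (2 * (K : ℝ)) = 2 * K := by
    rw [ENNReal.ofReal_mul (by norm_num)]
    simp
  rw [h2] at h1
  calc _ ≤ (K : ℝ≥0∞) * ∫⁻ s in {s | s ≤ t}, B * expWeight (2 * K) s ∂(timeMeasure T) := by
        gcongr
        exact hu _
    _ = (K : ℝ≥0∞) * (B * ∫⁻ s in {s | s ≤ t}, expWeight (2 * K) s ∂(timeMeasure T)) := by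
        rw [lintegral_const_mul _ (measurable_expWeight _)]
    _ = B / 2 * (2 * K * ∫⁻ s in {s | s ≤ t}, expWeight (2 * K) s ∂(timeMeasure T)) := by
        have : B = B / 2 * 2 := (ENNReal.div_mul_cancel (by norm_num) (by norm_num)).symm
        conv_lhs => rw [this]
        ring
    _ ≤ _ := by gcongr

/-- Gronwall's inequality for bounded functions. -/
theorem le_of_le_add_lintegral (K : ℝ≥0) {u : Icc (0 : ℝ) T → ℝ≥0∞} {a M : ℝ≥0∞} (hM : M ≠ ∞)
    (huM : ∀ t, u t ≤ M)
    (hu : ∀ t, u t ≤ a + K * ∫⁻ s in {s | s ≤ t}, u s ∂(timeMeasure T)) (t : Icc (0 : ℝ) T) :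
    u t ≤ 2 * a * expWeight (2 * K) t := by
  have hw : ∀ t : Icc (0 : ℝ) T, 1 ≤ expWeight (2 * K) t := one_le_expWeight (by positivity)
  -- One application of the inequality turns a weighted bound `B` into `a + B / 2`. Its fixed point
  -- is `2 a`, and the excess over it, at first `M`, is halved each time.
  have key : ∀ n : ℕ, ∀ t, u t ≤ (2 * a + M * 2⁻¹ ^ n) * expWeight (2 * K) t := by
    intro n
    induction n with
    | zero =>
      intro t
      refine (huM t).trans ?_
      calc M ≤ (2 * a + M * 2⁻¹ ^ 0) * 1 := by simp
        _ ≤ _ := by gcongr; exact hw t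
    | succ n ih =>
      intro t
      refine (hu t).trans ?_
      calc a + K * ∫⁻ s in {s | s ≤ t}, u s ∂(timeMeasure T)
          ≤ a * expWeight (2 * K) t + (2 * a + M * 2⁻¹ ^ n) / 2 * expWeight (2 * K) t := by
            refine add_le_add ?_ (lintegral_le_half_expWeight K ih t)
            calc a = a * 1 := (mul_one a).symm
              _ ≤ _ := by gcongr; exact hw t
        _ = _ := by
            rw [← add_mul, ENNReal.div_eq_inv_mul, mul_add, ← mul_assoc,
              ENNReal.inv_mul_cancel (by norm_num) (by norm_num)]
            ring
  have hlim : Tendsto (fun n : ℕ => (2 * a + M * 2⁻¹ ^ n) * expWeight (2 * K) t) atTop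
      (𝓝 ((2 * a + M * 0) * expWeight (2 * K) t)) := by
    refine ENNReal.Tendsto.mul_const (Tendsto.const_add _ (ENNReal.Tendsto.const_mul
      (ENNReal.tendsto_pow_atTop_nhds_zero_of_lt_one ENNReal.one_half_lt_one) (Or.inr hM))) ?_
    exact Or.inr ENNReal.ofReal_ne_top
  simpa using ge_of_tendsto' hlim fun n => key n t

end Gronwall

/-! ### The total difference of the jumps of two solutions -/

section JumpDist

variable {T : ℝ} {γ : ℤ → ℤ → ℤ → ℤ → ℝ} {g : ℤ → ℝ}

/-- A nonzero jump needs `y ≠ 0` and `z` below a rate that is itself at most `g y`. -/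
theorem RateBound.jump_eq_zero (h : RateBound γ g) (x : Icc (0 : ℝ) T → ℤ)
    (ν : Icc (0 : ℝ) T → ProbabilityMeasure (ℤ × ℤ)) {e : MarkSpace T} (he : e ∉ activeSet T g)
    (h0 : 0 < (e.1 : ℝ)) : jump γ x ν e = 0 := by
  unfold jump
  split_ifs with hz
  · by_contra hy
    exact he ⟨h0, by exact_mod_cast hy, hz.trans (h.totalRate_le _ _ _)⟩
  · rfl

theorem enorm_jump_le (x : Icc (0 : ℝ) T → ℤ)
    (ν : Icc (0 : ℝ) T → ProbabilityMeasure (ℤ × ℤ)) (e : MarkSpace T) :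
    ‖jump γ x ν e‖ₑ ≤ ‖(e.2.1 : ℝ)‖ₑ := by
  unfold jump
  split_ifs <;> simp

theorem RateBound.jump_ae_eq_indicator (h : RateBound γ g) (x : Icc (0 : ℝ) T → ℤ)
    (ν : Icc (0 : ℝ) T → ProbabilityMeasure (ℤ × ℤ)) {N : Measure (MarkSpace T)}
    (hN : N {e | (e.1 : ℝ) = 0} = 0) :
    jump γ x ν =ᵐ[N] (activeSet T g).indicator (jump γ x ν) := by
  have : ∀ᵐ e ∂N, ¬ (e.1 : ℝ) = 0 := by
    rw [ae_iff]
    simpa using hN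
  filter_upwards [this] with e he
  by_cases hA : e ∈ activeSet T g
  · rw [indicator_of_mem hA]
  · rw [indicator_of_notMem hA, h.jump_eq_zero x ν hA (lt_of_le_of_ne e.1.2.1 (Ne.symm he))]

theorem activeKernel_restrict {N : Measure (MarkSpace T)} (hA : N (activeSet T g) < ∞)
    (S : Set (MarkSpace T)) :
    (activeKernel T g N).restrict S = (N.restrict S).restrict (activeSet T g) := by
  rw [activeKernel_apply hA, Measure.restrict_comm (measurableSet_activeSet g)]

theorem RateBound.integrableOn_jump_iff (h : RateBound γ g) (x : Icc (0 : ℝ) T → ℤ)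
    (ν : Icc (0 : ℝ) T → ProbabilityMeasure (ℤ × ℤ)) {N : Measure (MarkSpace T)}
    (hN : N {e | (e.1 : ℝ) = 0} = 0) (hA : N (activeSet T g) < ∞) (S : Set (MarkSpace T)) :
    IntegrableOn (jump γ x ν) S N ↔ IntegrableOn (jump γ x ν) S (activeKernel T g N) := by
  rw [IntegrableOn, IntegrableOn, activeKernel_restrict hA,
    integrable_congr (ae_restrict_of_ae (h.jump_ae_eq_indicator x ν hN)),
    integrable_indicator_iff (measurableSet_activeSet g), IntegrableOn]

theorem RateBound.setIntegral_jump (h : RateBound γ g) (x : Icc (0 : ℝ) T → ℤ)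
    (ν : Icc (0 : ℝ) T → ProbabilityMeasure (ℤ × ℤ)) {N : Measure (MarkSpace T)}
    (hN : N {e | (e.1 : ℝ) = 0} = 0) (hA : N (activeSet T g) < ∞) (S : Set (MarkSpace T)) :
    ∫ e in S, jump γ x ν e ∂N = ∫ e in S, jump γ x ν e ∂(activeKernel T g N) := by
  rw [activeKernel_restrict hA,
    integral_congr_ae (ae_restrict_of_ae (h.jump_ae_eq_indicator x ν hN)),
    integral_indicator (measurableSet_activeSet g)]

/-- The equation, with the noise restricted to the active region. -/
theorem RateBound.solvesEquation_iff (h : RateBound γ g) {x₀ : ℤ} {N : Measure (MarkSpace T)}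
    (hN : N {e | (e.1 : ℝ) = 0} = 0) (hA : N (activeSet T g) < ∞)
    (ν : Icc (0 : ℝ) T → ProbabilityMeasure (ℤ × ℤ)) (x : PathSpace T ℤ) :
    SolvesEquation γ x₀ N ν x ↔ SolvesEquation γ x₀ (activeKernel T g N) ν x := by
  unfold SolvesEquation
  simp_rw [h.integrableOn_jump_iff x ν hN hA, h.setIntegral_jump x ν hN hA]

theorem enorm_jump_sub_le (x x' : Icc (0 : ℝ) T → ℤ)
    (ν ν' : Icc (0 : ℝ) T → ProbabilityMeasure (ℤ × ℤ)) (e : MarkSpace T) :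
    ‖jump γ x ν e - jump γ x' ν' e‖ₑ ≤ ‖(e.2.1 : ℝ)‖ₑ := by
  unfold jump
  split_ifs <;> simp

/-- The total weight of the jumps that the noise allows. -/
noncomputable def jumpMass (g : ℤ → ℝ) (N : Measure (MarkSpace T)) : ℝ≥0∞ :=
  ∫⁻ e, ‖(e.2.1 : ℝ)‖ₑ ∂(activeKernel T g N)

/-- The total difference up to time `t` of the jumps of two paths with the same noise. -/
noncomputable def jumpDist (γ : ℤ → ℤ → ℤ → ℤ → ℝ) (g : ℤ → ℝ) (x x' : Icc (0 : ℝ) T → ℤ)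
    (ν ν' : Icc (0 : ℝ) T → ProbabilityMeasure (ℤ × ℤ)) (N : Measure (MarkSpace T))
    (t : Icc (0 : ℝ) T) : ℝ≥0∞ :=
  ∫⁻ e in {e | e.1 ≤ t}, ‖jump γ x ν e - jump γ x' ν' e‖ₑ ∂(activeKernel T g N)

theorem jumpDist_mono (x x' : Icc (0 : ℝ) T → ℤ) (ν ν' : Icc (0 : ℝ) T → ProbabilityMeasure (ℤ × ℤ))
    (N : Measure (MarkSpace T)) : Monotone (jumpDist γ g x x' ν ν' N) := fun _ _ hst =>
  lintegral_mono_set fun _ he => le_trans (show _ ≤ _ from he) hst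

theorem jumpDist_le_jumpMass (x x' : Icc (0 : ℝ) T → ℤ)
    (ν ν' : Icc (0 : ℝ) T → ProbabilityMeasure (ℤ × ℤ)) (N : Measure (MarkSpace T))
    (t : Icc (0 : ℝ) T) : jumpDist γ g x x' ν ν' N t ≤ jumpMass g N :=
  (setLIntegral_le_lintegral _ _).trans (lintegral_mono fun e => enorm_jump_sub_le x x' ν ν' e)

theorem enorm_intCast_real (k : ℤ) : ‖(k : ℝ)‖ₑ = ‖k‖ₑ := by
  rw [← ofReal_norm, ← ofReal_norm, Int.norm_cast_real]

/-- The common initial state cancels, so this bound needs no moment of it. -/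
theorem SolvesEquation.enorm_sub_le {x₀ : ℤ} {N : Measure (MarkSpace T)}
    {ν ν' : Icc (0 : ℝ) T → ProbabilityMeasure (ℤ × ℤ)} {x x' : PathSpace T ℤ}
    (hx : SolvesEquation γ x₀ (activeKernel T g N) ν x)
    (hx' : SolvesEquation γ x₀ (activeKernel T g N) ν' x') (t : Icc (0 : ℝ) T) :
    ‖x t - x' t‖ₑ ≤ jumpDist γ g x x' ν ν' N t := by
  rw [← enorm_intCast_real, Int.cast_sub, (hx t).2, (hx' t).2, add_sub_add_left_eq_sub,
    ← integral_sub (hx t).1 (hx' t).1]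
  exact enorm_integral_le_lintegral_enorm _

theorem measurable_jumpMass (g : ℤ → ℝ) : Measurable (jumpMass (T := T) g) := by
  refine Measurable.lintegral_kernel (κ := activeKernel T g) ?_
  exact (measurable_of_countable fun y : ℤ => ‖(y : ℝ)‖ₑ).comp (measurable_fst.comp measurable_snd)

variable {Ω : Type*} [mΩ : MeasurableSpace Ω]

theorem RateBound.measurable_jumpDist (h : RateBound γ g) (hT : 0 ≤ T)
    {X X' : Ω → PathSpace T ℤ} {ν ν' : Ω → Icc (0 : ℝ) T → ProbabilityMeasure (ℤ × ℤ)}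
    {N : Ω → Measure (MarkSpace T)} (hN : Measurable N)
    (hν : ∀ ω t, ∃ l, Tendsto (ν ω) (𝓝[<] t) (𝓝 l))
    (hν' : ∀ ω t, ∃ l, Tendsto (ν' ω) (𝓝[<] t) (𝓝 l))
    (hr : ∀ t y, Measurable (fun ω => totalRate γ y (X ω t) (ν ω t)))
    (hr' : ∀ t y, Measurable (fun ω => totalRate γ y (X' ω t) (ν' ω t))) (t : Icc (0 : ℝ) T) :
    Measurable fun ω => jumpDist γ g (X ω) (X' ω) (ν ω) (ν' ω) (N ω) t := by
  have hS : MeasurableSet {e : MarkSpace T | e.1 ≤ t} :=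
    measurableSet_le measurable_fst measurable_const
  have hm : Measurable fun p : Ω × MarkSpace T => {e : MarkSpace T | e.1 ≤ t}.indicator
      (fun e => ‖jump γ (X p.1) (ν p.1) e - jump γ (X' p.1) (ν' p.1) e‖ₑ) p.2 :=
    Measurable.ite (measurable_snd hS)
      ((h.measurable_jump hT hν hr).sub (h.measurable_jump hT hν' hr')).enorm measurable_const
  unfold jumpDist
  simp_rw [← lintegral_indicator hS]
  exact Measurable.lintegral_kernel_prod_right' (κ := (activeKernel T g).comap N hN) hm

end JumpDist

end EdgeMeanField

namespace EdgeMeanField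

/-! ### The mean total difference of the jumps -/

section MeanJumpDist

variable {T : ℝ} {γ : ℤ → ℤ → ℤ → ℤ → ℝ} {g : ℤ → ℝ} {Ω : Type*} [mΩ : MeasurableSpace Ω]
  {P : Measure Ω}

theorem measurable_enorm_sub {α : Type*} [MeasurableSpace α] {a b : α → ℝ} (ha : Measurable a)
    (hb : Measurable b) : Measurable fun x => ‖a x - b x‖ₑ :=
  (ha.sub hb).enorm

/-- The two indicators differ only for `z` between `a` and `b`, a set of length at most `|a - b|`.
This turns the discontinuous jump coefficient into a Lipschitz one in mean. -/
theorem lintegral_enorm_ite_sub_le (y a b : ℝ) :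
    ∫⁻ z, ‖(open Classical in if ((z : Ici (0 : ℝ)) : ℝ) ≤ a then y else 0) -
        (open Classical in if (z : ℝ) ≤ b then y else 0)‖ₑ
      ∂((volume : Measure ℝ).comap ((↑) : Ici (0 : ℝ) → ℝ)) ≤ ‖y‖ₑ * ‖a - b‖ₑ := by
  wlog hab : a ≤ b generalizing a b
  · have := this b a (not_le.1 hab).le
    rw [enorm_sub_rev a b]
    refine le_trans (lintegral_mono fun z => ?_) this
    rw [enorm_sub_rev]
  have hm : MeasurableSet {z : Ici (0 : ℝ) | a < (z : ℝ) ∧ (z : ℝ) ≤ b} :=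
    (measurableSet_lt measurable_const measurable_subtype_coe).inter
      (measurableSet_le measurable_subtype_coe measurable_const)
  calc _ ≤ ∫⁻ z, ({z : Ici (0 : ℝ) | a < (z : ℝ) ∧ (z : ℝ) ≤ b}.indicator fun _ => ‖y‖ₑ) z
        ∂((volume : Measure ℝ).comap ((↑) : Ici (0 : ℝ) → ℝ)) := by
        refine lintegral_mono fun z => ?_
        by_cases h1 : (z : ℝ) ≤ a
        · simp [h1, h1.trans hab]
        · by_cases h2 : (z : ℝ) ≤ b
          · rw [indicator_of_mem (show z ∈ {z : Ici (0 : ℝ) | a < (z : ℝ) ∧ (z : ℝ) ≤ b} from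
              ⟨not_le.1 h1, h2⟩)]
            simp [h1, h2]
          · simp [h1, h2]
    _ ≤ _ := by
        rw [lintegral_indicator_const hm]
        gcongr
        refine (volume_Ici_Ioc_le a b).trans ?_
        rw [enorm_sub_rev, Real.enorm_of_nonneg (sub_nonneg.2 hab)]

/-- A bound for the mean distance of the rates, evaluated at the left limits. -/
theorem RateBound.lintegral_rate_leftLim_le (h : RateBound γ g)
    {X X' : Ω → PathSpace T ℤ} {ν ν' : Ω → Icc (0 : ℝ) T → ProbabilityMeasure (ℤ × ℤ)}
    (hν : ∀ ω t, ∃ l, Tendsto (ν ω) (𝓝[<] t) (𝓝 l))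
    (hν' : ∀ ω t, ∃ l, Tendsto (ν' ω) (𝓝[<] t) (𝓝 l)) {y : ℤ}
    (hr : ∀ t, Measurable (fun ω => totalRate γ y (X ω t) (ν ω t)))
    (hr' : ∀ t, Measurable (fun ω => totalRate γ y (X' ω t) (ν' ω t)))
    {v : Icc (0 : ℝ) T → ℝ≥0∞} (hv : Monotone v)
    (hb : ∀ t, ∫⁻ ω, ‖totalRate γ y (X ω t) (ν ω t) - totalRate γ y (X' ω t) (ν' ω t)‖ₑ ∂P ≤ v t)
    (t : Icc (0 : ℝ) T) :
    ∫⁻ ω, ‖totalRate γ y (Function.leftLim (X ω) t) (Function.leftLim (ν ω) t) -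
      totalRate γ y (Function.leftLim (X' ω) t) (Function.leftLim (ν' ω) t)‖ₑ ∂P ≤ v t := by
  have h1 : ∀ ω, Tendsto (fun m => ‖totalRate γ y (X ω (gridDown m t)) (ν ω (gridDown m t)) -
      totalRate γ y (X' ω (gridDown m t)) (ν' ω (gridDown m t))‖ₑ) atTop
      (𝓝 ‖totalRate γ y (Function.leftLim (X ω) t) (Function.leftLim (ν ω) t) -
      totalRate γ y (Function.leftLim (X' ω) t) (Function.leftLim (ν' ω) t)‖ₑ) := fun ω =>
    ((h.tendsto_totalRate (hν ω) y t).sub (h.tendsto_totalRate (hν' ω) y t)).enorm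
  simp_rw [← fun ω => (h1 ω).liminf_eq]
  -- Fatou's lemma along the grid; `v` is monotone, so the bounds at the earlier grid times are at
  -- most `v t`.
  refine (lintegral_liminf_le fun m => ((hr _).sub (hr' _)).enorm).trans ?_
  refine liminf_le_of_le (by isBoundedDefault) fun b hb' => ?_
  obtain ⟨m, hm⟩ := hb'.exists
  exact hm.trans ((hb _).trans (hv (gridDown_le m t)))

variable [IsProbabilityMeasure P]

/-- The mean of `jumpDist` is controlled by the mean distance of the rates. -/
theorem RateBound.lintegral_jumpDist_le (h : RateBound γ g) (hT : 0 ≤ T) {ρ : Measure ℤ}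
    [IsFiniteMeasure ρ] (hC : jumpConst ρ g < ∞) {F : Filtration (Icc (0 : ℝ) T) mΩ}
    {N : Ω → Measure (MarkSpace T)} (hN : IsPoissonRandomMeasure P N (intensity T ρ))
    (hF : IndepFuture P F N)
    {X X' : Ω → PathSpace T ℤ} {ν ν' : Ω → Icc (0 : ℝ) T → ProbabilityMeasure (ℤ × ℤ)}
    (hν : ∀ ω t, ∃ l, Tendsto (ν ω) (𝓝[<] t) (𝓝 l))
    (hν' : ∀ ω t, ∃ l, Tendsto (ν' ω) (𝓝[<] t) (𝓝 l))
    (hr : ∀ t y, Measurable[F t] (fun ω => totalRate γ y (X ω t) (ν ω t)))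
    (hr' : ∀ t y, Measurable[F t] (fun ω => totalRate γ y (X' ω t) (ν' ω t)))
    {v : Icc (0 : ℝ) T → ℝ≥0∞} (hv : Monotone v)
    (hb : ∀ t y, ∫⁻ ω, ‖totalRate γ y (X ω t) (ν ω t) - totalRate γ y (X' ω t) (ν' ω t)‖ₑ ∂P ≤
      ENNReal.ofReal (g y) * v t)
    (t : Icc (0 : ℝ) T) :
    ∫⁻ ω, jumpDist γ g (X ω) (X' ω) (ν ω) (ν' ω) (N ω) t ∂P ≤
      jumpConst ρ g * ∫⁻ s in {s | s ≤ t}, v s ∂(timeMeasure T) := by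
  let t₀ : Icc (0 : ℝ) T := ⟨0, le_rfl, hT⟩
  have : Nonempty (Icc (0 : ℝ) T) := ⟨t₀⟩
  have hA := measurableSet_activeSet (T := T) g
  have hS : MeasurableSet {e : MarkSpace T | e.1 ≤ t} :=
    measurableSet_le measurable_fst measurable_const
  have hSt : MeasurableSet {s : Icc (0 : ℝ) T | s ≤ t} := measurableSet_Iic
  have hrm : ∀ t y, Measurable (fun ω => totalRate γ y (X ω t) (ν ω t)) :=
    fun t y => (hr t y).mono (F.le t) le_rfl
  have hrm' : ∀ t y, Measurable (fun ω => totalRate γ y (X' ω t) (ν' ω t)) :=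
    fun t y => (hr' t y).mono (F.le t) le_rfl
  let f : Ω × MarkSpace T → ℝ≥0∞ := fun p => {e : MarkSpace T | e.1 ≤ t}.indicator
      (fun e => ‖jump γ (X p.1) (ν p.1) e - jump γ (X' p.1) (ν' p.1) e‖ₑ) p.2
  have hf : Measurable[predictableSpace F] f := by
    have h1 : MeasurableSet[predictableSpace F] {p : Ω × MarkSpace T | p.2.1 ≤ t} := by
      convert (measurableSet_predictable_Ioi F (a := t) MeasurableSet.univ).compl using 1
      ext p
      simp
    have h2 : Measurable[predictableSpace F] fun p : Ω × MarkSpace T =>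
        ‖jump γ (X p.1) (ν p.1) p.2 - jump γ (X' p.1) (ν' p.1) p.2‖ₑ :=
      @measurable_enorm_sub _ (predictableSpace F) _ _ (h.measurable_predictable_jump hν t₀ hr)
        (h.measurable_predictable_jump hν' t₀ hr')
    have h3 : Measurable[predictableSpace F] ({p : Ω × MarkSpace T | p.2.1 ≤ t}.indicator
        fun p => ‖jump γ (X p.1) (ν p.1) p.2 - jump γ (X' p.1) (ν' p.1) p.2‖ₑ) := h2.indicator h1
    exact h3
  have hfm : Measurable f := hf.mono (predictableSpace_le F) le_rfl
  have hfA : Measurable fun q : MarkSpace T × Ω => (activeSet T g).indicator (fun e => f (q.2, e)) q.1 :=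
    Measurable.ite (measurable_fst hA) (hfm.comp measurable_swap) measurable_const
  -- The compensation formula replaces the noise by its intensity; Tonelli then moves the
  -- expectation inside.
  have e1 : ∫⁻ ω, jumpDist γ g (X ω) (X' ω) (ν ω) (ν' ω) (N ω) t ∂P =
      ∫⁻ e, ∫⁻ ω, (activeSet T g).indicator (fun e => f (ω, e)) e ∂P ∂(intensity T ρ) := by
    rw [← lintegral_lintegral_swap
      (f := fun ω e => (activeSet T g).indicator (fun e => f (ω, e)) e)
      (hfA.comp measurable_swap).aemeasurable]
    simp_rw [lintegral_indicator hA]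
    rw [← lintegral_activeKernel hT hC hN hF hf]
    unfold jumpDist
    simp_rw [← lintegral_indicator hS]
    rfl
  rw [e1, lintegral_intensity _ (Measurable.lintegral_prod_right' hfA),
    ← lintegral_indicator hSt, jumpConst, ← lintegral_const_mul _ (hv.measurable.indicator hSt)]
  refine lintegral_mono fun s => ?_
  by_cases hs : s ≤ t
  swap
  · have : ∀ y z ω, (activeSet T g).indicator (fun e => f (ω, e)) ((s, y, z) : MarkSpace T) = 0 := by
      intro y z ω
      rw [indicator_apply_eq_zero]
      exact fun _ => indicator_of_notMem (s := {e : MarkSpace T | e.1 ≤ t}) hs _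
    simp [this]
  rw [indicator_of_mem (show s ∈ {s | s ≤ t} from hs), mul_comm, ← lintegral_const_mul _ (measurable_of_countable _)]
  refine lintegral_mono fun y => ?_
  rw [lintegral_lintegral_swap (f := fun z ω =>
    (activeSet T g).indicator (fun e => f (ω, e)) ((s, y, z) : MarkSpace T)) (hfA.comp
    ((measurable_const.prodMk (measurable_const.prodMk measurable_fst)).prodMk measurable_snd)).aemeasurable]
  calc _ ≤ ∫⁻ ω, ‖(y : ℝ)‖ₑ *
        ‖totalRate γ y (Function.leftLim (X ω) s) (Function.leftLim (ν ω) s) -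
        totalRate γ y (Function.leftLim (X' ω) s) (Function.leftLim (ν' ω) s)‖ₑ ∂P := by
        refine lintegral_mono fun ω => ?_
        -- For fixed time, jump size and outcome, the integral over `z` is at most `|y|` times the
        -- distance of the rates at the left limits.
        refine le_trans (lintegral_mono fun z => ?_) (lintegral_enorm_ite_sub_le (y : ℝ) _ _)
        exact (indicator_le_self _ _ _).trans (indicator_le_self _ _ _)
    _ ≤ ‖(y : ℝ)‖ₑ * (ENNReal.ofReal (g y) * v s) := by
        rw [lintegral_const_mul' _ _ enorm_ne_top]
        gcongr
        exact h.lintegral_rate_leftLim_le hν hν' (fun t => hrm t y) (fun t => hrm' t y)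
          (fun _ _ hab => mul_le_mul_right (hv hab) _) (fun t => hb t y) s
    _ = _ := by ring

theorem lintegral_jumpMass_le (hT : 0 ≤ T) {ρ : Measure ℤ}
    [IsFiniteMeasure ρ] (hC : jumpConst ρ g < ∞) {F : Filtration (Icc (0 : ℝ) T) mΩ}
    {N : Ω → Measure (MarkSpace T)} (hN : IsPoissonRandomMeasure P N (intensity T ρ))
    (hF : IndepFuture P F N) :
    ∫⁻ ω, jumpMass g (N ω) ∂P ≤ ENNReal.ofReal T * jumpConst ρ g := by
  have hf : Measurable[predictableSpace F] fun p : Ω × MarkSpace T => ‖(p.2.2.1 : ℝ)‖ₑ :=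
    ((measurable_of_countable fun y : ℤ => ‖(y : ℝ)‖ₑ).comp measurable_fst).comp
      (measurable_predictable_mark F)
  have := lintegral_activeKernel hT hC hN hF hf
  refine (this.trans_le ?_)
  simpa using lintegral_activeSet_le (T := T) ρ g

end MeanJumpDist

end EdgeMeanField

namespace EdgeMeanField

/-! ### Integer-valued measures and integrals -/

section IntegerValued

/-- A finite measure with integer values on the finite intersections of a generating sequence of
sets has integer values. -/
theorem measure_mem_range_natCast {α : Type*} [mα : MeasurableSpace α]
    [MeasurableSpace.CountablyGenerated α] {μ : Measure α} [IsFiniteMeasure μ]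
    (h : ∀ I : Finset ℕ, μ (⋂ n ∈ I, MeasurableSpace.natGeneratingSequence α n) ∈
      range (Nat.cast : ℕ → ℝ≥0∞)) {B : Set α} (hB : MeasurableSet B) :
    μ B ∈ range (Nat.cast : ℕ → ℝ≥0∞) := by
  let s := MeasurableSpace.natGeneratingSequence α
  have hgen : mα = MeasurableSpace.generateFrom
      (piiUnionInter (fun k => {s k}) (univ : Set ℕ)) := by
    rw [generateFrom_piiUnionInter_singleton_left]
    have : {t | ∃ k ∈ (univ : Set ℕ), s k = t} = range s := by
      ext t
      simp
    rw [this]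
    exact (MeasurableSpace.generateFrom_natGeneratingSequence α).symm
  have huniv : μ univ ∈ range (Nat.cast : ℕ → ℝ≥0∞) := by simpa using h ∅
  induction B, hB using MeasurableSpace.induction_on_inter hgen
    (isPiSystem_piiUnionInter _ (fun k => IsPiSystem.singleton _) _) with
  | empty => exact ⟨0, by simp⟩
  | basic t ht =>
    obtain ⟨I, -, f, hf, rfl⟩ := ht
    have : ⋂ x ∈ I, f x = ⋂ x ∈ I, s x := iInter₂_congr fun x hx => hf x hx
    rw [this]
    exact h I
  | compl t ht ih =>
    obtain ⟨a, ha⟩ := huniv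
    obtain ⟨b, hb⟩ := ih
    exact ⟨a - b, by rw [measure_compl ht (measure_ne_top _ _), ← ha, ← hb, ENNReal.natCast_sub]⟩
  | iUnion f hd hm ih =>
    choose k hk using ih
    rw [measure_iUnion hd hm]
    have hne : ∑' i, μ (f i) ≠ ∞ := by
      rw [← measure_iUnion hd hm]
      exact measure_ne_top _ _
    -- A convergent series of natural numbers has only finitely many nonzero terms, so its sum is a
    -- natural number.
    have h0 := ENNReal.tendsto_cofinite_zero_of_tsum_ne_top hne
    have hfin : ∀ᶠ i in cofinite, μ (f i) = 0 := by
      filter_upwards [h0.eventually_lt_const zero_lt_one] with i hi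
      rw [← hk i] at hi ⊢
      have : k i < 1 := by exact_mod_cast hi
      simp [Nat.lt_one_iff.1 this]
    rw [tsum_eq_sum (s := (eventually_cofinite.1 hfin).toFinset) (fun i hi => by simpa using hi)]
    refine ⟨∑ i ∈ (eventually_cofinite.1 hfin).toFinset, k i, ?_⟩
    push_cast
    exact Finset.sum_congr rfl fun i _ => hk i

/-- The integral of an integer valued function with respect to an integer valued measure. -/
theorem integral_mem_range_intCast {α : Type*} [MeasurableSpace α] {μ : Measure α}
    [IsFiniteMeasure μ] (h : ∀ B, MeasurableSet B → μ B ∈ range (Nat.cast : ℕ → ℝ≥0∞))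
    {f : α → ℤ} (hf : Measurable f) : ∫ a, (f a : ℝ) ∂μ ∈ range (Int.cast : ℤ → ℝ) := by
  by_cases hi : Integrable (fun a => (f a : ℝ)) μ
  swap
  · exact ⟨0, by rw [integral_undef hi, Int.cast_zero]⟩
  have hi' : Integrable (fun k : ℤ => (k : ℝ)) (μ.map f) :=
    (integrable_map_measure (measurable_of_countable _).aestronglyMeasurable hf.aemeasurable).2 hi
  have h1 : ∫ a, (f a : ℝ) ∂μ = ∫ k : ℤ, (k : ℝ) ∂(μ.map f) :=
    (integral_map hf.aemeasurable (measurable_of_countable _).aestronglyMeasurable).symm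
  rw [h1]
  have hs := hasSum_integral_iUnion (μ := μ.map f) (f := fun k : ℤ => (k : ℝ))
    (s := fun k : ℤ => {k}) (fun k => measurableSet_singleton k)
    (fun i j hij => by simpa using hij) hi'.integrableOn
  have huniv : ⋃ k : ℤ, ({k} : Set ℤ) = univ := by
    ext; simp
  rw [huniv, setIntegral_univ] at hs
  -- The integral is the sum over all values `k` of `k` times the integer mass of that value.
  -- Partial sums are integers, and the integers are closed in the reals.
  refine Int.isClosedEmbedding_coe_real.isClosed_range.mem_of_tendsto hs
    (Eventually.of_forall fun s => ?_)
  have : ∀ k : ℤ, ∃ c : ℤ, ∫ x in ({k} : Set ℤ), (x : ℝ) ∂(μ.map f) = c := by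
    intro k
    obtain ⟨c, hc⟩ := h _ (hf (measurableSet_singleton k))
    refine ⟨c * k, ?_⟩
    rw [integral_singleton, Measure.real, Measure.map_apply hf (measurableSet_singleton k), ← hc]
    simp
  choose c hc using this
  exact ⟨∑ k ∈ s, c k, by push_cast; exact Finset.sum_congr rfl fun k _ => (hc k).symm⟩

end IntegerValued

/-! ### Regularity of integrals as functions of time -/

section Regular

variable {T : ℝ}

/-- Right continuity and existence of left limits. -/
def IsRegular {S : Type*} [TopologicalSpace S] (f : Icc (0 : ℝ) T → S) : Prop :=
  (∀ t, ContinuousWithinAt f (Ici t) t) ∧ ∀ t, ∃ l, Tendsto f (𝓝[<] t) (𝓝 l)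

/-- The constant path. -/
def constPath {S : Type*} [TopologicalSpace S] (c : S) : PathSpace T S :=
  ⟨fun _ => c, fun _ => continuousWithinAt_const, fun _ => ⟨c, tendsto_const_nhds⟩⟩

/-- The integers are closed in the reals, so left limits of integer functions are integers. At time
`0` there is nothing on the left and any value serves. -/
theorem IsRegular.of_intCast {f : Icc (0 : ℝ) T → ℤ} (h : IsRegular fun t => (f t : ℝ)) :
    IsRegular f := by
  have he := Int.isClosedEmbedding_coe_real
  refine ⟨fun t => he.isInducing.tendsto_nhds_iff.2 (h.1 t), fun t => ?_⟩
  rcases eq_or_neBot (𝓝[<] t) with hb | hb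
  · exact ⟨0, by rw [hb]; exact tendsto_bot⟩
  obtain ⟨l, hl⟩ := h.2 t
  obtain ⟨k, rfl⟩ := he.isClosed_range.mem_of_tendsto hl (Eventually.of_forall fun s => ⟨f s, rfl⟩)
  exact ⟨k, he.isInducing.tendsto_nhds_iff.2 hl⟩

/-- The integral up to time `t` is right continuous with left limits in `t`. -/
theorem isRegular_setIntegral {μ : Measure (MarkSpace T)} {f : MarkSpace T → ℝ}
    (hf : Integrable f μ) (c : ℝ) : IsRegular fun t => c + ∫ e in {e | e.1 ≤ t}, f e ∂μ := by
  have hm : ∀ t : Icc (0 : ℝ) T, MeasurableSet {e : MarkSpace T | e.1 ≤ t} := fun t =>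
    measurableSet_le measurable_fst measurable_const
  have hm' : ∀ t : Icc (0 : ℝ) T, MeasurableSet {e : MarkSpace T | e.1 < t} := fun t =>
    measurableSet_lt measurable_fst measurable_const
  simp_rw [← integral_indicator (hm _)]
  -- Dominated convergence: for each mark the indicator is eventually constant. From the right it
  -- tends to the indicator of `{e.1 ≤ t}`, from the left to that of `{e.1 < t}`.
  have key : ∀ (l : Filter (Icc (0 : ℝ) T)) [l.IsCountablyGenerated] (F : MarkSpace T → ℝ),
      (∀ e, ∀ᶠ t in l, {e : MarkSpace T | e.1 ≤ t}.indicator f e = F e) →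
      Tendsto (fun t => c + ∫ e, {e : MarkSpace T | e.1 ≤ t}.indicator f e ∂μ) l
        (𝓝 (c + ∫ e, F e ∂μ)) := by
    intro l _ F hF
    refine Tendsto.const_add _ (tendsto_integral_filter_of_dominated_convergence (fun e => ‖f e‖)
      ?_ ?_ hf.norm ?_)
    · exact Eventually.of_forall fun t => (hf.indicator (hm t)).aestronglyMeasurable
    · exact Eventually.of_forall fun t => Eventually.of_forall fun e => norm_indicator_le_norm_self _ _
    · exact Eventually.of_forall fun e => tendsto_const_nhds.congr' ((hF e).mono fun t ht => ht.symm)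
  refine ⟨fun t => key _ _ fun e => ?_, fun t => ⟨_, key _ ({e | e.1 < t}.indicator f) fun e => ?_⟩⟩
  · by_cases he : e.1 ≤ t
    · filter_upwards [self_mem_nhdsWithin] with s hs
      rw [indicator_of_mem (show e ∈ {e : MarkSpace T | e.1 ≤ s} from le_trans he hs),
        indicator_of_mem (show e ∈ {e : MarkSpace T | e.1 ≤ t} from he)]
    · filter_upwards [mem_nhdsWithin_of_mem_nhds (Iio_mem_nhds (not_le.1 he))] with s hs
      rw [indicator_of_notMem (show e ∉ {e : MarkSpace T | e.1 ≤ s} from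
          fun h : e.1 ≤ s => lt_irrefl _ (lt_of_le_of_lt h hs)),
        indicator_of_notMem (show e ∉ {e : MarkSpace T | e.1 ≤ t} from he)]
  · by_cases he : e.1 < t
    · filter_upwards [mem_nhdsWithin_of_mem_nhds (Ioi_mem_nhds he)] with s hs
      rw [indicator_of_mem (show e ∈ {e : MarkSpace T | e.1 ≤ s} from
          (show e.1 < s from hs).le),
        indicator_of_mem (show e ∈ {e : MarkSpace T | e.1 < t} from he)]
    · filter_upwards [self_mem_nhdsWithin] with s hs
      rw [indicator_of_notMem (show e ∉ {e : MarkSpace T | e.1 ≤ s} from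
          not_le.2 (lt_of_lt_of_le hs (not_lt.1 he))),
        indicator_of_notMem (show e ∉ {e : MarkSpace T | e.1 < t} from he)]

end Regular

/-! ### The right-hand side of the equation as a map on paths -/

section NextPath

variable {T : ℝ} {γ : ℤ → ℤ → ℤ → ℤ → ℝ} {g : ℤ → ℝ}

/-- The realizations of the noise that are integer valued and of finite total jump mass on the
active region. -/
def goodNoise (T : ℝ) (g : ℤ → ℝ) : Set (Measure (MarkSpace T)) :=
  {N | N (activeSet T g) < ∞ ∧ jumpMass g N < ∞ ∧ ∀ I : Finset ℕ, activeKernel T g N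
    (⋂ n ∈ I, MeasurableSpace.natGeneratingSequence (MarkSpace T) n) ∈ range (Nat.cast : ℕ → ℝ≥0∞)}

/-- There are only countably many finite sets of indices, so integrality costs countably many
measurable conditions; it extends to all measurable sets because the finite intersections form a
generating π-system. -/
theorem measurableSet_goodNoise (g : ℤ → ℝ) : MeasurableSet (goodNoise T g) := by
  refine (measurableSet_lt (Measure.measurable_coe (measurableSet_activeSet g))
    measurable_const).inter ((measurableSet_lt (measurable_jumpMass g) measurable_const).inter ?_)
  have : {N : Measure (MarkSpace T) | ∀ I : Finset ℕ, activeKernel T g N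
      (⋂ n ∈ I, MeasurableSpace.natGeneratingSequence (MarkSpace T) n) ∈
        range (Nat.cast : ℕ → ℝ≥0∞)} = ⋂ I : Finset ℕ, {N | activeKernel T g N
      (⋂ n ∈ I, MeasurableSpace.natGeneratingSequence (MarkSpace T) n) ∈
        range (Nat.cast : ℕ → ℝ≥0∞)} := by
    ext; simp
  show MeasurableSet {N : Measure (MarkSpace T) | _}
  rw [this]
  exact MeasurableSet.iInter fun I => (activeKernel T g).measurable_coe
    (Finset.measurableSet_biInter I fun n _ =>
      MeasurableSpace.measurableSet_natGeneratingSequence n) (countable_range _).measurableSet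

theorem activeKernel_mem_range {N : Measure (MarkSpace T)} (hN : N ∈ goodNoise T g)
    {B : Set (MarkSpace T)} (hB : MeasurableSet B) :
    activeKernel T g N B ∈ range (Nat.cast : ℕ → ℝ≥0∞) :=
  measure_mem_range_natCast hN.2.2 hB

theorem mem_goodNoise_of_forall {N : Measure (MarkSpace T)} (h1 : N (activeSet T g) < ∞)
    (h2 : jumpMass g N < ∞)
    (h3 : ∀ B, MeasurableSet B → activeKernel T g N B ∈ range (Nat.cast : ℕ → ℝ≥0∞)) :
    N ∈ goodNoise T g :=
  ⟨h1, h2, fun I => h3 _ (Finset.measurableSet_biInter I fun n _ =>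
      MeasurableSpace.measurableSet_natGeneratingSequence n)⟩

theorem activeKernel_restrict_apply {N : Measure (MarkSpace T)} (hA : N (activeSet T g) < ∞)
    (S : Set (MarkSpace T)) :
    activeKernel T g (N.restrict S) = (activeKernel T g N).restrict S := by
  rw [activeKernel_restrict hA, activeKernel_apply]
  exact (Measure.restrict_le_self _).trans_lt hA

theorem goodNoise_restrict {N : Measure (MarkSpace T)} (hN : N ∈ goodNoise T g)
    {S : Set (MarkSpace T)} (hS : MeasurableSet S) : N.restrict S ∈ goodNoise T g := by
  refine mem_goodNoise_of_forall ((Measure.restrict_le_self _).trans_lt hN.1) ?_ fun B hB => ?_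
  · refine lt_of_le_of_lt ?_ hN.2.1
    rw [jumpMass, activeKernel_restrict_apply hN.1]
    exact setLIntegral_le_lintegral _ _
  · rw [activeKernel_restrict_apply hN.1, Measure.restrict_apply hB]
    exact activeKernel_mem_range hN (hB.inter hS)

theorem RateBound.measurable_jump_const (h : RateBound γ g) (hT : 0 ≤ T) (x : PathSpace T ℤ)
    {ν : Icc (0 : ℝ) T → ProbabilityMeasure (ℤ × ℤ)}
    (hν : ∀ t, ∃ l, Tendsto ν (𝓝[<] t) (𝓝 l)) : Measurable (jump γ x ν) :=
  (h.measurable_jump (Ω := Unit) (X := fun _ => x) (ν := fun _ => ν) hT (fun _ => hν)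
    fun _ _ => measurable_const).comp (measurable_const (a := ()) |>.prodMk measurable_id)

theorem RateBound.integrable_jump (h : RateBound γ g) (hT : 0 ≤ T) (x : PathSpace T ℤ)
    {ν : Icc (0 : ℝ) T → ProbabilityMeasure (ℤ × ℤ)}
    (hν : ∀ t, ∃ l, Tendsto ν (𝓝[<] t) (𝓝 l)) {N : Measure (MarkSpace T)}
    (hN : jumpMass g N < ∞) : Integrable (jump γ x ν) (activeKernel T g N) :=
  ⟨(h.measurable_jump_const hT x hν).aestronglyMeasurable,
    (lintegral_mono fun e => enorm_jump_le x ν e).trans_lt hN⟩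

theorem exists_int_eq_setIntegral_jump (h : RateBound γ g) (hT : 0 ≤ T) (x : PathSpace T ℤ)
    {ν : Icc (0 : ℝ) T → ProbabilityMeasure (ℤ × ℤ)}
    (hν : ∀ t, ∃ l, Tendsto ν (𝓝[<] t) (𝓝 l)) {N : Measure (MarkSpace T)}
    (hN : N ∈ goodNoise T g) {S : Set (MarkSpace T)} (hS : MeasurableSet S) :
    ∫ e in S, jump γ x ν e ∂(activeKernel T g N) ∈ range (Int.cast : ℤ → ℝ) := by
  have h1 : ∀ e, jump γ x ν e = ((⌊jump γ x ν e⌋ : ℤ) : ℝ) := by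
    intro e
    unfold jump
    split_ifs <;> simp
  have h2 : Measurable fun e => ⌊jump γ x ν e⌋ :=
    Int.measurable_floor.comp (h.measurable_jump_const hT x hν)
  rw [integral_congr_ae (Eventually.of_forall h1)]
  refine integral_mem_range_intCast (fun B hB => ?_) h2
  rw [Measure.restrict_apply hB]
  exact activeKernel_mem_range hN (hB.inter hS)

/-- The right-hand side of the equation, as a path; constant if the noise is not good. -/
noncomputable def nextPath (γ : ℤ → ℤ → ℤ → ℤ → ℝ) (g : ℤ → ℝ)
    (ν : Icc (0 : ℝ) T → ProbabilityMeasure (ℤ × ℤ)) (x : PathSpace T ℤ) (x₀ : ℤ)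
    (N : Measure (MarkSpace T)) : PathSpace T ℤ :=
  open Classical in
  if h : N ∈ goodNoise T g ∧
      IsRegular (fun t => x₀ + ⌊∫ e in {e | e.1 ≤ t}, jump γ x ν e ∂(activeKernel T g N)⌋) then
    ⟨_, h.2.1, h.2.2⟩ else constPath x₀

variable {ν : Icc (0 : ℝ) T → ProbabilityMeasure (ℤ × ℤ)}

/-- On good noise the integral is an integer, regular in `t`. Neither the rounding nor the default
path in the definition then has any effect. -/
theorem RateBound.nextPath_cast (h : RateBound γ g) (hT : 0 ≤ T)
    (hν : ∀ t, ∃ l, Tendsto ν (𝓝[<] t) (𝓝 l)) (x : PathSpace T ℤ) (x₀ : ℤ)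
    {N : Measure (MarkSpace T)} (hN : N ∈ goodNoise T g) (t : Icc (0 : ℝ) T) :
    (nextPath γ g ν x x₀ N t : ℝ) =
      x₀ + ∫ e in {e | e.1 ≤ t}, jump γ x ν e ∂(activeKernel T g N) := by
  have hm : ∀ t : Icc (0 : ℝ) T, MeasurableSet {e : MarkSpace T | e.1 ≤ t} := fun t =>
    measurableSet_le measurable_fst measurable_const
  have h1 : ∀ t : Icc (0 : ℝ) T,
      ((x₀ + ⌊∫ e in {e | e.1 ≤ t}, jump γ x ν e ∂(activeKernel T g N)⌋ : ℤ) : ℝ) =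
        x₀ + ∫ e in {e | e.1 ≤ t}, jump γ x ν e ∂(activeKernel T g N) := by
    intro t
    obtain ⟨k, hk⟩ := exists_int_eq_setIntegral_jump h hT x hν hN (hm t)
    rw [← hk]
    simp
  have h2 : IsRegular (fun t : Icc (0 : ℝ) T =>
      x₀ + ⌊∫ e in {e | e.1 ≤ t}, jump γ x ν e ∂(activeKernel T g N)⌋) := by
    refine IsRegular.of_intCast ?_
    simp_rw [h1]
    exact isRegular_setIntegral (h.integrable_jump hT x hν hN.2.1) x₀
  rw [nextPath, dif_pos ⟨hN, h2⟩]
  exact h1 t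

theorem nextPath_of_notMem (x : PathSpace T ℤ) (x₀ : ℤ)
    {N : Measure (MarkSpace T)} (hN : N ∉ goodNoise T g) :
    nextPath γ g ν x x₀ N = constPath x₀ := dif_neg fun h => hN h.1

theorem RateBound.solvesEquation_of_nextPath_eq (h : RateBound γ g) (hT : 0 ≤ T)
    (hν : ∀ t, ∃ l, Tendsto ν (𝓝[<] t) (𝓝 l)) {x : PathSpace T ℤ} {x₀ : ℤ}
    {N : Measure (MarkSpace T)} (hN : N ∈ goodNoise T g) (hx : nextPath γ g ν x x₀ N = x) :
    SolvesEquation γ x₀ (activeKernel T g N) ν x := by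
  refine fun t => ⟨(h.integrable_jump hT x hν hN.2.1).integrableOn, ?_⟩
  rw [← h.nextPath_cast hT hν x x₀ hN t, hx]

theorem RateBound.enorm_nextPath_sub_le (h : RateBound γ g) (hT : 0 ≤ T)
    {ν' : Icc (0 : ℝ) T → ProbabilityMeasure (ℤ × ℤ)} (hν : ∀ t, ∃ l, Tendsto ν (𝓝[<] t) (𝓝 l))
    (hν' : ∀ t, ∃ l, Tendsto ν' (𝓝[<] t) (𝓝 l)) (x x' : PathSpace T ℤ) (x₀ : ℤ)
    (N : Measure (MarkSpace T)) (t : Icc (0 : ℝ) T) :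
    ‖nextPath γ g ν x x₀ N t - nextPath γ g ν' x' x₀ N t‖ₑ ≤ jumpDist γ g x x' ν ν' N t := by
  by_cases hN : N ∈ goodNoise T g
  · rw [← enorm_intCast_real, Int.cast_sub, h.nextPath_cast hT hν x x₀ hN,
      h.nextPath_cast hT hν' x' x₀ hN, add_sub_add_left_eq_sub,
      ← integral_sub (h.integrable_jump hT x hν hN.2.1).integrableOn
        (h.integrable_jump hT x' hν' hN.2.1).integrableOn]
    exact enorm_integral_le_lintegral_enorm _
  · simp [nextPath_of_notMem _ _ hN]

/-- The value at time `t` depends only on the path before `t` and the noise up to time `t`. -/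
theorem RateBound.nextPath_congr (h : RateBound γ g) (hT : 0 ≤ T)
    (hν : ∀ t, ∃ l, Tendsto ν (𝓝[<] t) (𝓝 l)) {x x' : PathSpace T ℤ} (x₀ : ℤ)
    {N : Measure (MarkSpace T)} (hN : N ∈ goodNoise T g) {t : Icc (0 : ℝ) T}
    (hx : ∀ s ≤ t, x s = x' s) {s : Icc (0 : ℝ) T} (hs : s ≤ t) :
    nextPath γ g ν x x₀ N s = nextPath γ g ν x' x₀ (N.restrict {e | e.1 ≤ t}) s := by
  have hm : ∀ t : Icc (0 : ℝ) T, MeasurableSet {e : MarkSpace T | e.1 ≤ t} := fun t =>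
    measurableSet_le measurable_fst measurable_const
  -- The left limit at `r` is a limit of values at grid points not after `r`, where the two paths
  -- agree.
  have hl : ∀ r ≤ t, Function.leftLim x r = Function.leftLim x' r := by
    intro r hr
    have h1 := tendsto_leftLim_gridDown r (x.left_limit r)
    have h2 := tendsto_leftLim_gridDown r (x'.left_limit r)
    refine tendsto_nhds_unique h1 (h2.congr fun m => ?_)
    exact (hx _ ((gridDown_le m r).trans hr)).symm
  have key : (nextPath γ g ν x x₀ N s : ℝ) =
      nextPath γ g ν x' x₀ (N.restrict {e | e.1 ≤ t}) s := by
    rw [h.nextPath_cast hT hν x x₀ hN, h.nextPath_cast hT hν x' x₀ (goodNoise_restrict hN (hm t)),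
      activeKernel_restrict_apply hN.1, Measure.restrict_restrict (hm s)]
    have : {e : MarkSpace T | e.1 ≤ s} ∩ {e | e.1 ≤ t} = {e | e.1 ≤ s} :=
      inter_eq_left.2 fun e he => le_trans he hs
    rw [this]
    congr 1
    refine setIntegral_congr_fun (hm s) fun e he => ?_
    simp only [jump, hl e.1 (le_trans he hs)]
  exact_mod_cast key

variable {Ω : Type*} [mΩ : MeasurableSpace Ω]

theorem RateBound.measurable_totalRate_comp (γ : ℤ → ℤ → ℤ → ℤ → ℝ) {X : Ω → PathSpace T ℤ}
    (hX : Measurable X) (ν : Icc (0 : ℝ) T → ProbabilityMeasure (ℤ × ℤ)) (t : Icc (0 : ℝ) T)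
    (y : ℤ) : Measurable fun ω => totalRate γ y (X ω t) (ν t) :=
  (measurable_of_countable fun x : ℤ => totalRate γ y x (ν t)).comp
    ((PathSpace.measurable_eval t).comp hX)

/-- On good noise the value at a fixed time is the integral of a jointly measurable function against
a kernel, up to rounding; off that measurable set it is the initial state. -/
theorem RateBound.measurable_nextPath (h : RateBound γ g) (hT : 0 ≤ T)
    (hν : ∀ t, ∃ l, Tendsto ν (𝓝[<] t) (𝓝 l)) {X : Ω → PathSpace T ℤ} (hX : Measurable X)
    {X₀ : Ω → ℤ} (hX₀ : Measurable X₀) {N : Ω → Measure (MarkSpace T)} (hN : Measurable N) :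
    Measurable fun ω => nextPath γ g ν (X ω) (X₀ ω) (N ω) := by
  classical
  refine PathSpace.measurable_of_eval fun t => ?_
  have hm : MeasurableSet {e : MarkSpace T | e.1 ≤ t} :=
    measurableSet_le measurable_fst measurable_const
  have hj : Measurable fun p : Ω × MarkSpace T => {e : MarkSpace T | e.1 ≤ t}.indicator
      (jump γ (X p.1) ν) p.2 :=
    Measurable.ite (measurable_snd hm) (h.measurable_jump hT (fun _ => hν)
      (fun t y => RateBound.measurable_totalRate_comp γ hX ν t y)) measurable_const
  have hI : Measurable fun ω => ∫ e in {e | e.1 ≤ t}, jump γ (X ω) ν e ∂(activeKernel T g (N ω)) := by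
    simp_rw [← integral_indicator hm]
    exact (StronglyMeasurable.integral_kernel_prod_right' (κ := (activeKernel T g).comap N hN)
      hj.stronglyMeasurable).measurable
  have : (fun ω => nextPath γ g ν (X ω) (X₀ ω) (N ω) t) = fun ω => if N ω ∈ goodNoise T g then
      X₀ ω + ⌊∫ e in {e | e.1 ≤ t}, jump γ (X ω) ν e ∂(activeKernel T g (N ω))⌋ else X₀ ω := by
    ext ω
    split_ifs with hg
    · obtain ⟨k, hk⟩ := exists_int_eq_setIntegral_jump h hT (X ω) hν hg hm
      have := h.nextPath_cast hT hν (X ω) (X₀ ω) hg t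
      rw [← hk] at this ⊢
      rw [Int.floor_intCast]
      exact_mod_cast this
    · rw [nextPath_of_notMem _ _ hg]
      rfl
  rw [this]
  exact Measurable.ite (hN (measurableSet_goodNoise g)) (hX₀.add (Int.measurable_floor.comp hI)) hX₀

end NextPath

end EdgeMeanField

namespace EdgeMeanField

/-! ### The law of a Poisson random measure is determined by its intensity -/

section PoissonLaw

variable {Ω : Type*} [mΩ : MeasurableSpace Ω] {P : Measure Ω} {E : Type*} [MeasurableSpace E]

/-- The cells of the partition of `A` that finitely many sets generate. -/
def partitionCell {E ι : Type*} (A : Set E) (B : ι → Set E) (σ : ι → Bool) : Set E :=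
  A ∩ {e | ∀ j, e ∈ B j ↔ σ j = true}

theorem measurableSet_partitionCell {ι : Type*} [Countable ι] {A : Set E} {B : ι → Set E}
    (hA : MeasurableSet A) (hB : ∀ j, MeasurableSet (B j)) (σ : ι → Bool) :
    MeasurableSet (partitionCell A B σ) := by
  have : {e | ∀ j, e ∈ B j ↔ σ j = true} = ⋂ j, {e | e ∈ B j ↔ σ j = true} := by
    ext; simp
  rw [partitionCell, this]
  refine hA.inter (MeasurableSet.iInter fun j => ?_)
  cases h : σ j
  · have : {e | e ∈ B j ↔ false = true} = (B j)ᶜ := by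
      ext; simp
    rw [this]
    exact (hB j).compl
  · simpa using hB j

theorem disjoint_partitionCell {E ι : Type*} (A : Set E) (B : ι → Set E) {σ τ : ι → Bool}
    (h : σ ≠ τ) : Disjoint (partitionCell A B σ) (partitionCell A B τ) := by
  rw [Set.disjoint_left]
  rintro e ⟨-, h1⟩ ⟨-, h2⟩
  refine h (funext fun j => ?_)
  have := (h1 j).symm.trans (h2 j)
  rwa [← Bool.eq_iff_iff] at this

theorem measure_eq_sum_partitionCell {ι : Type*} [Fintype ι] [DecidableEq ι] {A : Set E}
    {B : ι → Set E} (hA : MeasurableSet A) (hB : ∀ j, MeasurableSet (B j)) (μ : Measure E) (j : ι) :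
    μ (B j ∩ A) = ∑ σ : ι → Bool, if σ j = true then μ (partitionCell A B σ) else 0 := by
  classical
  rw [← Finset.sum_filter, ← measure_biUnion_finset]
  · congr 1
    ext e
    simp only [mem_inter_iff, Finset.mem_filter, Finset.mem_univ, true_and, mem_iUnion,
      partitionCell, mem_ofPred_eq, exists_prop]
    constructor
    · rintro ⟨h1, h2⟩
      exact ⟨fun j => decide (e ∈ B j), by simpa using h1, h2, fun j => by simp⟩
    · rintro ⟨σ, h1, h2, h3⟩
      exact ⟨(h3 j).2 h1, h2⟩
  · exact fun σ _ τ _ h => disjoint_partitionCell A B h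
  · exact fun σ _ => measurableSet_partitionCell hA hB σ

/-- The joint law of the values of a Poisson random measure on finitely many sets is determined
by the intensity. -/
theorem IsPoissonRandomMeasure.map_apply_eq [IsProbabilityMeasure P] {N N' : Ω → Measure E}
    {m : Measure E} (h : IsPoissonRandomMeasure P N m) (h' : IsPoissonRandomMeasure P N' m)
    {A : Set E} (hA : MeasurableSet A) (hm : m A < ∞) {ι : Type*} [Fintype ι] {B : ι → Set E}
    (hB : ∀ j, MeasurableSet (B j)) :
    P.map (fun ω j => N ω (B j ∩ A)) = P.map (fun ω j => N' ω (B j ∩ A)) := by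
  classical
  let e := Fintype.equivFin (ι → Bool)
  let C : Fin (Fintype.card (ι → Bool)) → Set E := fun i => partitionCell A B (e.symm i)
  have hC : ∀ i, MeasurableSet (C i) := fun i => measurableSet_partitionCell hA hB _
  have hmC : ∀ i, m (C i) < ∞ := fun i => (measure_mono inter_subset_left).trans_lt hm
  have hd : Pairwise (Function.onFun Disjoint C) := fun i j hij =>
    disjoint_partitionCell A B fun hc => hij (e.symm.injective hc)
  let G : (Fin (Fintype.card (ι → Bool)) → ℝ≥0∞) → ι → ℝ≥0∞ := fun v j =>
    ∑ σ : ι → Bool, if σ j = true then v (e σ) else 0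
  have hG : Measurable G := by
    refine measurable_pi_lambda _ fun j => Finset.measurable_sum _ fun σ _ => ?_
    split_ifs
    · exact measurable_pi_apply _
    · exact measurable_const
  -- The masses of the disjoint cells are independent Poisson variables. The masses of the given
  -- sets are sums of them, so the joint law is the image under `G` of a product law that depends on
  -- `m` only.
  have key : ∀ M : Ω → Measure E, IsPoissonRandomMeasure P M m →
      P.map (fun ω j => M ω (B j ∩ A)) =
        (Measure.pi fun i => (poissonMeasure (m (C i)).toNNReal).map
          (fun k : ℕ => (k : ℝ≥0∞))).map G := by
    intro M hM
    have hmeas : ∀ i, Measurable fun ω => M ω (C i) := fun i =>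
      (Measure.measurable_coe (hC i)).comp hM.measurable
    have h1 := (iIndepFun_iff_map_fun_eq_pi_map (fun i => (hmeas i).aemeasurable)).1
      (hM.indep _ C hC hd)
    simp_rw [fun i => (hM.poisson (C i) (hC i) (hmC i)).map_eq] at h1
    rw [← h1, Measure.map_map hG (measurable_pi_lambda _ hmeas)]
    congr 1
    ext ω j
    rw [measure_eq_sum_partitionCell hA hB]
    simp [G, C]
  rw [key N h, key N' h']

/-- The `σ`-field on measures is generated by the process of the values on measurable sets. -/
theorem measurableSpace_measure_eq :
    (Measure.instMeasurableSpace : MeasurableSpace (Measure E)) =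
      MeasurableSpace.comap (fun μ (s : {s : Set E // MeasurableSet s}) => μ s.1)
        MeasurableSpace.pi := by
  rw [MeasurableSpace.pi, MeasurableSpace.comap_iSup, iSup_subtype]
  simp_rw [MeasurableSpace.comap_comp]
  rfl

/-- The law of a Poisson random measure, restricted to a set of finite intensity, is determined
by the intensity. -/
theorem IsPoissonRandomMeasure.map_restrict_eq [IsProbabilityMeasure P] {N N' : Ω → Measure E}
    {m : Measure E} (h : IsPoissonRandomMeasure P N m) (h' : IsPoissonRandomMeasure P N' m)
    {A : Set E} (hA : MeasurableSet A) (hm : m A < ∞) :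
    P.map (fun ω => (N ω).restrict A) = P.map (fun ω => (N' ω).restrict A) := by
  have hmr : ∀ M : Ω → Measure E, Measurable M → Measurable fun ω => (M ω).restrict A := by
    intro M hM
    refine Measure.measurable_of_measurable_coe _ fun B hB => ?_
    simp only [Measure.restrict_apply hB]
    exact (Measure.measurable_coe (hB.inter hA)).comp hM
  let V : Measure E → {s : Set E // MeasurableSet s} → ℝ≥0∞ := fun μ s => μ s.1
  have hV : Measurable V := measurable_pi_lambda _ fun s => Measure.measurable_coe s.2
  -- The law of a process is determined by its finite-dimensional laws; here the index set consists
  -- of all measurable sets.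
  have hproc : P.map (fun ω => V ((N ω).restrict A)) = P.map (fun ω => V ((N' ω).restrict A)) := by
    refine (map_eq_iff_forall_finset_map_restrict_eq
      (X := fun (s : {s : Set E // MeasurableSet s}) ω => (N ω).restrict A s.1)
      (Y := fun (s : {s : Set E // MeasurableSet s}) ω => (N' ω).restrict A s.1)
      (hV.comp (hmr N h.measurable)).aemeasurable
      (hV.comp (hmr N' h'.measurable)).aemeasurable).2 fun I => ?_
    have := h.map_apply_eq h' hA hm (ι := I) (B := fun s => s.1.1) (fun s => s.1.2)
    have e : ∀ M : Ω → Measure E, (fun ω => I.restrict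
        (fun s : {s : Set E // MeasurableSet s} => (M ω).restrict A s.1)) =
        fun ω (s : I) => M ω (s.1.1 ∩ A) := by
      intro M
      ext ω s
      simp [Measure.restrict_apply s.1.2]
    rw [e, e, this]
  ext S hS
  rw [measurableSpace_measure_eq] at hS
  obtain ⟨S', hS', rfl⟩ := hS
  have e : ∀ M : Ω → Measure E, Measurable M →
      P.map (fun ω => (M ω).restrict A) (V ⁻¹' S') = P.map (fun ω => V ((M ω).restrict A)) S' := by
    intro M hM
    rw [Measure.map_apply (hmr M hM) (hV hS'), Measure.map_apply (f := fun ω => V ((M ω).restrict A))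
      (hV.comp (hmr M hM)) hS']
    rfl
  exact (e N h.measurable).trans ((congrArg (fun μ => μ S') hproc).trans (e N' h'.measurable).symm)

end PoissonLaw

/-! ### Completion of the filtration -/

section Completion

variable {T : ℝ} {Ω : Type*} [mΩ : MeasurableSpace Ω] {P : Measure Ω}

/-- The filtration of the measurable sets that agree almost everywhere with one of `F t`. -/
def completedFiltration (P : Measure Ω) (F : Filtration (Icc (0 : ℝ) T) mΩ) :
    Filtration (Icc (0 : ℝ) T) mΩ where
  seq t := eventuallyMeasurableSpace (F t) (ae P) ⊓ mΩ
  mono' s t hst := by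
    refine inf_le_inf_right _ fun A hA => ?_
    obtain ⟨B, hB, hAB⟩ := hA
    exact ⟨B, F.mono hst _ hB, hAB⟩
  le' t := inf_le_right

theorem le_completedFiltration (F : Filtration (Icc (0 : ℝ) T) mΩ) (t : Icc (0 : ℝ) T) :
    F t ≤ completedFiltration P F t :=
  le_inf (fun A hA => ⟨A, hA, ae_eq_refl A⟩) (F.le t)

theorem measurable_completedFiltration {E : Type*} [MeasurableSpace E]
    {F : Filtration (Icc (0 : ℝ) T) mΩ} {t : Icc (0 : ℝ) T} {X Y : Ω → E} (hX : Measurable X)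
    (hY : Measurable[F t] Y) (h : X =ᵐ[P] Y) : Measurable[completedFiltration P F t] X := by
  refine fun S hS => ⟨⟨Y ⁻¹' S, hY hS, ?_⟩, hX hS⟩
  filter_upwards [h] with ω hω
  exact propext (show X ω ∈ S ↔ Y ω ∈ S by rw [hω])

/-- Independence depends on events only up to null sets. Processes that are adapted up to null sets
may therefore be treated as adapted to the completed filtration. -/
theorem IndepFuture.completedFiltration [IsProbabilityMeasure P]
    {F : Filtration (Icc (0 : ℝ) T) mΩ} {N : Ω → Measure (MarkSpace T)} (h : IndepFuture P F N) :
    IndepFuture P (completedFiltration P F) N := by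
  intro t
  rw [Indep_iff]
  rintro A B ⟨⟨A', hA', hAA'⟩, -⟩ hB
  have h1 := (Indep_iff _ _ _).1 (h t) A' B hA' hB
  rw [measure_congr hAA', ← h1]
  exact measure_congr (hAA'.inter (ae_eq_refl B))

end Completion

/-! ### The noise of one node -/

section Node

variable {T : ℝ} {g : ℤ → ℝ} {Ω : Type*} [mΩ : MeasurableSpace Ω] {P : Measure Ω}

theorem measurable_restrict_measure {E : Type*} [MeasurableSpace E] {A : Set E}
    (hA : MeasurableSet A) : Measurable fun μ : Measure E => μ.restrict A := by
  refine Measure.measurable_of_measurable_coe _ fun B hB => ?_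
  simp only [Measure.restrict_apply hB]
  exact Measure.measurable_coe (hB.inter hA)

/-- The data of one node: initial state and noise. -/
structure IsNode (P : Measure Ω) (F : Filtration (Icc (0 : ℝ) T) mΩ) (ρ : Measure ℤ)
    (X₀ : Ω → ℤ) (N : Ω → Measure (MarkSpace T)) : Prop where
  init_measurable : ∀ t, Measurable[F t] X₀
  poisson : IsPoissonRandomMeasure P N (intensity T ρ)
  poisson_adapted : ∀ t, Measurable[F t] (fun ω => (N ω).restrict {e | e.1 ≤ t})
  indepFuture : IndepFuture P F N

theorem IsModel.isNode {F : Filtration (Icc (0 : ℝ) T) mΩ} {ρ : Measure ℤ}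
    {θ : ProbabilityMeasure (PathSpace T ℤ)} {X₀ : ℕ → Ω → ℤ} {N : ℕ → Ω → Measure (MarkSpace T)}
    {ξ : ℕ → ℕ → Ω → PathSpace T ℤ} (h : IsModel P F ρ θ X₀ N ξ) (i : ℕ) :
    IsNode P F ρ (X₀ i) (N i) where
  init_measurable := h.init_measurable i
  poisson := h.poisson i
  poisson_adapted := h.poisson_adapted i
  indepFuture t := by
    refine indep_of_indep_of_le_right (h.poisson_future t) ?_
    rw [← measurable_iff_comap_le]
    exact (measurable_pi_apply i).comp (comap_measurable (fun ω i => (N i ω).restrict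
      {e : MarkSpace T | t < e.1}))

variable {F : Filtration (Icc (0 : ℝ) T) mΩ} {ρ : Measure ℤ} {X₀ : Ω → ℤ}
  {N : Ω → Measure (MarkSpace T)}

theorem IsNode.measurable_init (h : IsNode P F ρ X₀ N) (hT : 0 ≤ T) : Measurable X₀ :=
  (h.init_measurable ⟨0, le_rfl, hT⟩).mono (F.le _) le_rfl

theorem intensity_time_zero [IsFiniteMeasure ρ] :
    intensity T ρ {e | (e.1 : ℝ) = 0} = 0 := by
  have h1 : ((volume : Measure ℝ).comap ((↑) : Icc (0 : ℝ) T → ℝ)) {s | (s : ℝ) = 0} = 0 := by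
    rw [comap_subtype_coe_apply measurableSet_Icc]
    refine measure_mono_null (t := {0}) ?_ (by simp)
    rintro _ ⟨s, hs, rfl⟩
    exact hs
  have h2 : {e : MarkSpace T | (e.1 : ℝ) = 0} = {s : Icc (0 : ℝ) T | (s : ℝ) = 0} ×ˢ univ := by
    ext; simp
  rw [h2, intensity, Measure.prod_prod, h1, zero_mul]

theorem IsNode.ae_time_zero [IsFiniteMeasure ρ] (h : IsNode P F ρ X₀ N) :
    ∀ᵐ ω ∂P, N ω {e | (e.1 : ℝ) = 0} = 0 := by
  have hm : MeasurableSet {e : MarkSpace T | (e.1 : ℝ) = 0} :=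
    (measurable_subtype_coe.comp measurable_fst) (measurableSet_singleton (0 : ℝ))
  have h1 := h.poisson.lintegral_apply hm (by rw [intensity_time_zero]; exact ENNReal.zero_lt_top)
  rw [intensity_time_zero] at h1
  exact (lintegral_eq_zero_iff ((Measure.measurable_coe hm).comp h.poisson.measurable)).1 h1

/-- Each of the countably many conditions holds almost surely: Poisson values are finite integers on
sets of finite intensity, and the jump mass has finite mean. -/
theorem IsNode.ae_good [IsProbabilityMeasure P] [IsFiniteMeasure ρ] (h : IsNode P F ρ X₀ N)
    (hT : 0 ≤ T) (hC : jumpConst ρ g < ∞) : ∀ᵐ ω ∂P, N ω ∈ goodNoise T g := by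
  have hA := measurableSet_activeSet (T := T) g
  have hmA := intensity_activeSet_lt_top (T := T) hC
  have h1 := h.poisson.ae_lt_top hA hmA
  have h2 : ∀ᵐ ω ∂P, jumpMass g (N ω) < ∞ := by
    refine ae_lt_top ((measurable_jumpMass g).comp h.poisson.measurable) (ne_of_lt ?_)
    exact (lintegral_jumpMass_le hT hC h.poisson h.indepFuture).trans_lt
      (ENNReal.mul_lt_top ENNReal.ofReal_lt_top hC)
  have hI : ∀ I : Finset ℕ, MeasurableSet
      (⋂ n ∈ I, MeasurableSpace.natGeneratingSequence (MarkSpace T) n) := fun I =>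
    Finset.measurableSet_biInter I fun n _ => MeasurableSpace.measurableSet_natGeneratingSequence n
  have h3 : ∀ᵐ ω ∂P, ∀ I : Finset ℕ, N ω
      ((⋂ n ∈ I, MeasurableSpace.natGeneratingSequence (MarkSpace T) n) ∩ activeSet T g) ∈
        range (Nat.cast : ℕ → ℝ≥0∞) :=
    ae_all_iff.2 fun I => h.poisson.ae_mem_range ((hI I).inter hA)
      ((measure_mono inter_subset_right).trans_lt hmA)
  filter_upwards [h1, h2, h3] with ω w1 w2 w3
  refine ⟨w1, w2, fun I => ?_⟩
  rw [activeKernel_apply w1, Measure.restrict_apply (hI I)]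
  exact w3 I

theorem activeKernel_restrict_activeSet {M : Measure (MarkSpace T)} :
    activeKernel T g (M.restrict (activeSet T g)) = activeKernel T g M := by
  by_cases h : M (activeSet T g) < ∞
  · rw [activeKernel_restrict_apply h, activeKernel_apply h,
      Measure.restrict_restrict (measurableSet_activeSet g), inter_self]
  · have h1 : activeKernel T g M = 0 := if_neg h
    have h2 : activeKernel T g (M.restrict (activeSet T g)) = 0 := if_neg (by
      rwa [Measure.restrict_apply_self])
    rw [h1, h2]

theorem jumpDist_restrict_activeSet {γ : ℤ → ℤ → ℤ → ℤ → ℝ} (x x' : Icc (0 : ℝ) T → ℤ)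
    (ν ν' : Icc (0 : ℝ) T → ProbabilityMeasure (ℤ × ℤ)) (M : Measure (MarkSpace T))
    (t : Icc (0 : ℝ) T) : jumpDist γ g x x' ν ν' (M.restrict (activeSet T g)) t =
      jumpDist γ g x x' ν ν' M t := by
  rw [jumpDist, activeKernel_restrict_activeSet, jumpDist]

end Node

end EdgeMeanField

namespace EdgeMeanField

/-! ### Flows of marginal laws and the Lipschitz property of the rates -/

section Flow

variable {T : ℝ}

/-- The one-dimensional marginals of a law on the path space have left limits. -/
theorem exists_tendsto_marginal {S : Type*} [MetricSpace S] [MeasurableSpace S] [BorelSpace S]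
    (μ : ProbabilityMeasure (PathSpace T S)) (t : Icc (0 : ℝ) T) :
    ∃ l, Tendsto (PathSpace.marginal μ) (𝓝[<] t) (𝓝 l) := by
  have hm : Measurable fun x : PathSpace T S => Function.leftLim x t :=
    measurable_of_tendsto_metrizable (fun m => PathSpace.measurable_eval (gridDown m t))
      (tendsto_pi_nhds.2 fun x => tendsto_leftLim_gridDown t (x.left_limit t))
  refine ⟨μ.map hm.aemeasurable, ?_⟩
  rw [ProbabilityMeasure.tendsto_iff_forall_integral_tendsto]
  intro f
  have h1 : ∀ s, ∫ z, f z ∂(PathSpace.marginal μ s : Measure S) =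
      ∫ x : PathSpace T S, f (x s) ∂(μ : Measure (PathSpace T S)) :=
    fun s => integral_map (PathSpace.measurable_eval s).aemeasurable
      f.continuous.measurable.aestronglyMeasurable
  have h2 : ∫ z, f z ∂(μ.map hm.aemeasurable : Measure S) =
      ∫ x, f (Function.leftLim x t) ∂(μ : Measure (PathSpace T S)) :=
    integral_map hm.aemeasurable f.continuous.measurable.aestronglyMeasurable
  simp_rw [h1]
  rw [h2]
  -- The limit law is that of the left limit of the path: bounded continuous functions of the path
  -- converge pointwise.
  refine tendsto_integral_filter_of_dominated_convergence (fun _ => ‖f‖) ?_ ?_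
    (integrable_const _) ?_
  · exact Eventually.of_forall fun s =>
      (f.continuous.measurable.comp (PathSpace.measurable_eval s)).aestronglyMeasurable
  · exact Eventually.of_forall fun s => Eventually.of_forall fun x => f.norm_coe_le_norm _
  · exact Eventually.of_forall fun x =>
      (f.continuous.tendsto _).comp (tendsto_leftLim_of_tendsto (x.left_limit t))

/-- The flow of the one-dimensional marginals of `μ ⊗ θ`. -/
noncomputable def flowOf (μ θ : ProbabilityMeasure (PathSpace T ℤ)) (t : Icc (0 : ℝ) T) :
    ProbabilityMeasure (ℤ × ℤ) :=
  PathSpace.marginal (PathSpace.prodLaw μ θ) t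

theorem flowOf_leftLimit (μ θ : ProbabilityMeasure (PathSpace T ℤ)) (t : Icc (0 : ℝ) T) :
    ∃ l, Tendsto (flowOf μ θ) (𝓝[<] t) (𝓝 l) :=
  exists_tendsto_marginal _ t

theorem coe_flowOf (μ θ : ProbabilityMeasure (PathSpace T ℤ)) (t : Icc (0 : ℝ) T) :
    (flowOf μ θ t : Measure (ℤ × ℤ)) =
      ((μ : Measure (PathSpace T ℤ)).map fun x => x t).prod
        ((θ : Measure (PathSpace T ℤ)).map fun x => x t) := by
  show (((μ : Measure (PathSpace T ℤ)).prod (θ : Measure (PathSpace T ℤ))).map _).map _ = _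
  rw [Measure.map_map (PathSpace.measurable_eval t) PathSpace.measurable_prodMk,
    Measure.map_prod_map _ _ (PathSpace.measurable_eval t) (PathSpace.measurable_eval t)]
  rfl

/-- Distinct integers are at distance at least one, while two values in `[0, c]` differ by at most
`c`. This is the only source of Lipschitz continuity. -/
theorem enorm_sub_le_of_bounded {φ : ℤ → ℝ} {c : ℝ} (h0 : ∀ a, 0 ≤ φ a) (hc : ∀ a, φ a ≤ c)
    (a b : ℤ) : ‖φ a - φ b‖ₑ ≤ ENNReal.ofReal c * ‖a - b‖ₑ := by
  rcases eq_or_ne a b with rfl | hab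
  · simp
  · have h1 : ‖φ a - φ b‖ₑ ≤ ENNReal.ofReal c := by
      rw [← ofReal_norm, Real.norm_eq_abs]
      refine ENNReal.ofReal_le_ofReal (abs_sub_le_iff.2 ⟨?_, ?_⟩)
      · linarith [h0 b, hc a]
      · linarith [h0 a, hc b]
    have h2 : (1 : ℝ≥0∞) ≤ ‖a - b‖ₑ := by
      rw [← ofReal_norm, ENNReal.one_le_ofReal, ← Int.norm_cast_real, Real.norm_eq_abs]
      exact_mod_cast Int.one_le_abs (sub_ne_zero.2 hab)
    calc _ ≤ ENNReal.ofReal c * 1 := by rwa [mul_one]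
      _ ≤ _ := by gcongr

variable {γ : ℤ → ℤ → ℤ → ℤ → ℝ} {g : ℤ → ℝ} {Ω : Type*} [mΩ : MeasurableSpace Ω]
  {P : Measure Ω} [IsProbabilityMeasure P]

omit [IsProbabilityMeasure P] in
theorem RateBound.totalRate_flowOf (h : RateBound γ g) (y x : ℤ)
    {μ θ : ProbabilityMeasure (PathSpace T ℤ)} {X : Ω → PathSpace T ℤ} (hX : Measurable X)
    (hμ : (μ : Measure (PathSpace T ℤ)) = P.map X) (t : Icc (0 : ℝ) T) :
    totalRate γ y x (flowOf μ θ t) =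
      ∫ ω, ∫ ξ', γ y x (X ω t) ξ' ∂((θ : Measure (PathSpace T ℤ)).map fun x => x t) ∂P := by
  have hp1 : IsProbabilityMeasure ((μ : Measure (PathSpace T ℤ)).map fun x => x t) :=
    Measure.isProbabilityMeasure_map (PathSpace.measurable_eval t).aemeasurable
  have hp2 : IsProbabilityMeasure ((θ : Measure (PathSpace T ℤ)).map fun x => x t) :=
    Measure.isProbabilityMeasure_map (PathSpace.measurable_eval t).aemeasurable
  rw [totalRate, coe_flowOf, integral_prod _ (h.integrable y x _), hμ,
    Measure.map_map (PathSpace.measurable_eval t) hX,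
    integral_map ((PathSpace.measurable_eval t).comp hX).aemeasurable
      (measurable_of_countable _).aestronglyMeasurable]
  rfl

/-- The joint law of `X` and `X'` couples `μ` and `μ'`. After integration over the edge law, the
rate is a bounded function of the integer state of the other node. -/
theorem RateBound.enorm_totalRate_flowOf_sub_le (h : RateBound γ g) (y x : ℤ)
    {μ μ' θ : ProbabilityMeasure (PathSpace T ℤ)} {X X' : Ω → PathSpace T ℤ} (hX : Measurable X)
    (hX' : Measurable X') (hμ : (μ : Measure (PathSpace T ℤ)) = P.map X)
    (hμ' : (μ' : Measure (PathSpace T ℤ)) = P.map X') (t : Icc (0 : ℝ) T) :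
    ‖totalRate γ y x (flowOf μ θ t) - totalRate γ y x (flowOf μ' θ t)‖ₑ ≤
      ENNReal.ofReal (g y) * ∫⁻ ω, ‖X ω t - X' ω t‖ₑ ∂P := by
  have hp2 : IsProbabilityMeasure ((θ : Measure (PathSpace T ℤ)).map fun x => x t) :=
    Measure.isProbabilityMeasure_map (PathSpace.measurable_eval t).aemeasurable
  let ψ : ℤ → ℝ := fun x' => ∫ ξ', γ y x x' ξ' ∂((θ : Measure (PathSpace T ℤ)).map fun x => x t)
  have h0 : ∀ a, 0 ≤ ψ a := fun a => integral_nonneg fun _ => (h _ _ _ _).1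
  have hc : ∀ a, ψ a ≤ g y := fun a => by
    refine (integral_mono (Integrable.of_bound (measurable_of_countable _).aestronglyMeasurable
      (g y) (Eventually.of_forall fun ξ' => h.norm_le y x (a, ξ'))) (integrable_const (g y))
      fun ξ' => (h y x a ξ').2).trans ?_
    simp
  have hi : ∀ Z : Ω → PathSpace T ℤ, Measurable Z → Integrable (fun ω => ψ (Z ω t)) P := by
    intro Z hZ
    refine Integrable.of_bound ((measurable_of_countable ψ).comp
      ((PathSpace.measurable_eval t).comp hZ)).aestronglyMeasurable (g y)
      (Eventually.of_forall fun ω => ?_)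
    rw [Real.norm_of_nonneg (h0 _)]
    exact hc _
  rw [h.totalRate_flowOf y x hX hμ t, h.totalRate_flowOf y x hX' hμ' t,
    ← integral_sub (hi X hX) (hi X' hX'), ← lintegral_const_mul' _ _ ENNReal.ofReal_ne_top]
  exact (enorm_integral_le_lintegral_enorm _).trans
    (lintegral_mono fun ω => enorm_sub_le_of_bounded h0 hc _ _)

theorem RateBound.enorm_totalRate_sub_le (h : RateBound γ g) (y x x' : ℤ)
    (ν : ProbabilityMeasure (ℤ × ℤ)) :
    ‖totalRate γ y x ν - totalRate γ y x' ν‖ₑ ≤ ENNReal.ofReal (g y) * ‖x - x'‖ₑ :=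
  enorm_sub_le_of_bounded (fun a => h.totalRate_nonneg y a ν) (fun a => h.totalRate_le y a ν) x x'

/-- The factor `2` counts the two ways in which the process enters its rate: through its state and
through its law. -/
theorem RateBound.lintegral_totalRate_flowOf_sub_le (h : RateBound γ g) (y : ℤ)
    {μ μ' θ : ProbabilityMeasure (PathSpace T ℤ)} {X X' : Ω → PathSpace T ℤ} (hX : Measurable X)
    (hX' : Measurable X') (hμ : (μ : Measure (PathSpace T ℤ)) = P.map X)
    (hμ' : (μ' : Measure (PathSpace T ℤ)) = P.map X') (t : Icc (0 : ℝ) T) :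
    ∫⁻ ω, ‖totalRate γ y (X ω t) (flowOf μ θ t) - totalRate γ y (X' ω t) (flowOf μ' θ t)‖ₑ ∂P ≤
      ENNReal.ofReal (g y) * (2 * ∫⁻ ω, ‖X ω t - X' ω t‖ₑ ∂P) := by
  calc _ ≤ ∫⁻ ω, (ENNReal.ofReal (g y) * ‖X ω t - X' ω t‖ₑ +
        ENNReal.ofReal (g y) * ∫⁻ ω, ‖X ω t - X' ω t‖ₑ ∂P) ∂P := by
        refine lintegral_mono fun ω => ?_
        rw [← sub_add_sub_cancel _ (totalRate γ y (X' ω t) (flowOf μ θ t))]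
        exact (enorm_add_le _ _).trans (add_le_add (h.enorm_totalRate_sub_le y _ _ _)
          (h.enorm_totalRate_flowOf_sub_le y _ hX hX' hμ hμ' t))
    _ = _ := by
        rw [lintegral_add_right _ measurable_const, lintegral_const_mul' _ _ ENNReal.ofReal_ne_top]
        simp only [lintegral_const, measure_univ, mul_one]
        ring

/-- A process that is adapted up to null sets. -/
def IsAEAdapted (P : Measure Ω) (F : Filtration (Icc (0 : ℝ) T) mΩ) (X : Ω → PathSpace T ℤ) :
    Prop :=
  ∀ t, ∃ Y : Ω → ℤ, Measurable[F t] Y ∧ (fun ω => X ω t) =ᵐ[P] Y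

omit [IsProbabilityMeasure P] in
theorem IsAEAdapted.measurable {F : Filtration (Icc (0 : ℝ) T) mΩ} {X : Ω → PathSpace T ℤ}
    (hX : IsAEAdapted P F X) (hXm : Measurable X) (t : Icc (0 : ℝ) T) :
    Measurable[completedFiltration P F t] fun ω => X ω t := by
  obtain ⟨Y, hY, h⟩ := hX t
  exact measurable_completedFiltration ((PathSpace.measurable_eval t).comp hXm) hY h

omit [IsProbabilityMeasure P] in
theorem IsAEAdapted.measurable_totalRate {F : Filtration (Icc (0 : ℝ) T) mΩ}
    {X : Ω → PathSpace T ℤ} (hX : IsAEAdapted P F X) (hXm : Measurable X)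
    (ν : Icc (0 : ℝ) T → ProbabilityMeasure (ℤ × ℤ)) (t : Icc (0 : ℝ) T) (y : ℤ) :
    Measurable[completedFiltration P F t] fun ω => totalRate γ y (X ω t) (ν t) :=
  (measurable_of_countable fun x : ℤ => totalRate γ y x (ν t)).comp (hX.measurable hXm t)

/-- The contraction estimate for two processes that are driven by the flows of their laws. -/
theorem RateBound.lintegral_jumpDist_flowOf_le (h : RateBound γ g) (hT : 0 ≤ T) {ρ : Measure ℤ}
    [IsFiniteMeasure ρ] (hC : jumpConst ρ g < ∞) {F : Filtration (Icc (0 : ℝ) T) mΩ} {X₀ : Ω → ℤ}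
    {N : Ω → Measure (MarkSpace T)} (hN : IsNode P F ρ X₀ N)
    {μ μ' θ : ProbabilityMeasure (PathSpace T ℤ)} {X X' : Ω → PathSpace T ℤ} (hX : Measurable X)
    (hX' : Measurable X') (hXa : IsAEAdapted P F X) (hXa' : IsAEAdapted P F X')
    (hμ : (μ : Measure (PathSpace T ℤ)) = P.map X)
    (hμ' : (μ' : Measure (PathSpace T ℤ)) = P.map X') {v : Icc (0 : ℝ) T → ℝ≥0∞} (hv : Monotone v)
    (hb : ∀ t, ∫⁻ ω, ‖X ω t - X' ω t‖ₑ ∂P ≤ v t) (t : Icc (0 : ℝ) T) :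
    ∫⁻ ω, jumpDist γ g (X ω) (X' ω) (flowOf μ θ) (flowOf μ' θ) (N ω) t ∂P ≤
      ((2 * jumpConst ρ g).toNNReal : ℝ≥0∞) * ∫⁻ s in {s | s ≤ t}, v s ∂(timeMeasure T) := by
  have hC2 : 2 * jumpConst ρ g ≠ ∞ := ENNReal.mul_ne_top (by norm_num) hC.ne
  refine (h.lintegral_jumpDist_le hT hC hN.poisson hN.indepFuture.completedFiltration
    (ν := fun _ => flowOf μ θ) (ν' := fun _ => flowOf μ' θ) (fun _ => flowOf_leftLimit μ θ)
    (fun _ => flowOf_leftLimit μ' θ) (fun t y => hXa.measurable_totalRate hX _ t y)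
    (fun t y => hXa'.measurable_totalRate hX' _ t y) (v := fun t => 2 * v t)
    (fun _ _ hst => mul_le_mul_right (hv hst) 2) (fun t y => ?_) t).trans ?_
  · refine (h.lintegral_totalRate_flowOf_sub_le y hX hX' hμ hμ' t).trans ?_
    gcongr
    exact hb t
  · rw [lintegral_const_mul _ hv.measurable, ENNReal.coe_toNNReal hC2]
    exact le_of_eq (by ring)

end Flow

/-! ### Pathwise uniqueness of the limiting system -/

section Uniqueness

variable {T : ℝ} {γ : ℤ → ℤ → ℤ → ℤ → ℝ} {g : ℤ → ℝ} {Ω : Type*} [mΩ : MeasurableSpace Ω]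
  {P : Measure Ω} [IsProbabilityMeasure P] {F : Filtration (Icc (0 : ℝ) T) mΩ} {ρ : Measure ℤ}

/-- The law of a measurable process. -/
noncomputable def lawOf (P : Measure Ω) [IsProbabilityMeasure P] {X : Ω → PathSpace T ℤ}
    (hX : Measurable X) : ProbabilityMeasure (PathSpace T ℤ) :=
  ⟨P.map X, Measure.isProbabilityMeasure_map hX.aemeasurable⟩

/-- Almost surely no mark lies at time `0`, and later marks outside the active region produce no
jump. -/
theorem RateBound.ae_solvesEquation_activeKernel [IsFiniteMeasure ρ] (h : RateBound γ g)
    (hT : 0 ≤ T) (hC : jumpConst ρ g < ∞) {X₀ : Ω → ℤ} {N : Ω → Measure (MarkSpace T)}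
    (hN : IsNode P F ρ X₀ N) (ν : Ω → Icc (0 : ℝ) T → ProbabilityMeasure (ℤ × ℤ))
    (X : Ω → PathSpace T ℤ) :
    (∀ᵐ ω ∂P, SolvesEquation γ (X₀ ω) (N ω) (ν ω) (X ω)) ↔
      ∀ᵐ ω ∂P, SolvesEquation γ (X₀ ω) (activeKernel T g (N ω)) (ν ω) (X ω) := by
  refine eventually_congr ?_
  filter_upwards [hN.ae_good (g := g) hT hC, hN.ae_time_zero] with ω h1 h2
  exact h.solvesEquation_iff h2 h1.1 _ _

/-- In any solution the measure process is the flow of the node's own law. So it has left limits,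
and the contraction estimate for flows applies. -/
theorem IsLimitSystem.eq_flowOf {X₀ : ℕ → Ω → ℤ} {N : ℕ → Ω → Measure (MarkSpace T)}
    {ξ : ℕ → ℕ → Ω → PathSpace T ℤ} {θ : ProbabilityMeasure (PathSpace T ℤ)}
    (hM : IsModel P F ρ θ X₀ N ξ) {X : ℕ → Ω → PathSpace T ℤ}
    {ν : Icc (0 : ℝ) T → ProbabilityMeasure (ℤ × ℤ)} (hX : IsLimitSystem P F γ X₀ N ξ X ν) (i : ℕ) :
    ν = flowOf (lawOf P (hX.solution i).measurable) θ := by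
  ext1 t
  apply ProbabilityMeasure.toMeasure_injective
  rw [hX.law i 0 t, coe_flowOf, ← (hM.edge_law i 0).map_eq]
  show _ = (Measure.map _ (P.map (X i))).prod _
  rw [Measure.map_map (PathSpace.measurable_eval t) (hX.solution i).measurable,
    AEMeasurable.map_map_of_aemeasurable (PathSpace.measurable_eval t).aemeasurable
      (hM.edge_law i 0).aemeasurable]
  rfl

/-- Integers at distance below one are equal. Since the majorant is monotone, its value at the final
time controls all times. -/
theorem path_eq_of_jumpDist_eq_zero {x x' : PathSpace T ℤ} {D : Icc (0 : ℝ) T → ℝ≥0∞}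
    (hD : Monotone D) (h : ∀ t, ‖x t - x' t‖ₑ ≤ D t) {t₁ : Icc (0 : ℝ) T} (ht : (t₁ : ℝ) = T)
    (h1 : D t₁ < 1) : x = x' := by
  ext t
  by_contra hne
  have := (h t).trans (hD (show (t : ℝ) ≤ t₁ from t.2.2.trans ht.ge))
  refine absurd (this.trans_lt h1) (not_lt.2 ?_)
  rw [← ofReal_norm, ENNReal.one_le_ofReal, ← Int.norm_cast_real, Real.norm_eq_abs]
  exact_mod_cast Int.one_le_abs (sub_ne_zero.2 hne)

theorem IsLimitSystem.unique [IsFiniteMeasure ρ] (h : RateBound γ g) (hT : 0 ≤ T)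
    (hC : jumpConst ρ g < ∞) {X₀ : ℕ → Ω → ℤ} {N : ℕ → Ω → Measure (MarkSpace T)}
    {ξ : ℕ → ℕ → Ω → PathSpace T ℤ} {θ : ProbabilityMeasure (PathSpace T ℤ)}
    (hM : IsModel P F ρ θ X₀ N ξ) {X X' : ℕ → Ω → PathSpace T ℤ}
    {ν ν' : Icc (0 : ℝ) T → ProbabilityMeasure (ℤ × ℤ)} (hX : IsLimitSystem P F γ X₀ N ξ X ν)
    (hX' : IsLimitSystem P F γ X₀ N ξ X' ν') :
    ν = ν' ∧ ∀ᵐ ω ∂P, ∀ i, X i ω = X' i ω := by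
  let t₁ : Icc (0 : ℝ) T := ⟨T, hT, le_rfl⟩
  have key : ∀ i, ∀ᵐ ω ∂P, X i ω = X' i ω := by
    intro i
    have hm := (hX.solution i).measurable
    have hm' := (hX'.solution i).measurable
    have hN := hM.isNode i
    have e := hX.eq_flowOf hM i
    have e' := hX'.eq_flowOf hM i
    let u : Icc (0 : ℝ) T → ℝ≥0∞ := fun t =>
      ∫⁻ ω, jumpDist γ g (X i ω) (X' i ω) ν ν' (N i ω) t ∂P
    have hs := (h.ae_solvesEquation_activeKernel hT hC hN _ _).1 (hX.solution i).equation
    have hs' := (h.ae_solvesEquation_activeKernel hT hC hN _ _).1 (hX'.solution i).equation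
    have hle : ∀ᵐ ω ∂P, ∀ t, ‖X i ω t - X' i ω t‖ₑ ≤
        jumpDist γ g (X i ω) (X' i ω) ν ν' (N i ω) t := by
      filter_upwards [hs, hs'] with ω h1 h2 t
      exact h1.enorm_sub_le h2 t
    -- The mean difference of the jumps bounds the mean distance of the states, so it satisfies
    -- Gronwall's inequality with no inhomogeneous term. The a priori bound is the mean jump mass,
    -- which is finite without moments of the solutions.
    have hu : ∀ t, u t ≤ 0 + ((2 * jumpConst ρ g).toNNReal : ℝ≥0∞) *
        ∫⁻ s in {s | s ≤ t}, u s ∂(timeMeasure T) := by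
      intro t
      rw [zero_add]
      have := h.lintegral_jumpDist_flowOf_le hT hC hN (θ := θ) (μ := lawOf P hm) (μ' := lawOf P hm') hm hm'
        (hX.solution i).adapted (hX'.solution i).adapted rfl rfl (v := u)
        (fun s t hst => lintegral_mono fun ω => jumpDist_mono _ _ _ _ _ hst)
        (fun t => lintegral_mono_ae (hle.mono fun ω hω => hω t)) t
      rwa [← e, ← e'] at this
    have huM : ∀ t, u t ≤ ENNReal.ofReal T * jumpConst ρ g := fun t =>
      (lintegral_mono fun ω => jumpDist_le_jumpMass _ _ _ _ _ _).trans
        (lintegral_jumpMass_le hT hC hN.poisson hN.indepFuture)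
    have h0 := le_of_le_add_lintegral _ (ENNReal.mul_ne_top ENNReal.ofReal_ne_top hC.ne) huM hu t₁
    rw [mul_zero, zero_mul, nonpos_iff_eq_zero] at h0
    have hmD : Measurable fun ω => jumpDist γ g (X i ω) (X' i ω) ν ν' (N i ω) t₁ :=
      h.measurable_jumpDist hT hN.poisson.measurable (ν := fun _ => ν) (ν' := fun _ => ν')
        (fun _ => by rw [e]; exact flowOf_leftLimit _ _)
        (fun _ => by rw [e']; exact flowOf_leftLimit _ _)
        (fun t y => RateBound.measurable_totalRate_comp γ hm ν t y)
        (fun t y => RateBound.measurable_totalRate_comp γ hm' ν' t y) t₁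
    have h2 := (lintegral_eq_zero_iff hmD).1 h0
    filter_upwards [h2, hle] with ω w2 wle
    refine path_eq_of_jumpDist_eq_zero (jumpDist_mono _ _ _ _ _) wle (t₁ := t₁) rfl ?_
    rw [w2]
    exact zero_lt_one
  refine ⟨?_, ae_all_iff.2 key⟩
  rw [hX.eq_flowOf hM 0, hX'.eq_flowOf hM 0]
  congr 1
  exact Subtype.ext (Measure.map_congr (key 0))

end Uniqueness

end EdgeMeanField

namespace EdgeMeanField

/-! ### Limits of eventually constant sequences -/

section EventualLimit

variable {T : ℝ} {E : Type*} [MeasurableSpace E]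

/-- A sequence of measurable maps that is eventually constant on a measurable set has a measurable
limit there. -/
theorem exists_measurable_eventual_limit {φ : ℕ → E → PathSpace T ℤ} (hφ : ∀ k, Measurable (φ k))
    {S : Set E} (hS : MeasurableSet S) (h : ∀ p ∈ S, ∃ m, ∀ k ≥ m, φ k p = φ m p) :
    ∃ ψ : E → PathSpace T ℤ, Measurable ψ ∧ ∀ p ∈ S, ∀ᶠ k in atTop, φ k p = ψ p := by
  classical
  choose! m hm using h
  let ψ : E → PathSpace T ℤ := fun p => if p ∈ S then φ (m p) p else constPath 0
  have hev : ∀ p ∈ S, ∀ᶠ k in atTop, φ k p = ψ p := fun p hp => by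
    filter_upwards [eventually_ge_atTop (m p)] with k hk
    rw [hm p hp k hk]
    exact (if_pos hp).symm
  refine ⟨ψ, PathSpace.measurable_of_eval fun t => ?_, hev⟩
  refine measurable_of_tendsto_metrizable (f := fun k p => if p ∈ S then φ k p t else 0)
    (fun k => Measurable.ite hS ((PathSpace.measurable_eval t).comp (hφ k)) measurable_const)
    (tendsto_pi_nhds.2 fun p => ?_)
  by_cases hp : p ∈ S
  · simp only [if_pos hp]
    exact tendsto_const_nhds.congr' ((hev p hp).mono fun k hk => congrArg (fun x => x t) hk.symm)
  · simp only [if_neg hp]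
    have : ψ p t = 0 := by simp [ψ, hp, constPath]
    rw [this]
    exact tendsto_const_nhds

/-- The means are summable, so almost surely the series converges and its terms tend to zero. -/
theorem ae_eventually_lt_one {μ : Measure E} {f : ℕ → E → ℝ≥0∞} (hf : ∀ k, Measurable (f k))
    {C : ℝ≥0∞} (hC : C ≠ ∞) (h : ∀ k, ∫⁻ x, f k x ∂μ ≤ C * 2⁻¹ ^ k) :
    ∀ᵐ x ∂μ, ∀ᶠ k in atTop, f k x < 1 := by
  have h1 : ∫⁻ x, ∑' k, f k x ∂μ ≠ ∞ := by
    rw [lintegral_tsum fun k => (hf k).aemeasurable]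
    refine ne_top_of_le_ne_top ?_ (ENNReal.tsum_le_tsum h)
    rw [ENNReal.tsum_mul_left, ENNReal.tsum_geometric]
    exact ENNReal.mul_ne_top hC (by simp)
  filter_upwards [ae_lt_top (Measurable.tsum hf) h1] with x hx
  exact (ENNReal.tendsto_atTop_zero_of_tsum_ne_top hx.ne).eventually_lt_const zero_lt_one

/-- The limit is defined from the `Y k` alone, on the set where they converge, so it is measurable
for any `σ`-field for which they are; used with `F t`, it keeps adaptedness. -/
theorem exists_measurable_lim {Y : ℕ → E → ℤ} (hY : ∀ k, Measurable (Y k)) :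
    ∃ Z : E → ℤ, Measurable Z ∧ ∀ x c, (∀ᶠ k in atTop, Y k x = c) → Z x = c := by
  classical
  let A : Set E := {x | ∃ c, Tendsto (fun k => Y k x) atTop (𝓝 c)}
  have hA : MeasurableSet A := MeasureTheory.measurableSet_exists_tendsto hY
  let Z : E → ℤ := fun x => if hx : x ∈ A then hx.choose else 0
  refine ⟨Z, measurable_of_tendsto_metrizable (f := fun k x => if x ∈ A then Y k x else 0)
    (fun k => Measurable.ite hA (hY k) measurable_const) (tendsto_pi_nhds.2 fun x => ?_),
    fun x c hx => ?_⟩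
  · by_cases hx : x ∈ A
    · simp only [if_pos hx, Z, dif_pos hx]
      exact hx.choose_spec
    · simp only [if_neg hx, Z, dif_neg hx]
      exact tendsto_const_nhds
  · have hx' : Tendsto (fun k => Y k x) atTop (𝓝 c) :=
      tendsto_const_nhds.congr' (hx.mono fun _ h => h.symm)
    have hmem : x ∈ A := ⟨_, hx'⟩
    simp only [Z, dif_pos hmem]
    exact tendsto_nhds_unique hmem.choose_spec hx'

theorem measurableSet_eventually_atTop {p : ℕ → E → Prop} (hp : ∀ k, MeasurableSet {x | p k x}) :
    MeasurableSet {x | ∀ᶠ k in atTop, p k x} := by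
  have : {x | ∀ᶠ k in atTop, p k x} = ⋃ m, ⋂ k ≥ m, {x | p k x} := by
    ext x
    simp [eventually_atTop]
  rw [this]
  exact MeasurableSet.iUnion fun m => MeasurableSet.iInter fun k => MeasurableSet.iInter fun _ => hp k

theorem IsAEAdapted.of_eventually_eq {Ω : Type*} [mΩ : MeasurableSpace Ω] {P : Measure Ω}
    {F : Filtration (Icc (0 : ℝ) T) mΩ} {Xs : ℕ → Ω → PathSpace T ℤ} {X : Ω → PathSpace T ℤ}
    (hXs : ∀ k, IsAEAdapted P F (Xs k)) (h : ∀ᵐ ω ∂P, ∀ᶠ k in atTop, Xs k ω = X ω) :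
    IsAEAdapted P F X := by
  intro t
  choose Y hY hXY using fun k => hXs k t
  obtain ⟨Z, hZ, hlim⟩ := @exists_measurable_lim Ω (F t) Y hY
  refine ⟨Z, hZ, ?_⟩
  filter_upwards [h, ae_all_iff.2 hXY] with ω h1 h2
  refine (hlim ω _ (h1.mono fun k hk => ?_)).symm
  rw [← h2 k, hk]

end EventualLimit

/-! ### Successive approximations and existence -/

section Picard

variable {T : ℝ} {γ : ℤ → ℤ → ℤ → ℤ → ℝ} {g : ℤ → ℝ}

theorem restrict_activeSet_mem_goodNoise_iff {M : Measure (MarkSpace T)} :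
    M.restrict (activeSet T g) ∈ goodNoise T g ↔ M ∈ goodNoise T g := by
  simp only [goodNoise, mem_ofPred_eq, jumpMass, activeKernel_restrict_activeSet,
    Measure.restrict_apply_self]

theorem nextPath_restrict_activeSet (ν : Icc (0 : ℝ) T → ProbabilityMeasure (ℤ × ℤ))
    (x : PathSpace T ℤ) (x₀ : ℤ) (M : Measure (MarkSpace T)) :
    nextPath γ g ν x x₀ (M.restrict (activeSet T g)) = nextPath γ g ν x x₀ M := by
  by_cases h : M ∈ goodNoise T g ∧
      IsRegular (fun t => x₀ + ⌊∫ e in {e | e.1 ≤ t}, jump γ x ν e ∂(activeKernel T g M)⌋)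
  · have h' := h
    rw [← restrict_activeSet_mem_goodNoise_iff, ← activeKernel_restrict_activeSet] at h'
    rw [nextPath, nextPath, dif_pos h, dif_pos h']
    ext t
    show x₀ + ⌊_⌋ = x₀ + ⌊_⌋
    rw [activeKernel_restrict_activeSet]
  · have h' := h
    rw [← restrict_activeSet_mem_goodNoise_iff, ← activeKernel_restrict_activeSet] at h'
    rw [nextPath, nextPath, dif_neg h, dif_neg h']

/-- The successive approximations, as functions of the initial state and the noise, where `Q` is
the joint law of these two. -/
structure IsPicardSequence (γ : ℤ → ℤ → ℤ → ℤ → ℝ) (g : ℤ → ℝ)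
    (Q : ProbabilityMeasure (ℤ × Measure (MarkSpace T))) (θ : ProbabilityMeasure (PathSpace T ℤ))
    (φ : ℕ → ℤ × Measure (MarkSpace T) → PathSpace T ℤ) : Prop where
  measurable : ∀ k, Measurable (φ k)
  zero : ∀ p, φ 0 p = constPath p.1
  succ : ∀ k p, φ (k + 1) p =
    nextPath γ g (flowOf (Q.map (measurable k).aemeasurable) θ) (φ k p) p.1 p.2

theorem measurable_constPath : Measurable (constPath (T := T) (S := ℤ)) :=
  PathSpace.measurable_of_eval fun _ => measurable_id

/-- The recursion carries measurability along, because the next step needs the law of the present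
one. -/
theorem RateBound.exists_isPicardSequence (h : RateBound γ g) (hT : 0 ≤ T)
    (Q : ProbabilityMeasure (ℤ × Measure (MarkSpace T))) (θ : ProbabilityMeasure (PathSpace T ℤ)) :
    ∃ φ, IsPicardSequence γ g Q θ φ := by
  let Φ : ℕ → {φ : ℤ × Measure (MarkSpace T) → PathSpace T ℤ // Measurable φ} := fun k =>
    Nat.rec ⟨fun p => constPath p.1, measurable_constPath.comp measurable_fst⟩
      (fun _ φ => ⟨fun p => nextPath γ g (flowOf (Q.map φ.2.aemeasurable) θ) (φ.1 p) p.1 p.2,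
        h.measurable_nextPath hT (flowOf_leftLimit _ _) φ.2 measurable_fst measurable_snd⟩) k
  exact ⟨fun k => (Φ k).1, fun k => (Φ k).2, fun _ => rfl, fun _ _ => rfl⟩

variable {Q : ProbabilityMeasure (ℤ × Measure (MarkSpace T))}
  {θ : ProbabilityMeasure (PathSpace T ℤ)} {φ : ℕ → ℤ × Measure (MarkSpace T) → PathSpace T ℤ}

namespace IsPicardSequence

/-- The measure flow of an approximation. -/
noncomputable def flow (hφ : IsPicardSequence γ g Q θ φ) (k : ℕ) :
    Icc (0 : ℝ) T → ProbabilityMeasure (ℤ × ℤ) :=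
  flowOf (Q.map (hφ.measurable k).aemeasurable) θ

theorem restrict_activeSet (hφ : IsPicardSequence γ g Q θ φ) (k : ℕ) (x₀ : ℤ)
    (M : Measure (MarkSpace T)) : φ k (x₀, M.restrict (activeSet T g)) = φ k (x₀, M) := by
  induction k with
  | zero => rw [hφ.zero, hφ.zero]
  | succ k ih => rw [hφ.succ, hφ.succ, ih, nextPath_restrict_activeSet]

/-- Every step looks only at the path before, and the noise up to, the time in question. -/
theorem causal (hφ : IsPicardSequence γ g Q θ φ) (h : RateBound γ g) (hT : 0 ≤ T) (k : ℕ) (x₀ : ℤ)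
    {M : Measure (MarkSpace T)} (hM : M ∈ goodNoise T g) (t s : Icc (0 : ℝ) T) (hs : s ≤ t) :
    φ k (x₀, M) s = φ k (x₀, M.restrict {e | e.1 ≤ t}) s := by
  induction k generalizing s with
  | zero => rw [hφ.zero, hφ.zero]
  | succ k ih =>
    rw [hφ.succ, hφ.succ]
    exact h.nextPath_congr hT (flowOf_leftLimit _ _) x₀ hM ih hs

/-- The distance of two successive approximations, in terms of their jumps. -/
noncomputable def dist (hφ : IsPicardSequence γ g Q θ φ) (k : ℕ)
    (p : ℤ × Measure (MarkSpace T)) (t : Icc (0 : ℝ) T) : ℝ≥0∞ :=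
  jumpDist γ g (φ (k + 1) p) (φ k p) (hφ.flow (k + 1)) (hφ.flow k) p.2 t

theorem measurable_dist (hφ : IsPicardSequence γ g Q θ φ) (h : RateBound γ g) (hT : 0 ≤ T) (k : ℕ)
    (t : Icc (0 : ℝ) T) : Measurable fun p => hφ.dist k p t :=
  h.measurable_jumpDist hT measurable_snd (ν := fun _ => hφ.flow (k + 1)) (ν' := fun _ => hφ.flow k)
    (fun _ => flowOf_leftLimit _ _) (fun _ => flowOf_leftLimit _ _)
    (fun t y => RateBound.measurable_totalRate_comp γ (hφ.measurable _) _ t y)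
    (fun t y => RateBound.measurable_totalRate_comp γ (hφ.measurable _) _ t y) t

theorem enorm_sub_le_dist (hφ : IsPicardSequence γ g Q θ φ) (h : RateBound γ g) (hT : 0 ≤ T)
    (k : ℕ) (p : ℤ × Measure (MarkSpace T)) (t : Icc (0 : ℝ) T) :
    ‖φ (k + 2) p t - φ (k + 1) p t‖ₑ ≤ hφ.dist k p t := by
  have := h.enorm_nextPath_sub_le hT
    (flowOf_leftLimit (Q.map (hφ.measurable (k + 1)).aemeasurable) θ)
    (flowOf_leftLimit (Q.map (hφ.measurable k).aemeasurable) θ) (φ (k + 1) p) (φ k p) p.1 p.2 t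
  rwa [← hφ.succ, ← hφ.succ] at this

/-- Once the distance is below one at the final time, consecutive approximations are the same path.
-/
theorem eventually_const (hφ : IsPicardSequence γ g Q θ φ) (h : RateBound γ g) (hT : 0 ≤ T)
    {p : ℤ × Measure (MarkSpace T)}
    (hp : ∀ᶠ k in atTop, hφ.dist k p ⟨T, hT, le_rfl⟩ < 1) : ∃ m, ∀ k ≥ m, φ k p = φ m p := by
  obtain ⟨m, hm⟩ := eventually_atTop.1 hp
  refine ⟨m + 1, fun k hk => ?_⟩
  induction k, hk using Nat.le_induction with
  | base => rfl
  | succ k hk ih =>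
    obtain ⟨j, rfl⟩ : ∃ j, k = j + 1 := ⟨k - 1, by omega⟩
    rw [← ih]
    exact path_eq_of_jumpDist_eq_zero (jumpDist_mono _ _ _ _ _)
      (fun t => hφ.enorm_sub_le_dist h hT j p t) rfl (hm j (by omega))

variable {Ω : Type*} [mΩ : MeasurableSpace Ω] {P : Measure Ω} [IsProbabilityMeasure P]
  {F : Filtration (Icc (0 : ℝ) T) mΩ} {ρ : Measure ℤ} [IsFiniteMeasure ρ] {X₀ : Ω → ℤ}
  {N : Ω → Measure (MarkSpace T)}

/-- By causality the value at `t` is almost surely a function of the initial state and the noise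
restricted to `[0,t]`, both `F t`-measurable. -/
theorem isAEAdapted (hφ : IsPicardSequence γ g Q θ φ) (h : RateBound γ g) (hT : 0 ≤ T)
    (hC : jumpConst ρ g < ∞) (hN : IsNode P F ρ X₀ N) (k : ℕ) :
    IsAEAdapted P F fun ω => φ k (X₀ ω, N ω) := by
  intro t
  refine ⟨fun ω => φ k (X₀ ω, (N ω).restrict {e | e.1 ≤ t}) t, ?_, ?_⟩
  · exact ((PathSpace.measurable_eval t).comp (hφ.measurable k)).comp
      ((hN.init_measurable t).prodMk (hN.poisson_adapted t))
  · filter_upwards [hN.ae_good (g := g) hT hC] with ω hω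
    exact hφ.causal h hT k _ hω t t le_rfl

omit [IsProbabilityMeasure P] [IsFiniteMeasure ρ] in
-- `Q` records the noise on the active region only, which is all that the approximations see; so `Q`
-- determines their laws on any node.
theorem coe_law (hφ : IsPicardSequence γ g Q θ φ) (hX₀ : Measurable X₀) (hN : Measurable N)
    (hQ : P.map (fun ω => (X₀ ω, (N ω).restrict (activeSet T g))) = Q) (k : ℕ) :
    ((Q.map (hφ.measurable k).aemeasurable : ProbabilityMeasure _) : Measure (PathSpace T ℤ)) =
      P.map fun ω => φ k (X₀ ω, N ω) := by
  show (Q : Measure _).map (φ k) = _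
  have hY : Measurable fun ω => (X₀ ω, (N ω).restrict (activeSet T g)) :=
    hX₀.prodMk ((measurable_restrict_measure (measurableSet_activeSet g)).comp hN)
  rw [← hQ, Measure.map_map (hφ.measurable k) hY]
  congr 1
  ext1 ω
  exact hφ.restrict_activeSet k _ _

/-- The jump mass bounds the first distance; the exponential weight makes every further step
contract by one half. -/
theorem lintegral_dist_le (hφ : IsPicardSequence γ g Q θ φ) (h : RateBound γ g) (hT : 0 ≤ T)
    (hC : jumpConst ρ g < ∞) (hN : IsNode P F ρ X₀ N)
    (hQ : P.map (fun ω => (X₀ ω, (N ω).restrict (activeSet T g))) = Q) (k : ℕ)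
    (t : Icc (0 : ℝ) T) :
    ∫⁻ ω, hφ.dist k (X₀ ω, N ω) t ∂P ≤ ENNReal.ofReal T * jumpConst ρ g * 2⁻¹ ^ k *
      expWeight (2 * (2 * jumpConst ρ g).toNNReal) t := by
  have hY : Measurable fun ω => (X₀ ω, N ω) := (hN.measurable_init hT).prodMk hN.poisson.measurable
  have hm := fun k => (hφ.measurable k).comp hY
  have hl := hφ.coe_law (hN.measurable_init hT) hN.poisson.measurable hQ
  induction k generalizing t with
  | zero =>
    rw [pow_zero, mul_one]
    calc _ ≤ ENNReal.ofReal T * jumpConst ρ g * 1 := by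
          rw [mul_one]
          exact (lintegral_mono fun ω => jumpDist_le_jumpMass _ _ _ _ _ _).trans
            (lintegral_jumpMass_le hT hC hN.poisson hN.indepFuture)
      _ ≤ _ := by
          gcongr
          exact one_le_expWeight (by positivity) t
  | succ k ih =>
    refine (h.lintegral_jumpDist_flowOf_le hT hC hN (hm (k + 2)) (hm (k + 1))
      (hφ.isAEAdapted h hT hC hN _) (hφ.isAEAdapted h hT hC hN _) (hl _) (hl _)
      (v := fun t => ∫⁻ ω, hφ.dist k (X₀ ω, N ω) t ∂P)
      (fun s t hst => lintegral_mono fun ω => jumpDist_mono _ _ _ _ _ hst)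
      (fun t => lintegral_mono fun ω => hφ.enorm_sub_le_dist h hT k _ t) t).trans ?_
    refine (lintegral_le_half_expWeight _ ih t).trans (le_of_eq ?_)
    rw [pow_succ, div_eq_mul_inv]
    ring

end IsPicardSequence

/-- The constant in the geometric rate of convergence of the successive approximations. -/
noncomputable def picardConst (T : ℝ) (ρ : Measure ℤ) (g : ℤ → ℝ) : ℝ≥0∞ :=
  ENNReal.ofReal T * jumpConst ρ g *
    ENNReal.ofReal (Real.exp (2 * (2 * jumpConst ρ g).toNNReal * T))

theorem picardConst_ne_top {ρ : Measure ℤ} (hC : jumpConst ρ g < ∞) : picardConst T ρ g ≠ ∞ :=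
  ENNReal.mul_ne_top (ENNReal.mul_ne_top ENNReal.ofReal_ne_top hC.ne) ENNReal.ofReal_ne_top

theorem expWeight_le {c : ℝ} (hc : 0 ≤ c) (t : Icc (0 : ℝ) T) :
    expWeight c t ≤ ENNReal.ofReal (Real.exp (c * T)) :=
  ENNReal.ofReal_le_ofReal (Real.exp_le_exp.2 (mul_le_mul_of_nonneg_left t.2.2 hc))

theorem IsPicardSequence.lintegral_dist_le_const {Ω : Type*} [mΩ : MeasurableSpace Ω]
    {P : Measure Ω} [IsProbabilityMeasure P]
    {F : Filtration (Icc (0 : ℝ) T) mΩ} {ρ : Measure ℤ} [IsFiniteMeasure ρ] {X₀ : Ω → ℤ}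
    {N : Ω → Measure (MarkSpace T)} (hφ : IsPicardSequence γ g Q θ φ) (h : RateBound γ g)
    (hT : 0 ≤ T) (hC : jumpConst ρ g < ∞) (hN : IsNode P F ρ X₀ N)
    (hQ : P.map (fun ω => (X₀ ω, (N ω).restrict (activeSet T g))) = Q) (k : ℕ)
    (t : Icc (0 : ℝ) T) :
    ∫⁻ ω, hφ.dist k (X₀ ω, N ω) t ∂P ≤ picardConst T ρ g * 2⁻¹ ^ k := by
  refine (hφ.lintegral_dist_le h hT hC hN hQ k t).trans ?_
  rw [picardConst, mul_right_comm]
  gcongr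
  exact expWeight_le (by positivity) t

/-- The limit of the successive approximations solves the equation with the flow of its own law. -/
theorem RateBound.exists_nodeSolution (h : RateBound γ g) (hT : 0 ≤ T) {ρ : Measure ℤ}
    [IsFiniteMeasure ρ] (hC : jumpConst ρ g < ∞)
    (Q : ProbabilityMeasure (ℤ × Measure (MarkSpace T))) (θ : ProbabilityMeasure (PathSpace T ℤ))
    {Ω : Type*} [mΩ : MeasurableSpace Ω] (P : Measure Ω) [IsProbabilityMeasure P]
    (F : Filtration (Icc (0 : ℝ) T) mΩ) :
    ∃ (ψ : ℤ × Measure (MarkSpace T) → PathSpace T ℤ) (hψ : Measurable ψ),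
      ∀ (X₀ : Ω → ℤ) (N : Ω → Measure (MarkSpace T)), IsNode P F ρ X₀ N →
        P.map (fun ω => (X₀ ω, (N ω).restrict (activeSet T g))) = Q →
        IsNodeSolution P F γ X₀ N (fun _ => flowOf (Q.map hψ.aemeasurable) θ)
          (fun ω => ψ (X₀ ω, (N ω).restrict (activeSet T g))) := by
  let t₁ : Icc (0 : ℝ) T := ⟨T, hT, le_rfl⟩
  obtain ⟨φ, hφ⟩ := h.exists_isPicardSequence hT Q θ
  have hS : MeasurableSet {p | ∀ᶠ k in atTop, hφ.dist k p t₁ < 1} := by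
    refine measurableSet_eventually_atTop fun k => ?_
    exact measurableSet_lt (hφ.measurable_dist h hT k t₁) measurable_const
  obtain ⟨ψ, hψ, hlim⟩ := exists_measurable_eventual_limit hφ.measurable hS
    fun p hp => hφ.eventually_const h hT hp
  refine ⟨ψ, hψ, fun X₀ N hN hQ => ?_⟩
  have hX₀ := hN.measurable_init hT
  have hNm := hN.poisson.measurable
  have hY : Measurable fun ω => (X₀ ω, N ω) := hX₀.prodMk hNm
  have hYr : Measurable fun ω => (X₀ ω, (N ω).restrict (activeSet T g)) :=
    hX₀.prodMk ((measurable_restrict_measure (measurableSet_activeSet g)).comp hNm)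
  let X : Ω → PathSpace T ℤ := fun ω => ψ (X₀ ω, (N ω).restrict (activeSet T g))
  let Xs : ℕ → Ω → PathSpace T ℤ := fun k ω => φ k (X₀ ω, N ω)
  have hX : Measurable X := hψ.comp hYr
  have hXs : ∀ k, Measurable (Xs k) := fun k => (hφ.measurable k).comp hY
  have hl := hφ.coe_law hX₀ hNm hQ
  have hl' : ((Q.map hψ.aemeasurable : ProbabilityMeasure _) : Measure (PathSpace T ℤ)) =
      P.map X := by
    show (Q : Measure _).map ψ = _
    rw [← hQ, Measure.map_map hψ hYr]
    rfl
  have hconst := hφ.lintegral_dist_le_const h hT hC hN hQ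
  have hmd : ∀ k t, Measurable fun ω => hφ.dist k (X₀ ω, N ω) t := fun k t =>
    (hφ.measurable_dist h hT k t).comp hY
  -- The mean distances of successive approximations are summable, so almost surely they are below
  -- one from some step on, and the approximations stop changing.
  have hev : ∀ᵐ ω ∂P, ∀ᶠ k in atTop, Xs k ω = X ω := by
    filter_upwards [ae_eventually_lt_one (fun k => hmd k t₁) (picardConst_ne_top hC)
      (fun k => hconst k t₁)] with ω hω
    have hd : ∀ k, hφ.dist k (X₀ ω, (N ω).restrict (activeSet T g)) t₁ =
        hφ.dist k (X₀ ω, N ω) t₁ := fun k => by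
      simp only [IsPicardSequence.dist, hφ.restrict_activeSet, jumpDist_restrict_activeSet]
    have := hlim (X₀ ω, (N ω).restrict (activeSet T g))
      (show ∀ᶠ k in atTop, _ from by simpa only [hd] using hω)
    simpa only [hφ.restrict_activeSet] using this
  have hXa : IsAEAdapted P F X :=
    IsAEAdapted.of_eventually_eq (fun k => hφ.isAEAdapted h hT hC hN k) hev
  -- the distance to the limit
  have hdist : ∀ k t, ∫⁻ ω, ‖X ω t - Xs (k + 1) ω t‖ₑ ∂P ≤
      picardConst T ρ g * 2 * 2⁻¹ ^ k := by
    intro k t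
    calc ∫⁻ ω, ‖X ω t - Xs (k + 1) ω t‖ₑ ∂P
        ≤ ∫⁻ ω, ∑' m, hφ.dist (k + m) (X₀ ω, N ω) t ∂P := by
          refine lintegral_mono_ae ?_
          filter_upwards [hev] with ω hω
          have h1 := edist_le_tsum_of_edist_le_of_tendsto₀ (f := fun m => Xs (k + 1 + m) ω t)
            (fun m => hφ.dist (k + m) (X₀ ω, N ω) t) (fun m => ?_) (a := X ω t) ?_
          · rw [← edist_eq_enorm_sub, edist_comm]
            exact h1
          · rw [edist_comm, edist_eq_enorm_sub]
            have e1 : k + 1 + (m + 1) = k + m + 2 := by ring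
            have e2 : k + 1 + m = k + m + 1 := by ring
            simp only [Nat.succ_eq_add_one, e1, e2]
            exact hφ.enorm_sub_le_dist h hT (k + m) _ t
          · refine tendsto_const_nhds.congr' ?_
            filter_upwards [(tendsto_add_atTop_nat (k + 1)).eventually hω] with m hm
            rw [add_comm (k + 1), hm]
      _ = ∑' m, ∫⁻ ω, hφ.dist (k + m) (X₀ ω, N ω) t ∂P :=
          lintegral_tsum fun m => (hmd _ t).aemeasurable
      _ ≤ ∑' m, picardConst T ρ g * 2⁻¹ ^ k * 2⁻¹ ^ m := by
          refine ENNReal.tsum_le_tsum fun m => (hconst _ t).trans (le_of_eq ?_)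
          rw [pow_add, mul_assoc]
      _ = _ := by
          -- The extra factor `2` is the sum of the geometric tail.
          rw [ENNReal.tsum_mul_left, ENNReal.tsum_geometric, ENNReal.one_sub_inv_two, inv_inv]
          ring
  have hν := flowOf_leftLimit (Q.map hψ.aemeasurable) θ
  -- One further step, from the limit with the flow of its law and from an approximation with its
  -- own flow: the mean difference decays geometrically, so almost surely it is eventually below
  -- one.
  have hR : ∀ᵐ ω ∂P, ∀ᶠ k in atTop, jumpDist γ g (X ω) (Xs (k + 1) ω)
      (flowOf (Q.map hψ.aemeasurable) θ) (hφ.flow (k + 1)) (N ω) t₁ < 1 := by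
    refine ae_eventually_lt_one (C := ((2 * jumpConst ρ g).toNNReal : ℝ≥0∞) *
      (timeMeasure T {s | s ≤ t₁} * (picardConst T ρ g * 2))) (fun k => ?_) ?_ fun k => ?_
    · exact h.measurable_jumpDist hT hNm (ν := fun _ => flowOf (Q.map hψ.aemeasurable) θ)
        (ν' := fun _ => hφ.flow (k + 1)) (fun _ => hν) (fun _ => flowOf_leftLimit _ _)
        (fun t y => RateBound.measurable_totalRate_comp γ hX _ t y)
        (fun t y => RateBound.measurable_totalRate_comp γ (hXs _) _ t y) t₁
    · exact ENNReal.mul_ne_top ENNReal.coe_ne_top (ENNReal.mul_ne_top (measure_ne_top _ _)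
        (ENNReal.mul_ne_top (picardConst_ne_top hC) (by norm_num)))
    · refine (h.lintegral_jumpDist_flowOf_le hT hC hN hX (hXs (k + 1)) hXa
        (hφ.isAEAdapted h hT hC hN _) hl' (hl _) (v := fun _ => picardConst T ρ g * 2 * 2⁻¹ ^ k)
        monotone_const (hdist k) t₁).trans (le_of_eq ?_)
      rw [setLIntegral_const]
      ring
  refine ⟨hX, hXa, ?_⟩
  rw [h.ae_solvesEquation_activeKernel hT hC hN]
  filter_upwards [hev, hR, hN.ae_good (g := g) hT hC] with ω w1 w2 w3
  refine h.solvesEquation_of_nextPath_eq hT hν w3 ?_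
  -- Choose `k` so large that approximation `k + 2` is already the limit and also equals the step
  -- from the limit. The limit is then a fixed point.
  obtain ⟨k, hk1, hk2⟩ := (((tendsto_add_atTop_nat 2).eventually w1).and w2).exists
  have hk3 : nextPath γ g (flowOf (Q.map hψ.aemeasurable) θ) (X ω) (X₀ ω) (N ω) = Xs (k + 2) ω := by
    refine path_eq_of_jumpDist_eq_zero (jumpDist_mono _ _ _ _ _) (fun t => ?_) (t₁ := t₁) rfl hk2
    show ‖_ - φ (k + 2) (X₀ ω, N ω) t‖ₑ ≤ _
    rw [hφ.succ (k + 1)]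
    exact h.enorm_nextPath_sub_le hT hν (flowOf_leftLimit _ _) _ _ _ _ t
  exact hk3.trans hk1

end Picard

end EdgeMeanField

namespace EdgeMeanField

/-! ### Independence of pairs -/

section Independence

variable {Ω ι α β : Type*} [mΩ : MeasurableSpace Ω] {P : Measure Ω} [MeasurableSpace α]
  [MeasurableSpace β]

/-- The preimages of measurable rectangles. -/
def preimageRectangles (f : Ω → α) (g : Ω → β) : Set (Set Ω) :=
  {S | ∃ A B, MeasurableSet A ∧ MeasurableSet B ∧ S = f ⁻¹' A ∩ g ⁻¹' B}

omit mΩ in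
theorem isPiSystem_preimageRectangles (f : Ω → α) (g : Ω → β) :
    IsPiSystem (preimageRectangles f g) := by
  rintro _ ⟨A, B, hA, hB, rfl⟩ _ ⟨A', B', hA', hB', rfl⟩ -
  refine ⟨A ∩ A', B ∩ B', hA.inter hA', hB.inter hB', ?_⟩
  rw [preimage_inter, preimage_inter, inter_inter_inter_comm]

omit mΩ in
theorem generateFrom_preimageRectangles (f : Ω → α) (g : Ω → β) :
    MeasurableSpace.comap (fun ω => (f ω, g ω)) Prod.instMeasurableSpace =
      MeasurableSpace.generateFrom (preimageRectangles f g) := by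
  rw [← generateFrom_prod, MeasurableSpace.comap_generateFrom]
  congr 1
  ext S
  constructor
  · rintro ⟨_, ⟨A, hA, B, hB, rfl⟩, rfl⟩
    exact ⟨A, B, hA, hB, rfl⟩
  · rintro ⟨A, B, hA, hB, rfl⟩
    exact ⟨_, ⟨A, hA, B, hB, rfl⟩, rfl⟩

/-- If the `f i` are independent, the `g i` are independent and the two families are independent of
each other, then the pairs `(f i, g i)` are independent. -/
theorem iIndepFun_prodMk {f : ι → Ω → α} {g : ι → Ω → β} (hfm : ∀ i, Measurable (f i))
    (hgm : ∀ i, Measurable (g i)) (hf : iIndepFun f P) (hg : iIndepFun g P)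
    (hfg : IndepFun (fun ω i => f i ω) (fun ω i => g i ω) P) :
    iIndepFun (fun i ω => (f i ω, g i ω)) P := by
  rw [iIndepFun_iff_iIndep]
  refine iIndepSets.iIndep (fun i => ((hfm i).prodMk (hgm i)).comap_le)
    (fun i => preimageRectangles (f i) (g i)) (fun i => isPiSystem_preimageRectangles _ _)
    (fun i => generateFrom_preimageRectangles _ _) ?_
  -- On rectangles the probability factorizes three times: between the two families, within each
  -- family, and back into the individual pairs.
  rw [iIndepSets_iff]
  intro s S hS
  choose! A B hA hB hAB using hS
  have hAm : MeasurableSet {v : ι → α | ∀ i ∈ s, v i ∈ A i} := by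
    have : {v : ι → α | ∀ i ∈ s, v i ∈ A i} = ⋂ i ∈ s, (fun v => v i) ⁻¹' A i := by
      ext; simp
    rw [this]
    exact Finset.measurableSet_biInter s fun i hi => measurable_pi_apply i (hA i hi)
  have hBm : MeasurableSet {v : ι → β | ∀ i ∈ s, v i ∈ B i} := by
    have : {v : ι → β | ∀ i ∈ s, v i ∈ B i} = ⋂ i ∈ s, (fun v => v i) ⁻¹' B i := by
      ext; simp
    rw [this]
    exact Finset.measurableSet_biInter s fun i hi => measurable_pi_apply i (hB i hi)
  have h1 : ⋂ i ∈ s, S i = (fun ω i => f i ω) ⁻¹' {v | ∀ i ∈ s, v i ∈ A i} ∩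
      (fun ω i => g i ω) ⁻¹' {v | ∀ i ∈ s, v i ∈ B i} := by
    ext ω
    simp only [mem_iInter, mem_inter_iff, mem_preimage, mem_ofPred_eq]
    constructor
    · intro h
      exact ⟨fun i hi => ((hAB i hi).subset (h i hi)).1, fun i hi => ((hAB i hi).subset (h i hi)).2⟩
    · rintro ⟨ha, hb⟩ i hi
      rw [hAB i hi]
      exact ⟨ha i hi, hb i hi⟩
  have h2 : (fun ω i => f i ω) ⁻¹' {v : ι → α | ∀ i ∈ s, v i ∈ A i} = ⋂ i ∈ s, f i ⁻¹' A i := by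
    ext; simp
  have h3 : (fun ω i => g i ω) ⁻¹' {v : ι → β | ∀ i ∈ s, v i ∈ B i} = ⋂ i ∈ s, g i ⁻¹' B i := by
    ext; simp
  rw [h1, hfg.measure_inter_preimage_eq_mul _ _ hAm hBm, h2, h3,
    hf.measure_inter_preimage_eq_mul s (fun i hi => hA i hi),
    hg.measure_inter_preimage_eq_mul s (fun i hi => hB i hi), ← Finset.prod_mul_distrib]
  refine Finset.prod_congr rfl fun i hi => ?_
  rw [hAB i hi]
  have : IndepFun (f i) (g i) P := hfg.comp (measurable_pi_apply i) (measurable_pi_apply i)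
  exact (this.measure_inter_preimage_eq_mul _ _ (hA i hi) (hB i hi)).symm

end Independence

/-! ### Existence for the limiting system and the joint law of its nodes -/

section LimitSystem

variable {T : ℝ} {γ : ℤ → ℤ → ℤ → ℤ → ℝ} {g : ℤ → ℝ} {Ω : Type*} [mΩ : MeasurableSpace Ω]
  {P : Measure Ω} [IsProbabilityMeasure P] {F : Filtration (Icc (0 : ℝ) T) mΩ} {ρ : Measure ℤ}
  [IsFiniteMeasure ρ] {X₀ : ℕ → Ω → ℤ} {N : ℕ → Ω → Measure (MarkSpace T)}
  {ξ : ℕ → ℕ → Ω → PathSpace T ℤ} {θ : ProbabilityMeasure (PathSpace T ℤ)}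

omit [IsProbabilityMeasure P] [IsFiniteMeasure ρ] in
theorem IsModel.measurable_edge (hM : IsModel P F ρ θ X₀ N ξ) (i j : ℕ) : Measurable (ξ i j) :=
  PathSpace.measurable_of_eval fun t => (hM.edge_adapted i j t).mono (F.le t) le_rfl

omit [IsProbabilityMeasure P] [IsFiniteMeasure ρ] in
theorem IsModel.measurable_pair (hM : IsModel P F ρ θ X₀ N ξ) (hT : 0 ≤ T) (g : ℤ → ℝ) (i : ℕ) :
    Measurable fun ω => (X₀ i ω, (N i ω).restrict (activeSet T g)) :=
  ((hM.isNode i).measurable_init hT).prodMk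
    ((measurable_restrict_measure (measurableSet_activeSet g)).comp (hM.poisson i).measurable)

omit [IsProbabilityMeasure P] [IsFiniteMeasure ρ] in
theorem IsModel.indepFun_pair (hM : IsModel P F ρ θ X₀ N ξ) (g : ℤ → ℝ) :
    IndepFun (fun ω i => X₀ i ω) (fun ω i => (N i ω).restrict (activeSet T g)) P :=
  have hr : Measurable fun (v : ℕ → Measure (MarkSpace T)) i => (v i).restrict (activeSet T g) :=
    measurable_pi_lambda _ fun i =>
      (measurable_restrict_measure (measurableSet_activeSet g)).comp (measurable_pi_apply i)
  hM.init_indep_poisson.comp measurable_id hr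

/-- Initial state and noise are independent, and the law of the noise on the active region follows
from its intensity; hence one `Q` serves all nodes. -/
theorem IsModel.map_pair (hM : IsModel P F ρ θ X₀ N ξ) (hT : 0 ≤ T) (hC : jumpConst ρ g < ∞)
    (i : ℕ) : P.map (fun ω => (X₀ i ω, (N i ω).restrict (activeSet T g))) =
      P.map (fun ω => (X₀ 0 ω, (N 0 ω).restrict (activeSet T g))) := by
  have hr := measurable_restrict_measure (measurableSet_activeSet (T := T) g)
  have key : ∀ i, P.map (fun ω => (X₀ i ω, (N i ω).restrict (activeSet T g))) =
      (P.map (X₀ i)).prod (P.map fun ω => (N i ω).restrict (activeSet T g)) := fun i =>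
    (indepFun_iff_map_prod_eq_prod_map_map ((hM.isNode i).measurable_init hT).aemeasurable
      (hr.comp (hM.poisson i).measurable).aemeasurable).1
        ((hM.indepFun_pair g).comp (measurable_pi_apply i) (measurable_pi_apply i))
  rw [key i, key 0, (hM.init_identDistrib i).map_eq, (hM.poisson i).map_restrict_eq (hM.poisson 0)
    (measurableSet_activeSet g) (intensity_activeSet_lt_top hC)]

omit [IsProbabilityMeasure P] [IsFiniteMeasure ρ] in
theorem IsModel.iIndepFun_pair (hM : IsModel P F ρ θ X₀ N ξ) (hT : 0 ≤ T) (g : ℤ → ℝ) :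
    iIndepFun (fun i ω => (X₀ i ω, (N i ω).restrict (activeSet T g))) P := by
  have hr := measurable_restrict_measure (measurableSet_activeSet (T := T) g)
  exact iIndepFun_prodMk (fun i => (hM.isNode i).measurable_init hT)
    (fun i => hr.comp (hM.poisson i).measurable) hM.init_indep
    (hM.poisson_indep.comp (fun _ μ => μ.restrict (activeSet T g)) fun _ => hr)
    (hM.indepFun_pair g)

/-- The limiting system has a solution in which each node is a function of its initial state and
its noise. -/
theorem IsModel.exists_limitSystem (hM : IsModel P F ρ θ X₀ N ξ) (h : RateBound γ g) (hT : 0 ≤ T)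
    (hC : jumpConst ρ g < ∞) :
    ∃ (ψ : ℤ × Measure (MarkSpace T) → PathSpace T ℤ)
      (ν : Icc (0 : ℝ) T → ProbabilityMeasure (ℤ × ℤ)), Measurable ψ ∧
      IsLimitSystem P F γ X₀ N ξ (fun i ω => ψ (X₀ i ω, (N i ω).restrict (activeSet T g))) ν := by
  let Q : ProbabilityMeasure (ℤ × Measure (MarkSpace T)) :=
    ⟨P.map (fun ω => (X₀ 0 ω, (N 0 ω).restrict (activeSet T g))),
      Measure.isProbabilityMeasure_map (hM.measurable_pair hT g 0).aemeasurable⟩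
  obtain ⟨ψ, hψ, hsol⟩ := h.exists_nodeSolution hT hC Q θ P F
  refine ⟨ψ, flowOf (Q.map hψ.aemeasurable) θ, hψ,
    fun i => hsol _ _ (hM.isNode i) (hM.map_pair hT hC i), fun i j t => ?_⟩
  rw [coe_flowOf, ← (hM.edge_law i j).map_eq]
  show (((Q : Measure _).map ψ).map _).prod _ = _
  have hQ : (Q : Measure (ℤ × Measure (MarkSpace T))) =
      P.map (fun ω => (X₀ i ω, (N i ω).restrict (activeSet T g))) := (hM.map_pair hT hC i).symm
  rw [hQ, Measure.map_map hψ (hM.measurable_pair hT g i), Measure.map_map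
    (PathSpace.measurable_eval t) (hψ.comp (hM.measurable_pair hT g i)),
    Measure.map_map (PathSpace.measurable_eval t) (hM.measurable_edge i j)]
  rfl

/-- The nodes of the limiting system are independent and identically distributed, also jointly with
the edge processes of one node. -/
theorem IsLimitSystem.exists_law (h : RateBound γ g) (hT : 0 ≤ T) (hC : jumpConst ρ g < ∞)
    (hM : IsModel P F ρ θ X₀ N ξ) {X : ℕ → Ω → PathSpace T ℤ}
    {ν : Icc (0 : ℝ) T → ProbabilityMeasure (ℤ × ℤ)} (hX : IsLimitSystem P F γ X₀ N ξ X ν) :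
    ∃ μ : ProbabilityMeasure (PathSpace T ℤ), ν = flowOf μ θ ∧ (∀ i, P.map (X i) = μ) ∧
      iIndepFun X P ∧ ∀ i, iIndepFun (fun j ω => (X j ω, ξ i j ω)) P ∧
        ∀ j, P.map (fun ω => (X j ω, ξ i j ω)) = (μ : Measure (PathSpace T ℤ)).prod θ := by
  obtain ⟨ψ, ν', hψ, hX'⟩ := hM.exists_limitSystem h hT hC
  -- By uniqueness, an arbitrary solution agrees almost surely with the constructed one, whose nodes
  -- are the same function of i.i.d. data; laws and independence carry over.
  have hae := (hX.unique h hT hC hM hX').2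
  have hm := fun i => (hX.solution i).measurable
  have hm' := fun i => (hX'.solution i).measurable
  have hlaw : ∀ i, P.map (X i) = lawOf P (hm 0) := by
    intro i
    show P.map (X i) = P.map (X 0)
    rw [Measure.map_congr (ae_all_iff.1 hae i), Measure.map_congr (ae_all_iff.1 hae 0)]
    have := hM.map_pair hT hC (g := g) i
    have h2 := congrArg (fun Q => Q.map ψ) this
    beta_reduce at h2
    rwa [Measure.map_map hψ (hM.measurable_pair hT g i),
      Measure.map_map hψ (hM.measurable_pair hT g 0)] at h2
  have hind' : iIndepFun (fun i ω => ψ (X₀ i ω, (N i ω).restrict (activeSet T g))) P :=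
    (hM.iIndepFun_pair hT g).comp (fun _ => ψ) fun _ => hψ
  have hr := measurable_restrict_measure (measurableSet_activeSet (T := T) g)
  have hedge : ∀ i, IndepFun (fun ω j => ψ (X₀ j ω, (N j ω).restrict (activeSet T g)))
      (fun ω j => ξ i j ω) P := by
    intro i
    refine (hM.edge_indep_node.comp (φ := fun v j => v (i, j))
      (ψ := fun w j => ψ (w.1 j, (w.2 j).restrict (activeSet T g))) ?_ ?_).symm
    · exact measurable_pi_lambda _ fun j => measurable_pi_apply (i, j)
    · exact measurable_pi_lambda _ fun j => hψ.comp
        (((measurable_pi_apply j).comp measurable_fst).prodMk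
          (hr.comp ((measurable_pi_apply j).comp measurable_snd)))
  have hξ : ∀ i, iIndepFun (fun j => ξ i j) P := fun i =>
    hM.edge_indep.precomp (g := fun j => (i, j)) fun a b hab => (Prod.ext_iff.1 hab).2
  have hae' : ∀ i j, (fun ω => (ψ (X₀ j ω, (N j ω).restrict (activeSet T g)), ξ i j ω)) =ᵐ[P]
      fun ω => (X j ω, ξ i j ω) := fun i j => by
    filter_upwards [hae] with ω hω
    rw [hω j]
  refine ⟨lawOf P (hm 0), hX.eq_flowOf hM 0, hlaw,
    hind'.congr fun i => hae.mono fun ω hω => (hω i).symm, fun i => ⟨?_, fun j => ?_⟩⟩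
  · exact (iIndepFun_prodMk hm' (hM.measurable_edge i) hind' (hξ i) (hedge i)).congr (hae' i)
  · have h1 := (indepFun_iff_map_prod_eq_prod_map_map (hm' j).aemeasurable
      (hM.measurable_edge i j).aemeasurable).1
        ((hedge i).comp (measurable_pi_apply j) (measurable_pi_apply j))
    rw [Measure.map_congr (hae' i j), (hM.edge_law i j).map_eq,
      ← Measure.map_congr (ae_all_iff.1 hae j), hlaw j] at h1
    exact h1

end LimitSystem

end EdgeMeanField

namespace EdgeMeanField

/-! ### Integrals and limits of empirical measures -/

section EmpiricalMeasure

variable {S : Type*} [MeasurableSpace S]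

theorem integral_empiricalMeasure (n : ℕ+) (x : ℕ → S) {f : S → ℝ} (hf : StronglyMeasurable f) :
    ∫ a, f a ∂(empiricalMeasure n x : Measure S) =
      (n : ℝ)⁻¹ * ∑ j ∈ Finset.range n, f (x j) := by
  show ∫ a, f a ∂((n : ℝ≥0∞)⁻¹ • ∑ j ∈ Finset.range n, Measure.dirac (x j)) = _
  rw [integral_smul_measure, integral_finsetSum_measure fun j _ =>
    integrable_dirac' hf enorm_lt_top]
  simp_rw [integral_dirac' f _ hf]
  simp

theorem exists_tendsto_empiricalMeasure [TopologicalSpace S] [OpensMeasurableSpace S]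
    {ι : Type*} {l : Filter ι} (n : ℕ+) {x : ι → ℕ → S}
    (hx : ∀ j, ∃ a, Tendsto (fun s => x s j) l (𝓝 a)) :
    ∃ a, Tendsto (fun s => empiricalMeasure n (x s)) l (𝓝 a) := by
  choose a ha using hx
  refine ⟨empiricalMeasure n a, ?_⟩
  rw [ProbabilityMeasure.tendsto_iff_forall_integral_tendsto]
  intro f
  simp_rw [integral_empiricalMeasure n _ f.continuous.measurable.stronglyMeasurable]
  exact Tendsto.const_mul _ (tendsto_finsetSum _ fun j _ => (f.continuous.tendsto _).comp (ha j))

end EmpiricalMeasure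

/-! ### Fluctuations of averages -/

section Variance

variable {Ω E : Type*} [mΩ : MeasurableSpace Ω] {P : Measure Ω} [IsProbabilityMeasure P]
  [MeasurableSpace E] {Z : ℕ → Ω → E} {π : ProbabilityMeasure E} {h : E → E → ℝ} {c : ℝ}

/-- `Z k` is independent of the pair `(Z i, Z j)`, and integrating it out gives zero by centring.
The case `i = j` is allowed, so the diagonal term needs no correction. -/
theorem integral_mul_eq_zero_of_iIndepFun (hZm : ∀ j, Measurable (Z j)) (hZ : iIndepFun Z P)
    (hlaw : ∀ j, P.map (Z j) = π) (hh : Measurable (Function.uncurry h))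
    (hc : ∀ a b, |h a b| ≤ c) (h0 : ∀ a, ∫ b, h a b ∂(π : Measure E) = 0) {i j k : ℕ} (hik : i ≠ k)
    (hjk : j ≠ k) : ∫ ω, h (Z i ω) (Z j ω) * h (Z i ω) (Z k ω) ∂P = 0 := by
  have hm : Measurable fun ω => (Z i ω, Z j ω) := (hZm i).prodMk (hZm j)
  have hprob : IsProbabilityMeasure (P.map fun ω => (Z i ω, Z j ω)) :=
    Measure.isProbabilityMeasure_map hm.aemeasurable
  have hmap := (indepFun_iff_map_prod_eq_prod_map_map hm.aemeasurable (hZm k).aemeasurable).1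
    (hZ.indepFun_prodMk hZm i j k hik hjk)
  rw [hlaw k] at hmap
  have hc0 : ∀ a b, ‖h a b‖ ≤ c := hc
  have hF : Measurable fun q : (E × E) × E => h q.1.1 q.1.2 * h q.1.1 q.2 :=
    (hh.comp measurable_fst).mul
      (hh.comp ((measurable_fst.comp measurable_fst).prodMk measurable_snd))
  have e : ∫ ω, h (Z i ω) (Z j ω) * h (Z i ω) (Z k ω) ∂P =
      ∫ q, h q.1.1 q.1.2 * h q.1.1 q.2 ∂(P.map fun ω => ((Z i ω, Z j ω), Z k ω)) :=
    (integral_map (hm.prodMk (hZm k)).aemeasurable hF.aestronglyMeasurable).symm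
  rw [e, hmap, integral_prod]
  · simp_rw [integral_const_mul, h0, mul_zero]
    simp
  · refine Integrable.of_bound hF.aestronglyMeasurable (c * c) (Eventually.of_forall fun q => ?_)
    rw [norm_mul]
    exact mul_le_mul (hc0 _ _) (hc0 _ _) (norm_nonneg _) ((norm_nonneg _).trans (hc0 q.1.1 q.1.2))

/-- Averages of functions of independent variables, centred in the second one. -/
theorem lintegral_average_le (hZm : ∀ j, Measurable (Z j)) (hZ : iIndepFun Z P)
    (hlaw : ∀ j, P.map (Z j) = π) (hh : Measurable (Function.uncurry h))
    (hc : ∀ a b, |h a b| ≤ c) (h0 : ∀ a, ∫ b, h a b ∂(π : Measure E) = 0) (i : ℕ) (n : ℕ+) :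
    ∫⁻ ω, ‖(n : ℝ)⁻¹ * ∑ j ∈ Finset.range n, h (Z i ω) (Z j ω)‖ₑ ∂P ≤
      ENNReal.ofReal (c / √(n : ℝ)) := by
  have hn : (0 : ℝ) < n := by exact_mod_cast n.pos
  obtain ⟨ω₀⟩ : Nonempty Ω := nonempty_of_isProbabilityMeasure P
  have hc0 : 0 ≤ c := (abs_nonneg _).trans (hc (Z 0 ω₀) (Z 0 ω₀))
  let Y : ℕ → Ω → ℝ := fun j ω => h (Z i ω) (Z j ω)
  have hYm : ∀ j, Measurable (Y j) := fun j => hh.comp ((hZm i).prodMk (hZm j))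
  have hYb : ∀ j ω, |Y j ω| ≤ c := fun j ω => hc _ _
  have hYi : ∀ j k, Integrable (fun ω => Y j ω * Y k ω) P := fun j k =>
    Integrable.of_bound ((hYm j).mul (hYm k)).aestronglyMeasurable (c * c)
      (Eventually.of_forall fun ω => by
        rw [norm_mul]
        exact mul_le_mul (hYb _ _) (hYb _ _) (norm_nonneg _) hc0)
  have hcross : ∀ j k, ∫ ω, Y j ω * Y k ω ∂P ≤ if j = k then c ^ 2 else 0 := by
    intro j k
    split_ifs with hjk
    · subst hjk
      refine (integral_mono (hYi j j) (integrable_const (c ^ 2)) fun ω => ?_).trans (by simp)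
      show Y j ω * Y j ω ≤ c ^ 2
      rw [← sq, ← sq_abs]
      exact pow_le_pow_left₀ (abs_nonneg _) (hYb j ω) 2
    -- Of two different indices at least one differs from `i`, and that one is integrated out. If `i
    -- = k` it is `j`, and the factors are exchanged.
    · by_cases hik : i = k
      · simp_rw [mul_comm (Y j _)]
        exact (integral_mul_eq_zero_of_iIndepFun hZm hZ hlaw hh hc h0
          (fun hij => hjk (hij.symm.trans hik)) (fun hkj => hjk hkj.symm)).le
      · exact (integral_mul_eq_zero_of_iIndepFun hZm hZ hlaw hh hc h0 hik hjk).le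
  let V : Ω → ℝ := fun ω => |(n : ℝ)⁻¹ * ∑ j ∈ Finset.range n, Y j ω|
  have hVm : Measurable V :=
    (measurable_const.mul (Finset.measurable_sum _ fun j _ => hYm j)).abs
  have hVb : ∀ ω, V ω ≤ c := by
    intro ω
    show |_| ≤ c
    rw [abs_mul, abs_of_pos (inv_pos.2 hn), inv_mul_le_iff₀ hn]
    refine (Finset.abs_sum_le_sum_abs _ _).trans ?_
    refine (Finset.sum_le_sum fun j _ => hYb j ω).trans ?_
    simp
  have hV2 : ∫ ω, V ω ^ 2 ∂P ≤ c ^ 2 / n := by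
    have e : ∀ ω, V ω ^ 2 = ((n : ℝ)⁻¹) ^ 2 *
        ∑ j ∈ Finset.range n, ∑ k ∈ Finset.range n, Y j ω * Y k ω := by
      intro ω
      show |_| ^ 2 = _
      rw [sq_abs, mul_pow, sq (∑ j ∈ Finset.range n, Y j ω), Finset.sum_mul_sum]
    simp_rw [e]
    rw [integral_const_mul, integral_finsetSum _ fun j _ => integrable_finsetSum _ fun k _ => hYi j k]
    simp_rw [integral_finsetSum _ fun k _ => hYi _ k]
    calc _ ≤ ((n : ℝ)⁻¹) ^ 2 * ∑ j ∈ Finset.range n, ∑ k ∈ Finset.range n,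
          (if j = k then c ^ 2 else 0) := by
          gcongr
          exact hcross _ _
      _ = ((n : ℝ)⁻¹) ^ 2 * ∑ j ∈ Finset.range n, c ^ 2 := by
          congr 1
          refine Finset.sum_congr rfl fun j hj => ?_
          rw [Finset.sum_ite_eq, if_pos hj]
      _ = _ := by
          simp only [Finset.sum_const, Finset.card_range, nsmul_eq_mul]
          field_simp
  have hVL : MemLp V 2 P := MemLp.of_bound hVm.aestronglyMeasurable c
    (Eventually.of_forall fun ω => by
      rw [Real.norm_of_nonneg (abs_nonneg _)]
      exact hVb ω)
  have hVi : Integrable V P := hVL.integrable (by norm_num)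
  have hvar := variance_nonneg V P
  rw [variance_eq_sub hVL] at hvar
  -- The variance of `V` is nonnegative, so the square of the mean is at most the second moment.
  have hle : ∫ ω, V ω ∂P ≤ c / √(n : ℝ) := by
    have h1 : (∫ ω, V ω ∂P) ^ 2 ≤ c ^ 2 / n := by
      have : ∫ ω, (V ^ 2) ω ∂P = ∫ ω, V ω ^ 2 ∂P := rfl
      linarith
    refine le_of_sq_le_sq ?_ (by positivity)
    rwa [div_pow, Real.sq_sqrt hn.le]
  calc _ = ∫⁻ ω, ENNReal.ofReal (V ω) ∂P := by
        refine lintegral_congr fun ω => ?_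
        rw [← ofReal_norm]
        rfl
    _ = ENNReal.ofReal (∫ ω, V ω ∂P) :=
        (ofReal_integral_eq_lintegral_ofReal hVi (Eventually.of_forall fun ω => abs_nonneg _)).symm
    _ ≤ _ := ENNReal.ofReal_le_ofReal hle

/-- The mean distance of averages to the conditional mean is at most of order `1 / √n`. -/
theorem lintegral_average_sub_le (hZm : ∀ j, Measurable (Z j)) (hZ : iIndepFun Z P)
    (hlaw : ∀ j, P.map (Z j) = π) (hh : Measurable (Function.uncurry h))
    (hc : ∀ a b, |h a b - ∫ b', h a b' ∂(π : Measure E)| ≤ c)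
    (hi : ∀ a, Integrable (h a) (π : Measure E)) (i : ℕ) (n : ℕ+) :
    ∫⁻ ω, ‖(n : ℝ)⁻¹ * ∑ j ∈ Finset.range n, h (Z i ω) (Z j ω) -
      ∫ b, h (Z i ω) b ∂(π : Measure E)‖ₑ ∂P ≤ ENNReal.ofReal (c / √(n : ℝ)) := by
  have hn : (n : ℝ) ≠ 0 := by exact_mod_cast n.ne_zero
  have hI : Measurable fun a => ∫ b, h a b ∂(π : Measure E) :=
    (StronglyMeasurable.integral_prod_right (f := h) hh.stronglyMeasurable).measurable
  refine le_trans (le_of_eq (lintegral_congr fun ω => ?_)) (lintegral_average_le hZm hZ hlaw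
    (h := fun a b => h a b - ∫ b', h a b' ∂(π : Measure E)) (hh.sub (hI.comp measurable_fst)) hc
    (fun a => ?_) i n)
  · rw [Finset.sum_sub_distrib, mul_sub]
    simp [hn]
  · rw [integral_sub (hi a) (integrable_const _)]
    simp

end Variance

end EdgeMeanField

namespace EdgeMeanField

/-! ### Rate of convergence of the particle system -/

section Rate

variable {T : ℝ} {γ : ℤ → ℤ → ℤ → ℤ → ℝ} {g : ℤ → ℝ}

theorem totalRate_empiricalMeasure (y x : ℤ) (n : ℕ+) (p : ℕ → ℤ × ℤ) :
    totalRate γ y x (empiricalMeasure n p) =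
      (n : ℝ)⁻¹ * ∑ j ∈ Finset.range n, γ y x (p j).1 (p j).2 :=
  integral_empiricalMeasure n p
    (measurable_of_countable fun q : ℤ × ℤ => γ y x q.1 q.2).stronglyMeasurable

/-- Both empirical measures use the same edges, so atoms are compared index by index and only the
node states differ. -/
theorem RateBound.enorm_totalRate_empiricalMeasure_sub_le (h : RateBound γ g) (y x : ℤ) (n : ℕ+)
    (a a' b : ℕ → ℤ) :
    ‖totalRate γ y x (empiricalMeasure n fun j => (a j, b j)) -
      totalRate γ y x (empiricalMeasure n fun j => (a' j, b j))‖ₑ ≤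
      ENNReal.ofReal (g y) * ((n : ℝ≥0∞)⁻¹ * ∑ j ∈ Finset.range n, ‖a j - a' j‖ₑ) := by
  have hn : (0 : ℝ) < n := by exact_mod_cast n.pos
  have e : ‖(n : ℝ)⁻¹‖ₑ = (n : ℝ≥0∞)⁻¹ := by
    rw [Real.enorm_of_nonneg (by positivity), ENNReal.ofReal_inv_of_pos hn, ENNReal.ofReal_natCast]
  rw [totalRate_empiricalMeasure, totalRate_empiricalMeasure, ← mul_sub, ← Finset.sum_sub_distrib,
    enorm_mul, e, mul_left_comm, Finset.mul_sum]
  gcongr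
  refine (enorm_sum_le _ _).trans (Finset.sum_le_sum fun j _ => ?_)
  exact enorm_sub_le_of_bounded (φ := fun z => γ y x z (b j)) (fun z => (h _ _ _ _).1)
    (fun z => (h _ _ _ _).2) _ _

theorem inv_mul_sum_range_const (n : ℕ+) (v : ℝ≥0∞) :
    (n : ℝ≥0∞)⁻¹ * ∑ _j ∈ Finset.range n, v = v := by
  rw [Finset.sum_const, Finset.card_range, nsmul_eq_mul, ← mul_assoc, ENNReal.inv_mul_cancel,
    one_mul]
  · exact_mod_cast n.ne_zero
  · exact ENNReal.natCast_ne_top _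

/-- The measure process that drives node `i`. -/
noncomputable def edgeFlow {Ω : Type*} (n : ℕ+) (X : ℕ → Ω → PathSpace T ℤ)
    (ξ : ℕ → Ω → PathSpace T ℤ) (ω : Ω) (t : Icc (0 : ℝ) T) : ProbabilityMeasure (ℤ × ℤ) :=
  empiricalMeasure n fun j => (X j ω t, ξ j ω t)

variable {Ω : Type*} [mΩ : MeasurableSpace Ω]

omit mΩ in
theorem edgeFlow_leftLimit (n : ℕ+) (X : ℕ → Ω → PathSpace T ℤ) (ξ : ℕ → Ω → PathSpace T ℤ) (ω : Ω)
    (t : Icc (0 : ℝ) T) : ∃ l, Tendsto (edgeFlow n X ξ ω) (𝓝[<] t) (𝓝 l) :=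
  exists_tendsto_empiricalMeasure n fun j =>
    (PathSpace.prodMk (X j ω) (ξ j ω)).left_limit t

omit mΩ in
theorem measurable_totalRate_edgeFlow {m : MeasurableSpace Ω} {n : ℕ+} {X : ℕ → Ω → PathSpace T ℤ}
    {ξ : ℕ → Ω → PathSpace T ℤ} {t : Icc (0 : ℝ) T}
    (hX : ∀ j < (n : ℕ), Measurable[m] fun ω => X j ω t)
    (hξ : ∀ j < (n : ℕ), Measurable[m] fun ω => ξ j ω t) {a : Ω → ℤ} (ha : Measurable[m] a) (y : ℤ) :
    Measurable[m] fun ω => totalRate γ y (a ω) (edgeFlow n X ξ ω t) := by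
  simp_rw [edgeFlow, totalRate_empiricalMeasure]
  refine measurable_const.mul (Finset.measurable_sum _ fun j hj => ?_)
  have hj := Finset.mem_range.1 hj
  exact (measurable_of_countable fun q : ℤ × ℤ × ℤ => γ y q.1 q.2.1 q.2.2).comp
    (ha.prodMk ((hX j hj).prodMk (hξ j hj)))

variable {P : Measure Ω} [IsProbabilityMeasure P] {F : Filtration (Icc (0 : ℝ) T) mΩ}
  {ρ : Measure ℤ} [IsFiniteMeasure ρ] {X₀ : ℕ → Ω → ℤ} {N : ℕ → Ω → Measure (MarkSpace T)}
  {ξ : ℕ → ℕ → Ω → PathSpace T ℤ} {θ : ProbabilityMeasure (PathSpace T ℤ)}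

theorem coe_flowOf_eq_map (μ θ : ProbabilityMeasure (PathSpace T ℤ)) (t : Icc (0 : ℝ) T) :
    (flowOf μ θ t : Measure (ℤ × ℤ)) =
      ((μ : Measure (PathSpace T ℤ)).prod (θ : Measure (PathSpace T ℤ))).map
        fun p : PathSpace T ℤ × PathSpace T ℤ => (p.1 t, p.2 t) := by
  rw [coe_flowOf]
  exact Measure.map_prod_map _ _ (PathSpace.measurable_eval t) (PathSpace.measurable_eval t)

/-- The fluctuation of the rates of the limiting system. -/
theorem RateBound.lintegral_totalRate_edgeFlow_sub_le (h : RateBound γ g)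
    {X ξ : ℕ → Ω → PathSpace T ℤ} (hX : ∀ j, Measurable (X j)) (hξ : ∀ j, Measurable (ξ j))
    (hind : iIndepFun (fun j ω => (X j ω, ξ j ω)) P) {μ θ : ProbabilityMeasure (PathSpace T ℤ)}
    (hlaw : ∀ j, P.map (fun ω => (X j ω, ξ j ω)) = (μ : Measure (PathSpace T ℤ)).prod θ)
    (y : ℤ) (i : ℕ) (n : ℕ+) (t : Icc (0 : ℝ) T) :
    ∫⁻ ω, ‖totalRate γ y (X i ω t) (edgeFlow n X ξ ω t) -
      totalRate γ y (X i ω t) (flowOf μ θ t)‖ₑ ∂P ≤ ENNReal.ofReal (g y / √(n : ℝ)) := by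
  have hpair : Measurable fun p : PathSpace T ℤ × PathSpace T ℤ => (p.1 t, p.2 t) :=
    ((PathSpace.measurable_eval t).comp measurable_fst).prodMk
      ((PathSpace.measurable_eval t).comp measurable_snd)
  -- Node `i` enters through its own state as first argument and is also one of the averaged pairs;
  -- the diagonal is covered by the estimate for averages.
  let f : PathSpace T ℤ × PathSpace T ℤ → PathSpace T ℤ × PathSpace T ℤ → ℝ := fun a b =>
    γ y (a.1 t) (b.1 t) (b.2 t)
  have hf : Measurable (Function.uncurry f) :=
    (measurable_of_countable fun q : (ℤ × ℤ) × (ℤ × ℤ) => γ y q.1.1 q.2.1 q.2.2).comp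
      ((hpair.comp measurable_fst).prodMk (hpair.comp measurable_snd))
  have hint : ∀ a, ∫ b, f a b ∂((μ.prod θ : ProbabilityMeasure _) : Measure _) =
      totalRate γ y (a.1 t) (flowOf μ θ t) := by
    intro a
    rw [totalRate, coe_flowOf_eq_map, integral_map hpair.aemeasurable
      (measurable_of_countable _).aestronglyMeasurable]
    rfl
  have key := lintegral_average_sub_le (fun j => (hX j).prodMk (hξ j)) hind (π := μ.prod θ) hlaw hf
    (c := g y) (fun a b => ?_) (fun a => ?_) i n
  · refine le_trans (le_of_eq (lintegral_congr fun ω => ?_)) key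
    rw [hint, edgeFlow, totalRate_empiricalMeasure]
  · rw [hint]
    have h1 := h y (a.1 t) (b.1 t) (b.2 t)
    have h2 := h.totalRate_nonneg y (a.1 t) (flowOf μ θ t)
    have h3 := h.totalRate_le y (a.1 t) (flowOf μ θ t)
    exact abs_sub_le_iff.2 ⟨by linarith [h1.2], by linarith [h1.1]⟩
  · exact Integrable.of_bound (hf.comp measurable_prodMk_left).aestronglyMeasurable (g y)
      (Eventually.of_forall fun b => h.norm_le y _ (b.1 t, b.2 t))

/-- The difference of the rates of the particle system and of the limiting system. -/
theorem RateBound.lintegral_totalRate_particle_sub_le (h : RateBound γ g)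
    {X Y ξ : ℕ → Ω → PathSpace T ℤ} (hX : ∀ j, Measurable (X j)) (hY : ∀ j, Measurable (Y j))
    (hξ : ∀ j, Measurable (ξ j))
    (hind : iIndepFun (fun j ω => (X j ω, ξ j ω)) P) {μ θ : ProbabilityMeasure (PathSpace T ℤ)}
    (hlaw : ∀ j, P.map (fun ω => (X j ω, ξ j ω)) = (μ : Measure (PathSpace T ℤ)).prod θ)
    (y : ℤ) {i : ℕ} {n : ℕ+} (hi : i < n) (t : Icc (0 : ℝ) T) {v : ℝ≥0∞}
    (hv : ∀ j < (n : ℕ), ∫⁻ ω, ‖Y j ω t - X j ω t‖ₑ ∂P ≤ v) :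
    ∫⁻ ω, ‖totalRate γ y (Y i ω t) (edgeFlow n Y ξ ω t) -
      totalRate γ y (X i ω t) (flowOf μ θ t)‖ₑ ∂P ≤
      ENNReal.ofReal (g y) * (2 * v + ENNReal.ofReal (1 / √(n : ℝ))) := by
  have hm : ∀ j, Measurable fun ω => ‖Y j ω t - X j ω t‖ₑ := fun j =>
    (((PathSpace.measurable_eval t).comp (hY j)).sub
      ((PathSpace.measurable_eval t).comp (hX j))).enorm
  have tri : ∀ a b c d : ℝ, ‖a - d‖ₑ ≤ ‖a - b‖ₑ + (‖b - c‖ₑ + ‖c - d‖ₑ) := by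
    intro a b c d
    rw [← sub_add_sub_cancel a b d, ← sub_add_sub_cancel b c d]
    exact (enorm_add_le _ _).trans (add_le_add le_rfl (enorm_add_le _ _))
  -- Two intermediate rates: first replace the state of node `i`, then the nodes in the empirical
  -- measure; what remains is the fluctuation of the limiting system.
  calc _ ≤ ∫⁻ ω, (ENNReal.ofReal (g y) * ‖Y i ω t - X i ω t‖ₑ +
        (ENNReal.ofReal (g y) * ((n : ℝ≥0∞)⁻¹ * ∑ j ∈ Finset.range n, ‖Y j ω t - X j ω t‖ₑ) +
        ‖totalRate γ y (X i ω t) (edgeFlow n X ξ ω t) -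
          totalRate γ y (X i ω t) (flowOf μ θ t)‖ₑ)) ∂P := by
        refine lintegral_mono fun ω => (tri _
          (totalRate γ y (X i ω t) (edgeFlow n Y ξ ω t))
          (totalRate γ y (X i ω t) (edgeFlow n X ξ ω t)) _).trans ?_
        exact add_le_add (h.enorm_totalRate_sub_le y _ _ _) (add_le_add
          (h.enorm_totalRate_empiricalMeasure_sub_le y _ n (fun j => Y j ω t) (fun j => X j ω t)
            fun j => ξ j ω t) le_rfl)
    _ = ENNReal.ofReal (g y) * ∫⁻ ω, ‖Y i ω t - X i ω t‖ₑ ∂P +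
        (ENNReal.ofReal (g y) * ((n : ℝ≥0∞)⁻¹ * ∑ j ∈ Finset.range n,
          ∫⁻ ω, ‖Y j ω t - X j ω t‖ₑ ∂P) +
        ∫⁻ ω, ‖totalRate γ y (X i ω t) (edgeFlow n X ξ ω t) -
          totalRate γ y (X i ω t) (flowOf μ θ t)‖ₑ ∂P) := by
        rw [lintegral_add_left ((hm i).const_mul _), lintegral_const_mul _ (hm i),
          lintegral_add_left (((Finset.measurable_sum _ fun j _ => hm j).const_mul _).const_mul _),
          lintegral_const_mul _ ((Finset.measurable_sum _ fun j _ => hm j).const_mul _),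
          lintegral_const_mul _ (Finset.measurable_sum _ fun j _ => hm j),
          lintegral_finsetSum _ fun j _ => hm j]
    _ ≤ ENNReal.ofReal (g y) * v + (ENNReal.ofReal (g y) *
        ((n : ℝ≥0∞)⁻¹ * ∑ _j ∈ Finset.range n, v) + ENNReal.ofReal (g y / √(n : ℝ))) := by
        refine add_le_add (mul_le_mul_right (hv i hi) _) (add_le_add ?_
          (h.lintegral_totalRate_edgeFlow_sub_le hX hξ hind hlaw y i n t))
        gcongr with j hj
        exact hv j (Finset.mem_range.1 hj)
    _ = _ := by
        rw [inv_mul_sum_range_const, div_eq_mul_one_div, ENNReal.ofReal_mul (h.nonneg y)]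
        ring

/-- The rate of convergence of the particle system to the limiting system: the bound holds for a
measurable majorant of the distance of the paths. -/
theorem IsParticleSystem.exists_majorant (h : RateBound γ g) (hT : 0 ≤ T) (hC : jumpConst ρ g < ∞)
    (hM : IsModel P F ρ θ X₀ N ξ) {X : ℕ → Ω → PathSpace T ℤ}
    {ν : Icc (0 : ℝ) T → ProbabilityMeasure (ℤ × ℤ)} (hX : IsLimitSystem P F γ X₀ N ξ X ν) {n : ℕ+}
    {Y : ℕ → Ω → PathSpace T ℤ} (hY : IsParticleSystem P F γ X₀ N ξ n Y) {i : ℕ} (hi : i < n) :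
    ∃ D : Ω → ℝ≥0∞, Measurable D ∧ (∀ᵐ ω ∂P, ∀ t, ‖Y i ω t - X i ω t‖ₑ ≤ D ω) ∧
      ∫⁻ ω, D ω ∂P ≤ ENNReal.ofReal (2 * (picardConst T ρ g).toReal / √(n : ℝ)) := by
  let t₁ : Icc (0 : ℝ) T := ⟨T, hT, le_rfl⟩
  have hn : (0 : ℝ) < n := by exact_mod_cast n.pos
  obtain ⟨μ, rfl, -, -, hiid⟩ := hX.exists_law h hT hC hM
  have hXm := fun j => (hX.solution j).measurable
  have hYm := hY.measurable
  have hξm := hM.measurable_edge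
  let D : ℕ → Icc (0 : ℝ) T → Ω → ℝ≥0∞ := fun i t ω =>
    jumpDist γ g (Y i ω) (X i ω) (edgeFlow n Y (ξ i) ω) (flowOf μ θ) (N i ω) t
  have hmono : ∀ i ω, Monotone fun t => D i t ω := fun i ω => jumpDist_mono _ _ _ _ _
  have hle : ∀ i < (n : ℕ), ∀ᵐ ω ∂P, ∀ t, ‖Y i ω t - X i ω t‖ₑ ≤ D i t ω := by
    intro i hi
    have hN := hM.isNode i
    filter_upwards [(h.ae_solvesEquation_activeKernel hT hC hN _ _).1 (hY.solution i hi).equation,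
      (h.ae_solvesEquation_activeKernel hT hC hN _ _).1 (hX.solution i).equation] with ω h1 h2 t
    exact h1.enorm_sub_le h2 t
  -- The empirical measure involves every node, so Gronwall's inequality is applied to the largest
  -- mean over the nodes; exchangeability is not needed.
  let v : Icc (0 : ℝ) T → ℝ≥0∞ := fun t => ⨆ i : Fin n, ∫⁻ ω, D i t ω ∂P
  have hv : Monotone v := fun s t hst => iSup_mono fun i => lintegral_mono fun ω => hmono i ω hst
  have hDv : ∀ i < (n : ℕ), ∀ t, ∫⁻ ω, D i t ω ∂P ≤ v t := fun i hi t =>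
    le_iSup (fun i : Fin n => ∫⁻ ω, D i t ω ∂P) ⟨i, hi⟩
  let K : ℝ≥0 := (2 * jumpConst ρ g).toNNReal
  have hK : (K : ℝ≥0∞) = 2 * jumpConst ρ g :=
    ENNReal.coe_toNNReal (ENNReal.mul_ne_top (by norm_num) hC.ne)
  -- The inhomogeneous term is the fluctuation `1 / √n`, integrated over time and multiplied by the
  -- jump constant.
  let a : ℝ≥0∞ := ENNReal.ofReal T * jumpConst ρ g * ENNReal.ofReal (1 / √(n : ℝ))
  have hmass : timeMeasure T univ = ENNReal.ofReal T := by
    rw [timeMeasure, comap_subtype_coe_apply measurableSet_Icc, image_univ, Subtype.range_coe,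
      Real.volume_Icc, sub_zero]
  have hu : ∀ t, v t ≤ a + K * ∫⁻ s in {s | s ≤ t}, v s ∂(timeMeasure T) := by
    intro t
    refine iSup_le fun ⟨i, hi⟩ => ?_
    have hN := hM.isNode i
    have hYa : ∀ j < (n : ℕ), ∀ t, Measurable[completedFiltration P F t] fun ω => Y j ω t :=
      fun j hj t => IsAEAdapted.measurable (hY.solution j hj).adapted (hYm j) t
    refine (h.lintegral_jumpDist_le hT hC hN.poisson hN.indepFuture.completedFiltration
      (edgeFlow_leftLimit n Y (ξ i)) (fun _ => flowOf_leftLimit μ θ)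
      (fun t y => measurable_totalRate_edgeFlow (fun j hj => hYa j hj t)
        (fun j _ => (hM.edge_adapted i j t).mono (le_completedFiltration F t) le_rfl)
        (hYa i hi t) y)
      (fun t y => IsAEAdapted.measurable_totalRate (hX.solution i).adapted (hXm i) _ t y)
      (v := fun t => 2 * v t + ENNReal.ofReal (1 / √(n : ℝ)))
      (fun s t hst => add_le_add_left (mul_le_mul_right (hv hst) 2) _)
      (fun t y => h.lintegral_totalRate_particle_sub_le hXm hYm (hξm i) (hiid i).1 (hiid i).2 y hi t
        fun j hj => (lintegral_mono_ae ((hle j hj).mono fun ω hω => hω t)).trans (hDv j hj t))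
      t).trans ?_
    rw [lintegral_add_right _ measurable_const, lintegral_const_mul _ hv.measurable,
      setLIntegral_const, mul_add, add_comm, hK]
    refine add_le_add ?_ (le_of_eq (by ring))
    calc _ ≤ jumpConst ρ g * (ENNReal.ofReal (1 / √(n : ℝ)) * ENNReal.ofReal T) := by
          rw [← hmass]
          gcongr
          exact subset_univ _
      _ = a := by ring
  have huM : ∀ t, v t ≤ ENNReal.ofReal T * jumpConst ρ g := fun t => iSup_le fun i =>
    (lintegral_mono fun ω => jumpDist_le_jumpMass _ _ _ _ _ _).trans
      (lintegral_jumpMass_le hT hC (hM.isNode i).poisson (hM.isNode i).indepFuture)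
  have hfin := le_of_le_add_lintegral K (ENNReal.mul_ne_top ENNReal.ofReal_ne_top hC.ne) huM hu t₁
  -- The value at the final time dominates the distance at all times and is measurable, so it serves
  -- both for the mean of the supremum and for Markov's inequality.
  refine ⟨D i t₁, ?_, ?_, ?_⟩
  · exact h.measurable_jumpDist hT (hM.poisson i).measurable (edgeFlow_leftLimit n Y (ξ i))
      (fun _ => flowOf_leftLimit μ θ)
      (fun t y => measurable_totalRate_edgeFlow
        (fun j _ => (PathSpace.measurable_eval t).comp (hYm j))
        (fun j _ => (PathSpace.measurable_eval t).comp (hξm i j))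
        ((PathSpace.measurable_eval t).comp (hYm i)) y)
      (fun t y => RateBound.measurable_totalRate_comp γ (hXm i) _ t y) t₁
  · filter_upwards [hle i hi] with ω hω t
    exact (hω t).trans (hmono i ω (show (t : ℝ) ≤ T from t.2.2))
  · refine ((hDv i hi t₁).trans hfin).trans (le_of_eq ?_)
    -- Gronwall's bound is `2 a exp(2 K T)` with `K` twice the jump constant, which is `2 / √n`
    -- times `picardConst`.
    rw [div_eq_mul_one_div, ENNReal.ofReal_mul (by positivity), ENNReal.ofReal_mul (by norm_num),
      ENNReal.ofReal_toReal (picardConst_ne_top hC), ENNReal.ofReal_ofNat]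
    show 2 * (ENNReal.ofReal T * jumpConst ρ g * _) * ENNReal.ofReal (Real.exp (2 * K * T)) =
      2 * (ENNReal.ofReal T * jumpConst ρ g * ENNReal.ofReal (Real.exp (2 * K * T))) * _
    ring

end Rate

end EdgeMeanField

namespace EdgeMeanField

/-! ### Convergence in probability and in distribution -/

section ConvergenceInProbability

variable {Ω ι E : Type*} [mΩ : MeasurableSpace Ω] {P : Measure Ω}

/-- The filter of the sets that contain the values with probability tending to one. -/
def probFilter (P : Measure Ω) (l : Filter ι) (Z : ι → Ω → E) : Filter E where
  sets := {V | Tendsto (fun n => P {ω | Z n ω ∉ V}) l (𝓝 0)}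
  univ_sets := by simpa using tendsto_const_nhds
  sets_of_superset {V W} hV hVW :=
    tendsto_of_tendsto_of_tendsto_of_le_of_le tendsto_const_nhds hV (fun _ => zero_le)
      fun n => measure_mono fun ω hω hV => hω (hVW hV)
  inter_sets {V W} hV hW := by
    have h := Tendsto.add (mem_ofPred_eq ▸ hV : Tendsto _ _ _) (mem_ofPred_eq ▸ hW : Tendsto _ _ _)
    rw [add_zero] at h
    refine tendsto_of_tendsto_of_tendsto_of_le_of_le tendsto_const_nhds h (fun _ => zero_le)
      fun n => (measure_mono fun ω hω => ?_).trans (measure_union_le _ _)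
    by_contra hn
    rw [mem_union, not_or] at hn
    exact hω ⟨not_not.1 hn.1, not_not.1 hn.2⟩

theorem tendstoInProb_iff_probFilter_le [TopologicalSpace E] {l : Filter ι} {Z : ι → Ω → E} {z : E} :
    TendstoInProb P l Z z ↔ probFilter P l Z ≤ 𝓝 z := Iff.rfl

/-- Convergence in probability in the weak topology may be tested on bounded continuous
functions. -/
theorem tendstoInProb_of_forall_integral [TopologicalSpace E] [MeasurableSpace E]
    [OpensMeasurableSpace E] {l : Filter ι} {Z : ι → Ω → ProbabilityMeasure E}
    {π : ProbabilityMeasure E}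
    (h : ∀ f : BoundedContinuousFunction E ℝ, TendstoInProb P l
      (fun n ω => ∫ a, f a ∂(Z n ω : Measure E)) (∫ a, f a ∂(π : Measure E))) :
    TendstoInProb P l Z π := by
  rw [tendstoInProb_iff_probFilter_le]
  -- As a statement about one filter, convergence in probability obeys the criterion that
  -- characterizes weak convergence along any filter.
  have : Tendsto id (probFilter P l Z) (𝓝 π) := by
    rw [ProbabilityMeasure.tendsto_iff_forall_integral_tendsto]
    exact fun f V hV => h f V hV
  exact this

theorem tendstoInProb_of_lintegral_le {l : Filter ι} {W : ι → Ω → ℝ} {m : ℝ}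
    (hW : ∀ n, Measurable (W n)) {b : ι → ℝ≥0∞} (hb : Tendsto b l (𝓝 0))
    (h : ∀ n, ∫⁻ ω, ‖W n ω - m‖ₑ ∂P ≤ b n) : TendstoInProb P l W m := by
  rw [tendstoInProb_iff_dist (d := inferInstance) rfl]
  intro ε hε
  have hε' : ENNReal.ofReal ε ≠ 0 := by simpa using hε
  have hlim : Tendsto (fun n => b n / ENNReal.ofReal ε) l (𝓝 0) := by
    have := ENNReal.Tendsto.div_const hb (b := ENNReal.ofReal ε) (Or.inr hε')
    rwa [ENNReal.zero_div] at this
  refine tendsto_of_tendsto_of_tendsto_of_le_of_le tendsto_const_nhds hlim (fun _ => zero_le)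
    fun n => ?_
  refine le_trans (measure_mono fun ω hω => ?_)
    ((meas_ge_le_lintegral_div ((hW n).sub_const m).enorm.aemeasurable hε'
      ENNReal.ofReal_ne_top).trans (ENNReal.div_le_div_right (h n) _))
  show ENNReal.ofReal ε ≤ ‖W n ω - m‖ₑ
  rw [← edist_eq_enorm_sub, edist_dist]
  exact ENNReal.ofReal_le_ofReal hω

theorem tendsto_ofReal_div_sqrt (c : ℝ) :
    Tendsto (fun n : ℕ+ => ENNReal.ofReal (c / √(n : ℝ))) atTop (𝓝 0) := by
  rw [← ENNReal.ofReal_zero]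
  refine ENNReal.tendsto_ofReal (Tendsto.div_atTop tendsto_const_nhds ?_)
  exact Real.tendsto_sqrt_atTop.comp (tendsto_natCast_atTop_atTop.comp tendsto_PNat_val_atTop_atTop)

theorem lintegral_enorm_comp_sub_le {A : Type*} {f : A → ℝ} {c : ℝ} (hc : ∀ a, |f a| ≤ c)
    (U V : Ω → A) : ∫⁻ ω, ‖f (U ω) - f (V ω)‖ₑ ∂P ≤ ENNReal.ofReal (2 * c) * P {ω | U ω ≠ V ω} := by
  refine le_trans (lintegral_mono fun ω => ?_) (lintegral_indicator_const_le _ _)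
  by_cases h : U ω = V ω
  · simp [h]
  · rw [indicator_of_mem (show ω ∈ {ω | U ω ≠ V ω} from h), ← ofReal_norm, Real.norm_eq_abs]
    refine ENNReal.ofReal_le_ofReal ((abs_sub _ _).trans ?_)
    linarith [hc (U ω), hc (V ω)]

/-- A sequence that agrees with a fixed random element with probability tending to one converges
in distribution. -/
theorem tendstoInDistribution_of_measure_ne [IsProbabilityMeasure P] [TopologicalSpace E]
    [MeasurableSpace E] [OpensMeasurableSpace E] {l : Filter ι} {U : ι → Ω → E} {V : Ω → E}
    (hU : ∀ n, Measurable (U n)) (hV : Measurable V) {π : Measure E} [IsProbabilityMeasure π]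
    (hπ : P.map V = π) (h : Tendsto (fun n => P {ω | U n ω ≠ V ω}) l (𝓝 0)) :
    TendstoInDistribution U l id (fun _ => P) π := by
  refine ⟨fun n => (hU n).aemeasurable, aemeasurable_id,
    ProbabilityMeasure.tendsto_iff_forall_integral_tendsto.2 fun f => ?_⟩
  have hfm := f.continuous.measurable
  have e1 : ∀ n, ∫ a, f a ∂(P.map (U n)) = ∫ ω, f (U n ω) ∂P := fun n =>
    integral_map (hU n).aemeasurable hfm.aestronglyMeasurable
  have e2 : ∫ a, f a ∂(π.map id) = ∫ ω, f (V ω) ∂P := by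
    rw [Measure.map_id, ← hπ]
    exact integral_map hV.aemeasurable hfm.aestronglyMeasurable
  have hi : ∀ W : Ω → E, Measurable W → Integrable (fun ω => f (W ω)) P := fun W hW =>
    Integrable.of_bound (hfm.comp hW).aestronglyMeasurable ‖f‖
      (Eventually.of_forall fun ω => f.norm_coe_le_norm _)
  show Tendsto (fun n => ∫ a, f a ∂(P.map (U n))) l (𝓝 (∫ a, f a ∂(π.map id)))
  simp_rw [e1]
  rw [e2, tendsto_iff_edist_tendsto_0]
  have hlim : Tendsto (fun n => ENNReal.ofReal (2 * ‖f‖) * P {ω | U n ω ≠ V ω}) l (𝓝 0) := by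
    have := ENNReal.Tendsto.const_mul (a := ENNReal.ofReal (2 * ‖f‖)) h
      (Or.inr ENNReal.ofReal_ne_top)
    rwa [mul_zero] at this
  refine tendsto_of_tendsto_of_tendsto_of_le_of_le tendsto_const_nhds hlim (fun _ => zero_le)
    fun n => ?_
  -- For any bounded function the means differ by at most twice its bound times the probability of
  -- disagreement.
  rw [edist_eq_enorm_sub, ← integral_sub (hi _ (hU n)) (hi _ hV)]
  exact (enorm_integral_le_lintegral_enorm _).trans
    (lintegral_enorm_comp_sub_le (fun a => f.norm_coe_le_norm a) (U n) V)

end ConvergenceInProbability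

/-! ### Propagation of chaos and laws of large numbers -/

section Conclusions

variable {T : ℝ} {Ω : Type*} [mΩ : MeasurableSpace Ω] {P : Measure Ω} [IsProbabilityMeasure P]
  {X : ℕ → Ω → PathSpace T ℤ} {Y : ℕ+ → ℕ → Ω → PathSpace T ℤ} {κ : ℝ}

omit [IsProbabilityMeasure P] in
theorem tendsto_measure_exists_ne
    (hκ : ∀ (n : ℕ+), ∀ i < (n : ℕ), P {ω | Y n i ω ≠ X i ω} ≤ ENNReal.ofReal (κ / √(n : ℝ)))
    (k : ℕ) : Tendsto (fun n : ℕ+ => P {ω | ∃ i : Fin k, Y n i ω ≠ X i ω}) atTop (𝓝 0) := by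
  have hlim : Tendsto (fun n : ℕ+ => (k : ℝ≥0∞) * ENNReal.ofReal (κ / √(n : ℝ))) atTop (𝓝 0) := by
    have := ENNReal.Tendsto.const_mul (a := (k : ℝ≥0∞)) (tendsto_ofReal_div_sqrt κ)
      (Or.inr (ENNReal.natCast_ne_top k))
    rwa [mul_zero] at this
  refine tendsto_of_tendsto_of_tendsto_of_le_of_le' tendsto_const_nhds hlim
    (Eventually.of_forall fun _ => zero_le) ?_
  filter_upwards [tendsto_PNat_val_atTop_atTop.eventually (eventually_ge_atTop k)] with n hn
  have e : {ω | ∃ i : Fin k, Y n i ω ≠ X i ω} = ⋃ i : Fin k, {ω | Y n i ω ≠ X i ω} := by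
    ext; simp
  rw [e]
  refine (measure_iUnion_fintype_le _ _).trans
    ((Finset.sum_le_sum fun (i : Fin k) _ => hκ n i (i.2.trans_le hn)).trans ?_)
  simp

/-- The map `h` is the identity for laws of paths and an evaluation for marginals. It only has to be
measurable, because the particles equal the limiting nodes with probability tending to one;
evaluations need not be Skorokhod continuous. -/
theorem tendstoInDistribution_particles (hY : ∀ n i, Measurable (Y n i))
    (hX : ∀ i, Measurable (X i)) (hind : iIndepFun X P) {μ : ProbabilityMeasure (PathSpace T ℤ)}
    (hlaw : ∀ i, P.map (X i) = μ)
    (hκ : ∀ (n : ℕ+), ∀ i < (n : ℕ), P {ω | Y n i ω ≠ X i ω} ≤ ENNReal.ofReal (κ / √(n : ℝ)))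
    {E : Type*} [TopologicalSpace E] [SecondCountableTopology E] [MeasurableSpace E]
    [OpensMeasurableSpace E] {h : PathSpace T ℤ → E} (hh : Measurable h)
    {π : Measure E} [IsProbabilityMeasure π] (hπ : (μ : Measure (PathSpace T ℤ)).map h = π) (k : ℕ) :
    TendstoInDistribution (fun (n : ℕ+) ω (i : Fin k) => h (Y n i ω)) atTop id
      (fun _ => P) (Measure.pi fun _ => π) := by
  refine tendstoInDistribution_of_measure_ne (V := fun ω (i : Fin k) => h (X i ω))
    (fun n => measurable_pi_lambda _ fun i => hh.comp (hY n i))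
    (measurable_pi_lambda _ fun i => hh.comp (hX i)) ?_ ?_
  · have h1 : iIndepFun (fun (i : Fin k) ω => h (X i ω)) P :=
      (hind.precomp (g := fun i : Fin k => (i : ℕ)) Fin.val_injective).comp (fun _ => h) fun _ => hh
    have h2 : ∀ i : Fin k, Measurable fun ω => h (X i ω) := fun i => hh.comp (hX i)
    rw [(iIndepFun_iff_map_fun_eq_pi_map fun i => (h2 i).aemeasurable).1 h1]
    congr 1
    ext1 i
    rw [← hπ, ← hlaw i, Measure.map_map hh (hX i)]
    rfl
  · refine tendsto_of_tendsto_of_tendsto_of_le_of_le tendsto_const_nhds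
      (tendsto_measure_exists_ne hκ k) (fun _ => zero_le) fun n => measure_mono fun ω hω => ?_
    by_contra hne
    refine hω (funext fun i => ?_)
    by_contra hi
    exact hne ⟨i, fun he => hi (congrArg h he)⟩

/-- Replacing particles by limiting nodes costs `2 ‖f‖ κ / √n` in mean, and the i.i.d. average
deviates by `2 ‖f‖ / √n`. Neither bound depends on the node, so the node may vary with `n`. -/
theorem tendstoInProb_empiricalMeasure {ξ : ℕ → ℕ → Ω → PathSpace T ℤ}
    (hY : ∀ n i, Measurable (Y n i)) (hX : ∀ i, Measurable (X i)) (hξ : ∀ i j, Measurable (ξ i j))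
    {μ θ : ProbabilityMeasure (PathSpace T ℤ)}
    (hiid : ∀ i, iIndepFun (fun j ω => (X j ω, ξ i j ω)) P ∧
      ∀ j, P.map (fun ω => (X j ω, ξ i j ω)) = (μ : Measure (PathSpace T ℤ)).prod θ)
    (hκ : ∀ (n : ℕ+), ∀ i < (n : ℕ), P {ω | Y n i ω ≠ X i ω} ≤ ENNReal.ofReal (κ / √(n : ℝ)))
    {E : Type*} [TopologicalSpace E] [MeasurableSpace E] [OpensMeasurableSpace E]
    {h : PathSpace T ℤ × PathSpace T ℤ → E} (hh : Measurable h) {π : ProbabilityMeasure E}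
    (hπ : ((μ : Measure (PathSpace T ℤ)).prod (θ : Measure (PathSpace T ℤ))).map h = π)
    (i : ℕ+ → ℕ) :
    TendstoInProb P atTop (fun (n : ℕ+) ω => empiricalMeasure n fun j =>
      h (Y n j ω, ξ (i n) j ω)) π := by
  refine tendstoInProb_of_forall_integral fun f => ?_
  have hfm : Measurable fun p => f (h p) := f.continuous.measurable.comp hh
  have hfb : ∀ p, |f (h p)| ≤ ‖f‖ := fun p => f.norm_coe_le_norm _
  simp_rw [integral_empiricalMeasure _ _ f.continuous.measurable.stronglyMeasurable]
  have hm : ∫ a, f a ∂(π : Measure E) =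
      ∫ p, f (h p) ∂((μ.prod θ : ProbabilityMeasure _) : Measure (PathSpace T ℤ × PathSpace T ℤ)) := by
    rw [← hπ]
    exact integral_map hh.aemeasurable f.continuous.measurable.aestronglyMeasurable
  rw [hm]
  set m := ∫ p, f (h p) ∂((μ.prod θ : ProbabilityMeasure _) :
    Measure (PathSpace T ℤ × PathSpace T ℤ)) with hmdef
  have hmb : |m| ≤ ‖f‖ := by
    refine (norm_integral_le_of_norm_le_const (f := fun p => f (h p)) (C := ‖f‖)
      (Eventually.of_forall hfb)).trans ?_
    simp
  have hYξ : ∀ n j, Measurable fun ω => f (h (Y n j ω, ξ (i n) j ω)) := fun n j =>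
    hfm.comp ((hY n j).prodMk (hξ (i n) j))
  have hXξ : ∀ n j, Measurable fun ω => f (h (X j ω, ξ (i n) j ω)) := fun n j =>
    hfm.comp ((hX j).prodMk (hξ (i n) j))
  refine tendstoInProb_of_lintegral_le
    (b := fun n : ℕ+ => ENNReal.ofReal (2 * ‖f‖ * κ / √(n : ℝ)) + ENNReal.ofReal (2 * ‖f‖ / √(n : ℝ)))
    (fun n => measurable_const.mul (Finset.measurable_sum _ fun j _ => hYξ n j)) ?_ fun n => ?_
  · simpa using (tendsto_ofReal_div_sqrt (2 * ‖f‖ * κ)).add (tendsto_ofReal_div_sqrt (2 * ‖f‖))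
  have hn : (0 : ℝ) < n := by exact_mod_cast n.pos
  have e : ‖(n : ℝ)⁻¹‖ₑ = (n : ℝ≥0∞)⁻¹ := by
    rw [Real.enorm_of_nonneg (by positivity), ENNReal.ofReal_inv_of_pos hn, ENNReal.ofReal_natCast]
  have hsub : ∀ j, Measurable fun ω =>
      ‖f (h (Y n j ω, ξ (i n) j ω)) - f (h (X j ω, ξ (i n) j ω))‖ₑ := fun j =>
    ((hYξ n j).sub (hXξ n j)).enorm
  calc _ ≤ ∫⁻ ω, ((n : ℝ≥0∞)⁻¹ * ∑ j ∈ Finset.range n,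
          ‖f (h (Y n j ω, ξ (i n) j ω)) - f (h (X j ω, ξ (i n) j ω))‖ₑ +
        ‖(n : ℝ)⁻¹ * ∑ j ∈ Finset.range n, f (h (X j ω, ξ (i n) j ω)) - m‖ₑ) ∂P := by
        refine lintegral_mono fun ω => ?_
        rw [← sub_add_sub_cancel _ ((n : ℝ)⁻¹ * ∑ j ∈ Finset.range n, f (h (X j ω, ξ (i n) j ω)))]
        refine (enorm_add_le _ _).trans (add_le_add ?_ le_rfl)
        rw [← mul_sub, ← Finset.sum_sub_distrib, enorm_mul, e]
        gcongr
        exact enorm_sum_le _ _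
    _ = (n : ℝ≥0∞)⁻¹ * ∑ j ∈ Finset.range n,
          ∫⁻ ω, ‖f (h (Y n j ω, ξ (i n) j ω)) - f (h (X j ω, ξ (i n) j ω))‖ₑ ∂P +
        ∫⁻ ω, ‖(n : ℝ)⁻¹ * ∑ j ∈ Finset.range n, f (h (X j ω, ξ (i n) j ω)) - m‖ₑ ∂P := by
        rw [lintegral_add_left ((Finset.measurable_sum _ fun j _ => hsub j).const_mul _),
          lintegral_const_mul _ (Finset.measurable_sum _ fun j _ => hsub j),
          lintegral_finsetSum _ fun j _ => hsub j]
    _ ≤ (n : ℝ≥0∞)⁻¹ * ∑ _j ∈ Finset.range n, ENNReal.ofReal (2 * ‖f‖ * κ / √(n : ℝ)) +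
        ENNReal.ofReal (2 * ‖f‖ / √(n : ℝ)) := by
        refine add_le_add ?_ ?_
        · refine mul_le_mul_right (Finset.sum_le_sum fun j hj => ?_) _
          refine (lintegral_enorm_comp_sub_le hfb (fun ω => (Y n j ω, ξ (i n) j ω))
            (fun ω => (X j ω, ξ (i n) j ω))).trans ?_
          rw [mul_div_assoc, ENNReal.ofReal_mul (p := 2 * ‖f‖) (q := κ / √(n : ℝ)) (by positivity)]
          refine mul_le_mul_right ?_ _
          refine (measure_mono fun ω hω => ?_).trans (hκ n j (Finset.mem_range.1 hj))
          exact fun he => hω (Prod.ext he rfl)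
        -- The function ignores its first argument, so the conditional mean is the constant `m` and
        -- the estimate is the ordinary weak law.
        · exact lintegral_average_sub_le (h := fun _ p => f (h p))
            (fun j => (hX j).prodMk (hξ (i n) j)) (hiid (i n)).1 (π := μ.prod θ) (hiid (i n)).2
            (hfm.comp measurable_snd)
            (fun _ b => (abs_sub _ _).trans (by linarith [hfb b]))
            (fun _ => Integrable.of_bound hfm.aestronglyMeasurable ‖f‖ (Eventually.of_forall hfb))
            (i n) n
    _ = _ := by rw [inv_mul_sum_range_const]

end Conclusions

end EdgeMeanField

namespace EdgeMeanField

/-- Different integer paths are at uniform distance at least one, so the majorant is at least one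
where they differ; Markov's inequality applies. -/
theorem IsParticleSystem.measure_ne_le {T : ℝ} {γ : ℤ → ℤ → ℤ → ℤ → ℝ} {g : ℤ → ℝ} {Ω : Type*}
    [mΩ : MeasurableSpace Ω] {P : Measure Ω} [IsProbabilityMeasure P]
    {F : Filtration (Icc (0 : ℝ) T) mΩ} {ρ : Measure ℤ} [IsFiniteMeasure ρ] {X₀ : ℕ → Ω → ℤ}
    {N : ℕ → Ω → Measure (MarkSpace T)} {ξ : ℕ → ℕ → Ω → PathSpace T ℤ}
    {θ : ProbabilityMeasure (PathSpace T ℤ)} (h : RateBound γ g) (hT : 0 ≤ T)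
    (hC : jumpConst ρ g < ∞) (hM : IsModel P F ρ θ X₀ N ξ) {X : ℕ → Ω → PathSpace T ℤ}
    {ν : Icc (0 : ℝ) T → ProbabilityMeasure (ℤ × ℤ)} (hX : IsLimitSystem P F γ X₀ N ξ X ν) {n : ℕ+}
    {Y : ℕ → Ω → PathSpace T ℤ} (hY : IsParticleSystem P F γ X₀ N ξ n Y) {i : ℕ} (hi : i < n) :
    P {ω | Y i ω ≠ X i ω} ≤ ENNReal.ofReal (2 * (picardConst T ρ g).toReal / √(n : ℝ)) := by
  obtain ⟨D, hD, hle, hint⟩ := hY.exists_majorant h hT hC hM hX hi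
  have h1 : P {ω | 1 ≤ D ω} ≤ ∫⁻ ω, D ω ∂P := by
    simpa using mul_meas_ge_le_lintegral hD 1
  refine le_trans (measure_mono_ae ?_) (h1.trans hint)
  filter_upwards [hle] with ω hω hne
  show 1 ≤ D ω
  by_contra hlt
  exact hne (path_eq_of_jumpDist_eq_zero (D := fun _ => D ω) monotone_const hω
    (t₁ := ⟨T, hT, le_rfl⟩) rfl (not_le.1 hlt))

end EdgeMeanField

theorem mainTheorem3 {T : ℝ} (hT : 0 < T) (ρ : Measure ℤ) [IsFiniteMeasure ρ]
    (γ : ℤ → ℤ → ℤ → ℤ → ℝ) (hγ : BoundedRates ρ γ) :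
    ∃ κ : ℝ, ∀ (Ω : Type*) [mΩ : MeasurableSpace Ω] (P : Measure Ω) [IsProbabilityMeasure P]
      (F : Filtration (Icc (0 : ℝ) T) mΩ) (θ : ProbabilityMeasure (PathSpace T ℤ))
      (X₀ : ℕ → Ω → ℤ) (N : ℕ → Ω → Measure (MarkSpace T)) (ξ : ℕ → ℕ → Ω → PathSpace T ℤ),
      IsModel P F ρ θ X₀ N ξ →
      -- existence and pathwise uniqueness for the limiting system
      (∃ X ν, IsLimitSystem P F γ X₀ N ξ X ν) ∧
      (∀ X ν X' ν', IsLimitSystem P F γ X₀ N ξ X ν → IsLimitSystem P F γ X₀ N ξ X' ν' →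
        ν = ν' ∧ ∀ᵐ ω ∂P, ∀ i, X i ω = X' i ω) ∧
      ∀ X ν, IsLimitSystem P F γ X₀ N ξ X ν →
      ∀ Xn : ℕ+ → ℕ → Ω → PathSpace T ℤ, (∀ n, IsParticleSystem P F γ X₀ N ξ n (Xn n)) →
        -- rate of convergence
        (∀ (n : ℕ+) (i : ℕ), i < n →
          ∫⁻ ω, ⨆ t, ‖Xn n i ω t - X i ω t‖ₑ ∂P ≤ ENNReal.ofReal (κ / √(n : ℝ))) ∧
        ∃ μ : ProbabilityMeasure (PathSpace T ℤ), (∀ i, HasLaw (X i) (μ : Measure _) P) ∧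
          -- propagation of chaos
          (∀ k : ℕ,
            TendstoInDistribution (fun (n : ℕ+) ω (i : Fin k) => Xn n i ω) atTop id
              (fun _ => P) (Measure.pi fun _ => (μ : Measure (PathSpace T ℤ))) ∧
            ∀ t, TendstoInDistribution (fun (n : ℕ+) ω (i : Fin k) => Xn n i ω t) atTop id
              (fun _ => P) (Measure.pi fun _ => (PathSpace.marginal μ t : Measure ℤ))) ∧
          -- law of large numbers for the local empirical measures
          (∀ i : ℕ+ → ℕ, (∀ᶠ n : ℕ+ in atTop, i n < n) →
            TendstoInProb P atTop (fun (n : ℕ+) ω =>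
              empiricalMeasure n fun j => PathSpace.prodMk (Xn n j ω) (ξ (i n) j ω))
              (PathSpace.prodLaw μ θ) ∧
            ∀ t, TendstoInProb P atTop (fun (n : ℕ+) ω =>
              empiricalMeasure n fun j => (Xn n j ω t, ξ (i n) j ω t)) (ν t)) ∧
          -- law of large numbers for the empirical measures of the nodes
          TendstoInProb P atTop (fun (n : ℕ+) ω => empiricalMeasure n fun j => Xn n j ω) μ ∧
          ∀ t, TendstoInProb P atTop (fun (n : ℕ+) ω => empiricalMeasure n fun j => Xn n j ω t)
            (PathSpace.marginal μ t) := by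
  obtain ⟨g, hg0, h, hgi⟩ := hγ
  have h : RateBound γ g := h
  have hC : jumpConst ρ g < ∞ := jumpConst_lt_top hg0 hgi
  have hT' := hT.le
  -- The majorant `g` comes from the hypothesis on the rates alone, so the constant is fixed before
  -- the probability space.
  refine ⟨2 * (picardConst T ρ g).toReal, fun Ω mΩ P _ F θ X₀ N ξ hM => ⟨?_, ?_, ?_⟩⟩
  · obtain ⟨ψ, ν, -, hX⟩ := hM.exists_limitSystem h hT' hC
    exact ⟨_, ν, hX⟩
  · exact fun X ν X' ν' hX hX' => hX.unique h hT' hC hM hX'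
  intro X ν hX Y hY
  have hYm := fun n => (hY n).measurable
  have hXm := fun i => (hX.solution i).measurable
  have hne : ∀ (n : ℕ+), ∀ i < (n : ℕ), P {ω | Y n i ω ≠ X i ω} ≤
      ENNReal.ofReal (2 * (picardConst T ρ g).toReal / √(n : ℝ)) := fun n i hi =>
    (hY n).measure_ne_le h hT' hC hM hX hi
  obtain ⟨μ, rfl, hlaw, hind, hiid⟩ := hX.exists_law h hT' hC hM
  have hev := fun t => PathSpace.measurable_eval (S := ℤ) (T := T) t
  refine ⟨fun n i hi => ?_, μ, fun i => ⟨(hXm i).aemeasurable, hlaw i⟩, fun k => ⟨?_, fun t => ?_⟩,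
    fun i _ => ⟨?_, fun t => ?_⟩, ?_, fun t => ?_⟩
  · obtain ⟨D, -, hle, hint⟩ := (hY n).exists_majorant h hT' hC hM hX hi
    exact (lintegral_mono_ae (hle.mono fun ω hω => iSup_le hω)).trans hint
  · exact tendstoInDistribution_particles hYm hXm hind hlaw hne measurable_id Measure.map_id k
  · exact tendstoInDistribution_particles hYm hXm hind hlaw hne (hev t)
      (π := (PathSpace.marginal μ t : Measure ℤ)) rfl k
  · exact tendstoInProb_empiricalMeasure hYm hXm hM.measurable_edge hiid hne
      PathSpace.measurable_prodMk rfl i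
  · exact tendstoInProb_empiricalMeasure hYm hXm hM.measurable_edge hiid hne
      (((hev t).comp measurable_fst).prodMk ((hev t).comp measurable_snd))
      (coe_flowOf_eq_map μ θ t).symm i
  -- The empirical measure of the nodes is obtained by projecting away the edges, here those of node
  -- `0`.
  · exact tendstoInProb_empiricalMeasure hYm hXm hM.measurable_edge hiid hne measurable_fst
      (by rw [← Measure.fst, Measure.fst_prod]) fun _ => 0
  · refine tendstoInProb_empiricalMeasure hYm hXm hM.measurable_edge hiid hne
      ((hev t).comp measurable_fst) ?_ fun _ => 0
    rw [← Measure.map_map (hev t) measurable_fst, ← Measure.fst, Measure.fst_prod]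
    rfl
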